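/- Let $\mathbb{R}^{4,2}$ be $\mathbb{R}^6$ with an inner product $(\cdot,\cdot)$ of signature $(4,2)$, identify $a\wedge b$ with the skew endomorphism $c\mapsto (a,c)b-(b,c)a$, and let $\Sigma$ be a connected smooth $2$-manifold. For a subbundle $W$ of the trivial bundle $\underline{\mathbb{R}}^{4,2}=\Sigma\times\mathbb{R}^{4,2}$ let $W^{(1)}$ be spanned by the values and first derivatives of sections of $W$. A *Legendre map* is a smooth rank $2$ isotropic subbundle $f$ with $f^{(1)}\le f^\perp$ such that $d_X\sigma\in f$ for all sections $\sigma$ of $f$ only if $X=0$. A line $s(x)\le f(x)$ is a *curvature sphere* at $x$ if there is $X\neq 0$ in $T_x\Sigma$ with $d_X\sigma\in f(x)$ for all sections $\sigma$ of $f$ with $\sigma(x)\in s(x)$; $f$ is *umbilic-free* if it has two distinct curvature spheres at every point. Then, with local lifts $\sigma_1,\sigma_2$ of the curvature spheres and vector fields $X_1,X_2$ spanning their curvature directions, $\underline{\mathbb{R}}^{4,2}=S_1\oplus_\perp S_2$, where $S_1=\langle\sigma_1,d_{X_2}\sigma_1,d_{X_2}d_{X_2}\sigma_1\rangle$ and $S_2=\langle\sigma_2,d_{X_1}\sigma_2,d_{X_1}d_{X_1}\sigma_2\rangle$.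 An *umbilic-free $\Omega$-surface* is an umbilic-free Legendre map $f$ with a closed $1$-form $\eta\in\Omega^1(f\wedge f^\perp)$, $[\eta\wedge\eta]=0$, whose quadratic differential $q(X,Y)=\mathrm{tr}(\sigma\mapsto\eta(X)d_Y\sigma:f\to f)$ is non-degenerate; $\eta$ is a *middle potential* if its $S_1\wedge S_2$-component takes values in $\wedge^2 f$. The $\Omega$-surface is *special of type $1$* if, for its middle potential $\eta$, there is a degree $1$ polynomial $p(t)=p_0+tp_1$ of sections of $\underline{\mathbb{R}}^{4,2}$ with $(d+t\eta)p(t)=0$ for all $t\in\mathbb{R}$ (a linear conserved quantity). Let $\mathfrak{p}\in\mathbb{R}^{4,2}$ with $(\mathfrak{p},\mathfrak{p})\ne0$. A *sphere congruence* in $\langle\mathfrak{p}\rangle^\perp$ is a rank $4$ subbundle $V\le\langle\mathfrak{p}\rangle^\perp$ of signature $(3,1)$; write $d=\mathcal{D}^V+\mathcal{N}^V$, where $\mathcal{D}^V$ is the sum of the induced connections on $V$ and $V^\perp$. A null line subbundle $\Lambda\le\langle\mathfrak{p}\rangle^\perp$ is a *Guichard (Möbius flat) surface* in the conformal geometry of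 $\langle\mathfrak{p}\rangle^\perp$ if for some sphere congruence $V$ with $\Lambda^{(1)}\le V$ (enveloped by $\Lambda$) there is $\chi\in\Omega^1(\Lambda\wedge\Lambda^{(1)})$ such that $\mathcal{D}^V+t\mathcal{N}^V+(t^2-1)\chi$ is flat for all $t\in\mathbb{R}$; its quadratic differential is $$q^\Lambda(X,Y)=2\,\mathrm{tr}(\sigma\mapsto\chi_X\mathcal{D}^V_Y\sigma:\Lambda\to\Lambda)+\mathrm{tr}(\mathcal{N}^V_X\circ\mathcal{N}^V_Y|_{V^\perp}),$$ and it is called *non-channel* if $q^\Lambda$ is non-degenerate. **Theorem.** (i) Let $f$ be a special $\Omega$-surface of type $1$ with middle potential $\eta$, quadratic differential $q$ and linear conserved quantity $p$ such that $(p(t),p(t))$ is linear (of degree exactly $1$) in $t$ with non-zero constant term. Then $\mathfrak{p}:=p(0)$ is constant, $(p(t),p(t))=a+bt$ with constants $a,b\neq0$, and $\Lambda:=f\cap\langle\mathfrak{p}\rangle^\perp$ is a non-channel Guichard surface in the conformal geometry of $\langle\mathfrak{p}\rangle^\perp$: there are an enveloped sphere congruence $V$ and $\chi$ as above, with $f=\Lambda\oplus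 s$ for a null line subbundle $s\le V^\perp$, and $q^\Lambda=\frac{2a}{b}\,q$. In particular $q^\Lambda=q$ when $\eta$ is scaled by a constant so that the root $-a/b$ of $(p(t),p(t))$ is $-\frac12$. (ii) Conversely, let $\Lambda$ be a non-channel Guichard surface in the conformal geometry of $\langle\mathfrak{p}\rangle^\perp$, with $V$ and $\chi$ as above, and let $s$ be a null line subbundle of $V^\perp$. If $\Lambda$ is an immersion, then $f:=\Lambda\oplus s$ is a Legendre map. Whenever $f$ is an umbilic-free Legendre map, $f\cap\langle\mathfrak{p}\rangle^\perp=\Lambda$, and $f$ is a special $\Omega$-surface of type $1$ having a middle potential with quadratic differential $q=q^\Lambda$ and with a linear conserved quantity $p$ such that $p(0)=\mathfrak{p}$ and $(p(t),p(t))=(\mathfrak{p},\mathfrak{p})(1+2t)$. -/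

import Mathlib

open scoped Manifold ContDiff

noncomputable section

namespace LieSphere

/-! ### The pseudo-Euclidean space of signature (4,2) -/

abbrev R42 : Type := Fin 6 → ℝ

abbrev EndR42 : Type := R42 →L[ℝ] R42

/-- The inner product of signature `(4,2)`. -/
def form : LinearMap.BilinForm ℝ R42 :=
  Matrix.toBilin' (Matrix.diagonal ![1, 1, 1, 1, -1, -1])

/-- The orthogonal complement of a subspace. -/
abbrev perp (W : Submodule ℝ R42) : Submodule ℝ R42 := form.orthogonal W

/-- `⟨v⟩^⊥`. -/
abbrev vperp (v : R42) : Submodule ℝ R42 := perp (Submodule.span ℝ {v})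

def IsIsotropic (W : Submodule ℝ R42) : Prop := W ≤ perp W

/-- `W` has induced signature `(3,1)`: it has an orthonormal basis with three spacelike vectors
and one timelike vector. -/
def HasSignature31 (W : Submodule ℝ R42) : Prop :=
  ∃ e : Fin 4 → R42, Submodule.span ℝ (Set.range e) = W ∧
    ∀ i j, form (e i) (e j) = (Matrix.diagonal ![1, 1, 1, -1] : Matrix (Fin 4) (Fin 4) ℝ) i j

/-- `a ∧ b` as a skew endomorphism: `(a ∧ b) c = (a,c) b - (b,c) a`. -/
def wedge (a b : R42) : EndR42 :=
  LinearMap.toContinuousLinearMap ((form a).smulRight b - (form b).smulRight a)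

/-- The space `U ∧ W` of endomorphisms spanned by all `a ∧ b`, `a ∈ U`, `b ∈ W`. -/
def wedgeSpan (U W : Submodule ℝ R42) : Submodule ℝ EndR42 :=
  Submodule.span ℝ {T | ∃ a ∈ U, ∃ b ∈ W, T = wedge a b}

open Classical in
/-- The orthogonal projection onto a non-degenerate subspace `W`
(set to be zero if `W` is degenerate). -/
def orthProj (W : Submodule ℝ R42) : EndR42 :=
  if h : IsCompl W (perp W) then LinearMap.toContinuousLinearMap (W.projection (perp W) h) else 0

/-! ### Calculus on a two-dimensional manifold -/

section Calculus

variable {M : Type*} [TopologicalSpace M] [ChartedSpace (EuclideanSpace ℝ (Fin 2)) M]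
variable {F : Type*} [NormedAddCommGroup F] [NormedSpace ℝ F]

/-- The derivative `X ↦ d_X σ` at `x` of a vector-valued function `σ`. -/
def der (σ : M → F) (x : M) : TangentSpace (𝓡 2) x →L[ℝ] F :=
  mfderiv (𝓡 2) 𝓘(ℝ, F) σ x

/-- One-forms on `M` with values in `F`. -/
abbrev OneForm (M : Type*) [TopologicalSpace M] [ChartedSpace (EuclideanSpace ℝ (Fin 2)) M]
    (F : Type*) [NormedAddCommGroup F] [NormedSpace ℝ F] : Type _ :=
  (x : M) → TangentSpace (𝓡 2) x →L[ℝ] F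

/-- The expression of a one-form in the chart at `x₀` (its pull-back by the inverse chart). -/
def inChart (α : OneForm M F) (x₀ : M) (y : EuclideanSpace ℝ (Fin 2)) :
    EuclideanSpace ℝ (Fin 2) →L[ℝ] F :=
  (α ((chartAt (EuclideanSpace ℝ (Fin 2)) x₀).symm y)).comp
    (mfderiv 𝓘(ℝ, EuclideanSpace ℝ (Fin 2)) (𝓡 2)
      (chartAt (EuclideanSpace ℝ (Fin 2)) x₀).symm y)

def IsSmoothForm (α : OneForm M F) : Prop :=
  ∀ x₀ : M, ContDiffOn ℝ ∞ (inChart α x₀) (chartAt (EuclideanSpace ℝ (Fin 2)) x₀).target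

/-- `dα` evaluated on `(u, v)` at the point `y` of the chart at `x₀`. -/
def extDer (α : OneForm M F) (x₀ : M) (y u v : EuclideanSpace ℝ (Fin 2)) : F :=
  fderiv ℝ (inChart α x₀) y u v - fderiv ℝ (inChart α x₀) y v u

/-- `dα = 0`. -/
def IsClosedForm (α : OneForm M F) : Prop :=
  ∀ x₀ : M, ∀ y ∈ (chartAt (EuclideanSpace ℝ (Fin 2)) x₀).target,
    ∀ u v, extDer α x₀ y u v = 0

/-- `[α ∧ α] = 0`, that is, all `[α(X), α(Y)]` vanish. -/
def BracketVanishes (α : OneForm M EndR42) : Prop :=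
  ∀ x X Y, α x X * α x Y - α x Y * α x X = 0

/-- The connection `d + α` on the trivial bundle is flat: its curvature
`dα(u,v) + [α(u), α(v)]` vanishes. -/
def IsFlat (α : OneForm M EndR42) : Prop :=
  ∀ x₀ : M, ∀ y ∈ (chartAt (EuclideanSpace ℝ (Fin 2)) x₀).target, ∀ u v,
    extDer α x₀ y u v +
      (inChart α x₀ y u * inChart α x₀ y v - inChart α x₀ y v * inChart α x₀ y u) = 0

/-- `W` is a smooth rank `k` subbundle of the trivial bundle. -/
def IsSubbundle (k : ℕ) (W : M → Submodule ℝ R42) : Prop :=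
  ∀ x, ∃ U : Set M, IsOpen U ∧ x ∈ U ∧ ∃ σ : Fin k → M → R42,
    (∀ i, ContMDiffOn (𝓡 2) 𝓘(ℝ, R42) ∞ (σ i) U) ∧
    ∀ y ∈ U, LinearIndependent ℝ (fun i => σ i y) ∧
      Submodule.span ℝ (Set.range fun i => σ i y) = W y

/-- `σ` is a smooth section of `W` on some open neighbourhood of `x`. -/
def IsSectionNear (W : M → Submodule ℝ R42) (x : M) (σ : M → R42) : Prop :=
  ∃ U : Set M, IsOpen U ∧ x ∈ U ∧ ContMDiffOn (𝓡 2) 𝓘(ℝ, R42) ∞ σ U ∧ ∀ y ∈ U, σ y ∈ W y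

/-- The derived bundle `W^{(1)}`: the fibre at `x` is spanned by the values and the derivatives
at `x` of the sections of `W`. -/
def derived (W : M → Submodule ℝ R42) (x : M) : Submodule ℝ R42 :=
  Submodule.span ℝ {v | ∃ σ, IsSectionNear W x σ ∧ (v = σ x ∨ ∃ X, v = der σ x X)}

/-- The tensor `X ↦ (σ ↦ d_X σ mod W)` is injective. For a null line bundle `W` this says that
`W` immerses as a map into the projective light cone. -/
def Immerses (W : M → Submodule ℝ R42) : Prop :=
  ∀ x X, (∀ σ, IsSectionNear W x σ → der σ x X ∈ W x) → X = 0

/-- `c` is the trace of the endomorphism of the fibre `W x` which sends the value `σ x`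
of a section `σ` of `W` to `A σ`. -/
def IsFibreTrace (W : M → Submodule ℝ R42) (x : M) (A : (M → R42) → R42) (c : ℝ) : Prop :=
  ∃ L : W x →ₗ[ℝ] W x,
    (∀ σ, IsSectionNear W x σ → ∀ v : W x, σ x = v → (L v : R42) = A σ) ∧
    LinearMap.trace ℝ (W x) L = c

/-- Fields of real-valued functions of two tangent vectors. -/
abbrev BiForm (M : Type*) [TopologicalSpace M]
    [ChartedSpace (EuclideanSpace ℝ (Fin 2)) M] : Type _ :=
  (x : M) → TangentSpace (𝓡 2) x → TangentSpace (𝓡 2) x → ℝ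

/-- Non-degeneracy at every point. -/
def IsNondegenerate (q : BiForm M) : Prop :=
  ∀ x X, (∀ Y, q x X Y = 0) → X = 0

/-! ### Legendre maps and their curvature spheres -/

structure IsLegendre (f : M → Submodule ℝ R42) : Prop where
  smooth : IsSubbundle 2 f
  isotropic : ∀ x, IsIsotropic (f x)
  contact : ∀ x, derived f x ≤ perp (f x)
  immersion : Immerses f

/-- The line `s` is a curvature sphere of `f` at `x`. -/
def IsCurvatureSphere (f : M → Submodule ℝ R42) (x : M) (s : Submodule ℝ R42) : Prop :=
  Module.finrank ℝ s = 1 ∧ s ≤ f x ∧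
    ∃ X : TangentSpace (𝓡 2) x, X ≠ 0 ∧
      ∀ σ, IsSectionNear f x σ → σ x ∈ s → der σ x X ∈ f x

/-- There are two distinct curvature spheres at every point. -/
def IsUmbilicFree (f : M → Submodule ℝ R42) : Prop :=
  ∀ x, ∃ s₁ s₂, IsCurvatureSphere f x s₁ ∧ IsCurvatureSphere f x s₂ ∧ s₁ ≠ s₂

/-- On the open set `U`, `σ₁` and `σ₂` are lifts of the two curvature sphere congruences of `f`,
and `X₁` and `X₂` are vector fields spanning the respective curvature directions. -/
structure IsCurvatureFrame [IsManifold (𝓡 2) ∞ M] (f : M → Submodule ℝ R42) (U : Set M) (σ₁ σ₂ : M → R42)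
    (X₁ X₂ : (x : M) → TangentSpace (𝓡 2) x) : Prop where
  smooth₁ : ContMDiffOn (𝓡 2) 𝓘(ℝ, R42) ∞ σ₁ U
  smooth₂ : ContMDiffOn (𝓡 2) 𝓘(ℝ, R42) ∞ σ₂ U
  smooth_field₁ : ContMDiffOn (𝓡 2) (𝓡 2).tangent ∞
    (fun x => (⟨x, X₁ x⟩ : TangentBundle (𝓡 2) M)) U
  smooth_field₂ : ContMDiffOn (𝓡 2) (𝓡 2).tangent ∞
    (fun x => (⟨x, X₂ x⟩ : TangentBundle (𝓡 2) M)) U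
  indep : ∀ x ∈ U, LinearIndependent ℝ ![σ₁ x, σ₂ x]
  span : ∀ x ∈ U, Submodule.span ℝ {σ₁ x, σ₂ x} = f x
  indep_field : ∀ x ∈ U, LinearIndependent ℝ ![X₁ x, X₂ x]
  curv₁ : ∀ x ∈ U, der σ₁ x (X₁ x) ∈ f x
  curv₂ : ∀ x ∈ U, der σ₂ x (X₂ x) ∈ f x

/-- `⟨σ, d_Y σ, d_Y d_Y σ⟩` at `x`. -/
def cyclideSpace (σ : M → R42) (Y : (x : M) → TangentSpace (𝓡 2) x) (x : M) :
    Submodule ℝ R42 :=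
  Submodule.span ℝ {σ x, der σ x (Y x), der (fun y => der σ y (Y y)) x (Y x)}

/-! ### Omega-surfaces and polynomial conserved quantities -/

/-- `q(X,Y) = tr (σ ↦ η(X) d_Y σ : f → f)`. -/
def IsQuadraticDifferential (f : M → Submodule ℝ R42) (η : OneForm M EndR42)
    (q : BiForm M) : Prop :=
  ∀ x X Y, IsFibreTrace f x (fun σ => η x X (der σ x Y)) (q x X Y)

/-- `η` is a closed one-form with values in `f ∧ f^⊥` and `[η ∧ η] = 0`. -/
structure IsPotential (f : M → Submodule ℝ R42) (η : OneForm M EndR42) : Prop where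
  smooth : IsSmoothForm η
  mem : ∀ x X, η x X ∈ wedgeSpan (f x) (perp (f x))
  closed : IsClosedForm η
  bracket : BracketVanishes η

/-- `η` is a middle potential: with respect to the Lie cyclide splitting `S₁ ⊕ S₂` of the trivial
bundle, the component of `η` in `S₁ ∧ S₂` takes values in `∧² f`. -/
structure IsMiddlePotential [IsManifold (𝓡 2) ∞ M] (f : M → Submodule ℝ R42) (η : OneForm M EndR42) : Prop
    extends IsPotential f η where
  middle : ∀ x, ∃ (U : Set M) (σ₁ σ₂ : M → R42) (X₁ X₂ : (x : M) → TangentSpace (𝓡 2) x),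
    IsOpen U ∧ x ∈ U ∧ IsCurvatureFrame f U σ₁ σ₂ X₁ X₂ ∧
    ∀ Z, ∃ h ∈ wedgeSpan (cyclideSpace σ₁ X₂ x) (cyclideSpace σ₁ X₂ x) ⊔
          wedgeSpan (cyclideSpace σ₂ X₁ x) (cyclideSpace σ₂ X₁ x),
      ∃ m ∈ wedgeSpan (cyclideSpace σ₁ X₂ x) (cyclideSpace σ₂ X₁ x),
        η x Z = h + m ∧ m ∈ wedgeSpan (f x) (f x)

/-- `f` is an umbilic-free `Ω`-surface with middle potential `η` and quadratic differential `q`.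
As `q` has constant signature, it is non-degenerate at every point. -/
structure IsOmegaSurface [IsManifold (𝓡 2) ∞ M] (f : M → Submodule ℝ R42) (η : OneForm M EndR42)
    (q : BiForm M) : Prop where
  legendre : IsLegendre f
  umbilicFree : IsUmbilicFree f
  middle : IsMiddlePotential f η
  differential : IsQuadraticDifferential f η q
  nondegenerate : IsNondegenerate q

/-- The section `p(t) = ∑ₖ tᵏ pₖ` with coefficients `p₀, …, p_d`. -/
def evalPoly {d : ℕ} (p : Fin (d + 1) → M → R42) (t : ℝ) (x : M) : R42 :=
  ∑ k : Fin (d + 1), t ^ (k : ℕ) • p k x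

/-- `p` is a polynomial conserved quantity of degree `d` of the connections `d + t η`. -/
structure IsConservedQuantity (η : OneForm M EndR42) (d : ℕ) (p : Fin (d + 1) → M → R42) :
    Prop where
  smooth : ∀ k, ContMDiff (𝓡 2) 𝓘(ℝ, R42) ∞ (p k)
  degree : p (Fin.last d) ≠ 0
  parallel : ∀ t x X, der (evalPoly p t) x X + t • η x X (evalPoly p t x) = 0

/-! ### Sphere congruences and Guichard surfaces -/

/-- The induced connection `𝒟^V` on `V ⊕ V^⊥`, where `π` is the projection onto `V`:
`𝒟_X σ = π d_X (π σ) + (1 - π) d_X ((1 - π) σ)`. -/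
def inducedConn (V : M → Submodule ℝ R42) (σ : M → R42) (x : M) (X : TangentSpace (𝓡 2) x) :
    R42 :=
  orthProj (V x) (der (fun y => orthProj (V y) (σ y)) x X) +
    (1 - orthProj (V x)) (der (fun y => (1 - orthProj (V y)) (σ y)) x X)

/-- The tensor `𝒩^V = d - 𝒟^V`, with values in `V ∧ V^⊥`. Evaluating `d - 𝒟^V` on constant
sections gives `𝒩_X = (1 - 2 π) (d_X π)`. -/
def normalForm (V : M → Submodule ℝ R42) : OneForm M EndR42 := fun x =>
  (ContinuousLinearMap.mul ℝ EndR42 (1 - (2 : ℝ) • orthProj (V x))).comp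
    (der (fun y => orthProj (V y)) x)

/-- `d = 𝒟^V + 𝒩^V`. -/
theorem der_eq_inducedConn_add_normalForm (V : M → Submodule ℝ R42) (σ : M → R42) (x : M)
    (X : TangentSpace (𝓡 2) x)
    (hV : MDifferentiableAt (𝓡 2) 𝓘(ℝ, EndR42) (fun y => orthProj (V y)) x)
    (hσ : MDifferentiableAt (𝓡 2) 𝓘(ℝ, R42) σ x) :
    der σ x X = inducedConn V σ x X + normalForm V x X (σ x) := by
  have key : ∀ (T : M → EndR42), MDifferentiableAt (𝓡 2) 𝓘(ℝ, EndR42) T x →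
      der (fun y => T y (σ y)) x X = T x (der σ x X) + der T x X (σ x) := by
    intro T hT
    have h := hT.hasMFDerivAt.2.clm_apply hσ.hasMFDerivAt.2
    have h2 := HasMFDerivAt.mfderiv (I := 𝓡 2) (I' := 𝓘(ℝ, R42)) (f := fun y => T y (σ y))
      ⟨hT.continuousAt.clm_apply hσ.continuousAt, h⟩
    refine (congrArg (fun L : TangentSpace (𝓡 2) x →L[ℝ] R42 => L X) h2).trans ?_
    have hx : (extChartAt (𝓡 2) x).symm (extChartAt (𝓡 2) x x) = x :=
      extChartAt_to_inv (I := 𝓡 2) x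
    change T ((extChartAt (𝓡 2) x).symm (extChartAt (𝓡 2) x x)) (der σ x X) +
      der T x X (σ ((extChartAt (𝓡 2) x).symm (extChartAt (𝓡 2) x x))) = _
    rw [hx]
  have hid : orthProj (V x) * orthProj (V x) = orthProj (V x) := by
    unfold orthProj
    split_ifs with h
    · ext1 v
      exact Submodule.projection_apply_of_mem_left h (Submodule.projection_apply_mem h v)
    · simp
  have h1 := key _ hV
  have hsub : der (fun y => 1 - orthProj (V y)) x X = - der (fun y => orthProj (V y)) x X := by
    have hh := (hasMFDerivAt_const (I := 𝓡 2) (I' := 𝓘(ℝ, EndR42)) (1 : EndR42) x).sub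
      hV.hasMFDerivAt
    have h4 := congrArg (fun L => L X) hh.mfderiv
    unfold der
    refine Eq.trans h4 ?_
    exact zero_sub _
  have h2 := key (fun y => 1 - orthProj (V y)) ((mdifferentiableAt_const).sub hV)
  have hid' : ∀ v, orthProj (V x) (orthProj (V x) v) = orthProj (V x) v := fun v =>
    congrArg (fun T : EndR42 => T v) hid
  rw [inducedConn, h1, h2, hsub]
  simp only [normalForm, ContinuousLinearMap.comp_apply, ContinuousLinearMap.mul_apply',
    mul_apply_eq_comp, map_add, map_neg, map_sub,
    sub_apply, smul_apply, neg_apply,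
    one_apply_eq_self, hid']
  module

/-- `V` is a sphere congruence in the conformal geometry of `⟨𝔭⟩^⊥`. -/
structure IsSphereCongruence (𝔭 : R42) (V : M → Submodule ℝ R42) : Prop where
  smooth : IsSubbundle 4 V
  le : ∀ x, V x ≤ vperp 𝔭
  signature : ∀ x, HasSignature31 (V x)

/-- `Λ` is a smooth map into the projective light cone of `⟨𝔭⟩^⊥`. -/
structure IsPointMap (𝔭 : R42) (Λ : M → Submodule ℝ R42) : Prop where
  smooth : IsSubbundle 1 Λ
  le : ∀ x, Λ x ≤ vperp 𝔭
  isotropic : ∀ x, IsIsotropic (Λ x)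

/-- `Λ` is a Guichard (Möbius flat) surface in the conformal geometry of `⟨𝔭⟩^⊥`, as exhibited by
the enveloped sphere congruence `V` and the one-form `χ` with values in `Λ ∧ Λ^{(1)}`: the
connections `𝒟^V + t 𝒩^V + (t² - 1) χ = d + (t - 1) 𝒩^V + (t² - 1) χ` are flat for all `t`. -/
structure IsGuichard (𝔭 : R42) (Λ V : M → Submodule ℝ R42) (χ : OneForm M EndR42) : Prop where
  nonnull : form 𝔭 𝔭 ≠ 0
  pointMap : IsPointMap 𝔭 Λ
  sphere : IsSphereCongruence 𝔭 V
  envelops : ∀ x, derived Λ x ≤ V x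
  smooth : IsSmoothForm χ
  mem : ∀ x X, χ x X ∈ wedgeSpan (Λ x) (derived Λ x)
  flat : ∀ t : ℝ, IsFlat fun x => (t - 1) • normalForm V x + (t ^ 2 - 1) • χ x

/-- `q^Λ(X,Y) = 2 tr (σ ↦ χ_X 𝒟_Y σ : Λ → Λ) + tr (𝒩_X ∘ 𝒩_Y |_{V^⊥})`. -/
def IsGuichardDifferential (Λ V : M → Submodule ℝ R42) (χ : OneForm M EndR42)
    (q : BiForm M) : Prop :=
  ∀ x X Y, ∃ (a : ℝ) (K : perp (V x) →ₗ[ℝ] perp (V x)),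
    IsFibreTrace Λ x (fun σ => χ x X (inducedConn V σ x Y)) a ∧
    (∀ v, (K v : R42) = normalForm V x X (normalForm V x Y v)) ∧
    q x X Y = 2 * a + LinearMap.trace ℝ (perp (V x)) K

/-- `s` is one of the two null line subbundles of `V^⊥`, so that `Λ ⊕ s` is a lift of a surface
`Λ` enveloping `V`, with the orientation given by `s`. -/
structure IsNullNormal (V s : M → Submodule ℝ R42) : Prop where
  smooth : IsSubbundle 1 s
  le : ∀ x, s x ≤ perp (V x)
  isotropic : ∀ x, IsIsotropic (s x)

end Calculus

end LieSphere

end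

open LieSphere

open scoped Manifold ContDiff

noncomputable section

namespace LieSphere

/-! ### Algebra of the form and of wedge products -/

/-! Both directions rest on one dictionary. Let p be a null section of f with (𝔭, p) = k a non-zero
constant, a = (𝔭, 𝔭), V = ⟨𝔭, p⟩^⊥ and Λ = f ∩ ⟨𝔭⟩^⊥. Since 𝔭 is constant, V turns only through p,
and 𝒩^V = m ∧ dp with m = k⁻¹ 𝔭 - (a/k²) p (`IsNullField.normalForm_eq`). Expanding the curvature in
t, all connections 𝒟^V + t 𝒩^V + (t² - 1) χ are flat exactly when dχ(X,Y) = (a/k²) d_X p ∧ d_Y p,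
χ_X d_Y p is symmetric in X and Y, and [χ ∧ χ] = 0 (`IsNullField.flat_iff`).

Put η = (2k/a) χ - k⁻¹ p ∧ dp (`IsGuichardLift`). Then flatness amounts to dη = 0 and [η ∧ η] = 0:
the exterior derivative of p ∧ dp supplies the inhomogeneous term, the cross terms of the bracket
cancel by the symmetry, and the symmetry itself follows from evaluating [η ∧ η] = 0 on 𝔭. Moreover
η𝔭 = -dp and ηp = 0, which is the conservation of 𝔭 + t p, and comparing traces gives q^Λ = (a/k) q,
where (p(t), p(t)) = a + 2kt.

From Ω-surfaces to Guichard surfaces: a linear conserved quantity has p₀ = 𝔭 constant, dp₁ = -η𝔭 and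
ηp₁ = 0. Skewness makes (𝔭, p₁) constant, and p₁ is null because its square is the coefficient of
t². Let e₁, e₂ span the curvature spheres, n₁ = d_{X₂} e₁ and n₂ = d_{X₁} e₂. A middle potential has
η_{X₁} = β e₂ ∧ n₂ and η_{X₂} = α e₁ ∧ n₁ up to multiples of e₁ ∧ e₂, and non-degeneracy of q forces
α, β ≠ 0. Hence the joint kernel of η is f and p₁ lies in f (`IsOmegaSurface.mem_of_apply_eq_zero`).
The form χ is a/(2k) times the ∧² V-component of η; as there are no mixed terms e₁ ∧ n₂, e₂ ∧ n₁, it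
takes values in Λ ∧ Λ^{(1)} even where Λ is not immersed (`IsPrincipalAt.wedge_shear_mem`).

Conversely, p is taken in the null normal s with k = a, and the dictionary yields a potential η with
q = q^Λ, which need not be middle. It is replaced by η - dτ with τ a section of ∧² f: this is still
closed with values in f ∧ f^⊥, and q is unchanged since the second fundamental form is symmetric.
The section τ is chosen to cancel the mixed term along X₁; closedness shows that the same τ works
along X₂ and that it does not depend on the frame (`IsPrincipalAt.gaugeAt_eq`), so it is global. The
conserved quantity becomes 𝔭 + t (p + τ𝔭). Smoothness of τ uses smooth curvature sphere lifts, found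
as a simple root of a quadratic equation (`exists_isCurvatureFrame`). -/

theorem form_apply (x y : R42) :
    form x y = x 0 * y 0 + x 1 * y 1 + x 2 * y 2 + x 3 * y 3 - x 4 * y 4 - x 5 * y 5 := by
  simp only [form, Matrix.toBilin'_apply, Matrix.diagonal_apply, Fin.sum_univ_six]
  simp
  ring

theorem form_comm (x y : R42) : form x y = form y x := by
  simp only [form_apply]; ring

theorem form_isSymm : form.IsSymm := ⟨fun x y => by simpa using form_comm x y⟩

theorem form_isRefl : form.IsRefl := form_isSymm.isRefl

theorem form_eq_zero_of_forall {x : R42} (h : ∀ y, form x y = 0) : x = 0 := by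
  ext i
  have := h (Pi.single i 1)
  rw [form_apply] at this
  fin_cases i <;> simpa [Pi.single_apply] using this

theorem form_nondegenerate : form.Nondegenerate := by
  refine ⟨fun x h => form_eq_zero_of_forall h, fun x h => form_eq_zero_of_forall fun y => ?_⟩
  rw [form_comm]; exact h y

theorem mem_perp {W : Submodule ℝ R42} {v : R42} : v ∈ perp W ↔ ∀ w ∈ W, form w v = 0 :=
  Iff.rfl

theorem mem_perp_span {S : Set R42} {v : R42} :
    v ∈ perp (Submodule.span ℝ S) ↔ ∀ w ∈ S, form w v = 0 := by
  refine ⟨fun h w hw => h w (Submodule.subset_span hw), fun h w hw => ?_⟩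
  change form w v = 0
  induction hw using Submodule.span_induction with
  | mem x hx => exact h x hx
  | zero => simp
  | add x y _ _ hx hy => simp [hx, hy]
  | smul c x _ hx => simp [hx]

theorem mem_vperp {p v : R42} : v ∈ vperp p ↔ form p v = 0 :=
  mem_perp_span.trans (by simp)

theorem mem_perp_span_pair {a b v : R42} :
    v ∈ perp (Submodule.span ℝ {a, b}) ↔ form a v = 0 ∧ form b v = 0 :=
  mem_perp_span.trans (by simp)

theorem perp_perp (W : Submodule ℝ R42) : perp (perp W) = W :=
  LinearMap.BilinForm.orthogonal_orthogonal form_nondegenerate form_isRefl W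

theorem finrank_perp (W : Submodule ℝ R42) :
    Module.finrank ℝ (perp W) = 6 - Module.finrank ℝ W := by
  rw [perp, LinearMap.BilinForm.finrank_orthogonal form_nondegenerate]
  simp

theorem perp_anti {U W : Submodule ℝ R42} (h : U ≤ W) : perp W ≤ perp U :=
  fun _ hv w hw => hv w (h hw)

theorem wedge_apply (a b c : R42) : wedge a b c = form a c • b - form b c • a := rfl

theorem form_wedge (a b c d : R42) : form (wedge a b c) d = - form c (wedge a b d) := by
  simp only [wedge_apply, map_sub, map_smul, LinearMap.sub_apply, LinearMap.smul_apply,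
    smul_eq_mul]
  rw [form_comm b d, form_comm a d, form_comm c b, form_comm c a]; ring

theorem wedge_add_left (a a' b : R42) : wedge (a + a') b = wedge a b + wedge a' b := by
  ext1 c; simp only [wedge_apply, add_apply, map_add, LinearMap.add_apply]; module

theorem wedge_add_right (a b b' : R42) : wedge a (b + b') = wedge a b + wedge a b' := by
  ext1 c; simp only [wedge_apply, add_apply, map_add, LinearMap.add_apply]; module

theorem wedge_smul_left (r : ℝ) (a b : R42) : wedge (r • a) b = r • wedge a b := by
  ext1 c; simp only [wedge_apply, smul_apply, map_smul, LinearMap.smul_apply, smul_eq_mul]; module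

theorem wedge_smul_right (r : ℝ) (a b : R42) : wedge a (r • b) = r • wedge a b := by
  ext1 c; simp only [wedge_apply, smul_apply, map_smul, LinearMap.smul_apply, smul_eq_mul]; module

theorem wedge_swap (a b : R42) : wedge a b = - wedge b a := by
  ext1 c; simp only [wedge_apply, neg_apply]; module

theorem wedge_self (a : R42) : wedge a a = 0 := by
  ext1 c; simp [wedge_apply]

/-- The wedge product as a continuous bilinear map. -/
def wedgeL : R42 →L[ℝ] R42 →L[ℝ] EndR42 :=
  LinearMap.toContinuousLinearMap
    { toFun := fun a => LinearMap.toContinuousLinearMap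
        { toFun := fun b => wedge a b
          map_add' := wedge_add_right a
          map_smul' := fun r b => wedge_smul_right r a b }
      map_add' := fun a a' => by ext1 b; exact wedge_add_left a a' b
      map_smul' := fun r a => by ext1 b; exact wedge_smul_left r a b }

theorem wedgeL_apply (a b : R42) : wedgeL a b = wedge a b := rfl

theorem wedge_zero_left (b : R42) : wedge 0 b = 0 := by simp [← wedgeL_apply]

theorem wedge_zero_right (a : R42) : wedge a 0 = 0 := by simp [← wedgeL_apply]

theorem wedge_sub_left (a a' b : R42) : wedge (a - a') b = wedge a b - wedge a' b := by
  simp [← wedgeL_apply]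

theorem wedge_sub_right (a b b' : R42) : wedge a (b - b') = wedge a b - wedge a b' := by
  simp [← wedgeL_apply]

theorem wedge_neg_right (a b : R42) : wedge a (-b) = - wedge a b := by
  simp [← wedgeL_apply]

/-- The inner product as a continuous bilinear map. -/
def formL : R42 →L[ℝ] R42 →L[ℝ] ℝ :=
  LinearMap.toContinuousLinearMap
    { toFun := fun a => LinearMap.toContinuousLinearMap (form a)
      map_add' := fun a a' => by ext1 b; simp
      map_smul' := fun r a => by ext1 b; simp }

/-- Skew endomorphisms. -/
def IsSkew (T : EndR42) : Prop := ∀ v w, form (T v) w = - form v (T w)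

theorem isSkew_wedge (a b : R42) : IsSkew (wedge a b) := form_wedge a b

theorem IsSkew.form_self {T : EndR42} (h : IsSkew T) (v : R42) : form (T v) v = 0 := by
  have := h v v
  rw [form_comm v] at this; linarith

theorem IsSkew.add {S T : EndR42} (hS : IsSkew S) (hT : IsSkew T) : IsSkew (S + T) := by
  intro v w; simp [hS v w, hT v w]; ring

theorem IsSkew.smul {T : EndR42} (hT : IsSkew T) (r : ℝ) : IsSkew (r • T) := by
  intro v w; simp [hT v w]

/-- The commutator of a skew endomorphism with a wedge product. -/
theorem IsSkew.commutator_wedge {T : EndR42} (hT : IsSkew T) (a b : R42) :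
    T * wedge a b - wedge a b * T = wedge (T a) b + wedge a (T b) := by
  ext1 c
  have h1 := hT a c
  have h2 := hT b c
  simp only [sub_apply, mul_apply_eq_comp, wedge_apply, map_sub, map_smul, add_apply, h1, h2]
  module

theorem wedge_mem_wedgeSpan {U W : Submodule ℝ R42} {a b : R42} (ha : a ∈ U) (hb : b ∈ W) :
    wedge a b ∈ wedgeSpan U W :=
  Submodule.subset_span ⟨a, ha, b, hb, rfl⟩

/-- Linear properties of T are phrased as membership in a subspace P, so that decomposable elements
suffice. -/
theorem wedgeSpan_induction {U W : Submodule ℝ R42} {T : EndR42} (hT : T ∈ wedgeSpan U W)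
    (P : Submodule ℝ EndR42) (h : ∀ a ∈ U, ∀ b ∈ W, wedge a b ∈ P) : T ∈ P := by
  refine (Submodule.span_le.mpr ?_ : wedgeSpan U W ≤ P) hT
  rintro _ ⟨a, ha, b, hb, rfl⟩
  exact h a ha b hb

theorem wedgeSpan_mono {U U' W W' : Submodule ℝ R42} (hU : U ≤ U') (hW : W ≤ W') :
    wedgeSpan U W ≤ wedgeSpan U' W' := fun _ hT =>
  wedgeSpan_induction hT _ fun _ ha _ hb => wedge_mem_wedgeSpan (hU ha) (hW hb)

/-- The space of skew endomorphisms. -/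
def skewSubmodule : Submodule ℝ EndR42 where
  carrier := {T | IsSkew T}
  add_mem' := IsSkew.add
  zero_mem' := by intro v w; simp
  smul_mem' r _ hT := hT.smul r

theorem isSkew_of_mem {U W : Submodule ℝ R42} {T : EndR42} (hT : T ∈ wedgeSpan U W) :
    IsSkew T :=
  wedgeSpan_induction hT skewSubmodule fun a _ b _ => isSkew_wedge a b

/-- The endomorphisms mapping `U` into `W`. -/
def mapsSubmodule (U W : Submodule ℝ R42) : Submodule ℝ EndR42 where
  carrier := {T | ∀ u ∈ U, T u ∈ W}
  add_mem' hS hT u hu := W.add_mem (hS u hu) (hT u hu)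
  zero_mem' u _ := by simp
  smul_mem' r _ hT u hu := W.smul_mem r (hT u hu)

theorem apply_eq_zero_of_perp {U W : Submodule ℝ R42} {T : EndR42} (hT : T ∈ wedgeSpan U W)
    {v : R42} (hU : ∀ u ∈ U, form u v = 0) (hW : ∀ w ∈ W, form w v = 0) : T v = 0 := by
  have := wedgeSpan_induction hT (mapsSubmodule (Submodule.span ℝ {v}) ⊥) fun a ha b hb u hu => by
    obtain ⟨c, rfl⟩ := Submodule.mem_span_singleton.mp hu
    simp [wedge_apply, hU a ha, hW b hb]
  simpa using this v (Submodule.mem_span_singleton_self v)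

section Isotropic

variable {F : Submodule ℝ R42} {T : EndR42}

theorem apply_eq_zero_of_mem (hF : IsIsotropic F) (hT : T ∈ wedgeSpan F (perp F)) {v : R42}
    (hv : v ∈ F) : T v = 0 :=
  apply_eq_zero_of_perp hT (fun u hu => hF hv u hu) fun w hw => by
    rw [form_comm]; exact hw v hv

theorem apply_mem_of_mem_perp (hT : T ∈ wedgeSpan F (perp F)) {v : R42}
    (hv : v ∈ perp F) : T v ∈ F := by
  refine wedgeSpan_induction hT (mapsSubmodule (perp F) F) (fun a ha b _ u hu => ?_) v hv
  have h : form a u = 0 := hu a ha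
  rw [wedge_apply, h, zero_smul, zero_sub]
  exact F.neg_mem (F.smul_mem _ ha)

end Isotropic

/-! ### Signature -/

theorem finrank_le_of_disjoint {U W : Submodule ℝ R42} (h : Disjoint U W) :
    Module.finrank ℝ U + Module.finrank ℝ W ≤ 6 := by
  have h1 := Submodule.finrank_sup_add_finrank_inf_eq U W
  rw [h.eq_bot] at h1
  have h2 := Submodule.finrank_le (U ⊔ W)
  simp at h1 h2
  omega

/-- A subspace without positive vectors meets the four-dimensional positive definite space v₄ = v₅ =
0 only in zero. -/
theorem finrank_le_two_of_nonpos {W : Submodule ℝ R42} (h : ∀ v ∈ W, form v v ≤ 0) :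
    Module.finrank ℝ W ≤ 2 := by
  let g : R42 →ₗ[ℝ] ℝ × ℝ := (LinearMap.proj 4).prod (LinearMap.proj 5)
  have hP : 4 ≤ Module.finrank ℝ (LinearMap.ker g) := by
    have h1 := LinearMap.finrank_range_add_finrank_ker g
    have h2 := Submodule.finrank_le (LinearMap.range g)
    simp at h1 h2
    omega
  have hd : Disjoint W (LinearMap.ker g) := by
    rw [Submodule.disjoint_def]
    intro v hv hvP
    have h4 : v 4 = 0 ∧ v 5 = 0 := by simpa [g] using hvP
    have := h v hv
    rw [form_apply, h4.1, h4.2] at this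
    ext i
    fin_cases i <;> simp <;> nlinarith [h4.1, h4.2, sq_nonneg (v 0), sq_nonneg (v 1),
      sq_nonneg (v 2), sq_nonneg (v 3)]
  have := finrank_le_of_disjoint hd
  omega

/-- The hypothesis is positive definiteness; such a subspace meets the negative definite plane v₀ =
v₁ = v₂ = v₃ = 0 only in zero. -/
theorem finrank_le_four_of_pos {W : Submodule ℝ R42} (h : ∀ v ∈ W, form v v ≤ 0 → v = 0) :
    Module.finrank ℝ W ≤ 4 := by
  let g : R42 →ₗ[ℝ] (Fin 4 → ℝ) := LinearMap.pi fun i => LinearMap.proj (Fin.castLE (by norm_num) i)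
  have hP : 2 ≤ Module.finrank ℝ (LinearMap.ker g) := by
    have h1 := LinearMap.finrank_range_add_finrank_ker g
    have h2 := Submodule.finrank_le (LinearMap.range g)
    simp at h1 h2
    omega
  have hd : Disjoint W (LinearMap.ker g) := by
    rw [Submodule.disjoint_def]
    intro v hv hvP
    refine h v hv ?_
    rw [LinearMap.mem_ker] at hvP
    have h0 : v 0 = 0 := congrFun hvP 0
    have h1 : v 1 = 0 := congrFun hvP 1
    have h2 : v 2 = 0 := congrFun hvP 2
    have h3 : v 3 = 0 := congrFun hvP 3
    rw [form_apply, h0, h1, h2, h3]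
    nlinarith [sq_nonneg (v 4), sq_nonneg (v 5)]
  have := finrank_le_of_disjoint hd
  omega

/-- `f^⊥ / f` is positive definite for a maximal isotropic subspace `f`. -/
theorem mem_of_form_self_nonpos {F : Submodule ℝ R42} (hF : IsIsotropic F)
    (h2 : Module.finrank ℝ F = 2) {v : R42} (hv : v ∈ perp F) (hn : form v v ≤ 0) : v ∈ F := by
  by_contra hvF
  -- On F ⊕ ⟨v⟩ the square of x + c v is c² (v, v) ≤ 0, so adjoining v cannot raise the dimension
  -- above two.
  have hle : Module.finrank ℝ (F ⊔ Submodule.span ℝ {v} : Submodule ℝ R42) ≤ 2 := by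
    refine finrank_le_two_of_nonpos fun w hw => ?_
    obtain ⟨x, hx, y, hy, rfl⟩ := Submodule.mem_sup.mp hw
    obtain ⟨c, rfl⟩ := Submodule.mem_span_singleton.mp hy
    have hxx : form x x = 0 := hF hx x hx
    have hxv : form x v = 0 := hv x hx
    simp only [map_add, LinearMap.add_apply, map_smul, LinearMap.smul_apply, smul_eq_mul, hxx, hxv,
      form_comm v x]
    nlinarith [sq_nonneg c]
  have h3 : F = F ⊔ Submodule.span ℝ {v} :=
    Submodule.eq_of_le_of_finrank_le le_sup_left (by omega)
  exact hvF (h3 ▸ Submodule.mem_sup_right (Submodule.mem_span_singleton_self v))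

theorem form_self_pos {F : Submodule ℝ R42} (hF : IsIsotropic F)
    (h2 : Module.finrank ℝ F = 2) {v : R42} (hv : v ∈ perp F) (hn : v ∉ F) : 0 < form v v := by
  by_contra h
  exact hn (mem_of_form_self_nonpos hF h2 hv (not_lt.mp h))

/-! ### Calculus of vector-valued functions on a surface -/

section Rules

variable {M : Type*} [TopologicalSpace M] [ChartedSpace (EuclideanSpace ℝ (Fin 2)) M]
variable {F F₁ F₂ F₃ : Type*} [NormedAddCommGroup F] [NormedSpace ℝ F]
  [NormedAddCommGroup F₁] [NormedSpace ℝ F₁] [NormedAddCommGroup F₂] [NormedSpace ℝ F₂]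
  [NormedAddCommGroup F₃] [NormedSpace ℝ F₃]

/-- Smooth vector-valued functions on a subset of `M`. -/
abbrev SmoothOn (σ : M → F) (U : Set M) : Prop := ContMDiffOn (𝓡 2) 𝓘(ℝ, F) ∞ σ U

/-- Differentiability at a point of `M`. -/
abbrev DiffAt (σ : M → F) (x : M) : Prop := MDifferentiableAt (𝓡 2) 𝓘(ℝ, F) σ x

theorem SmoothOn.diffAt {σ : M → F} {U : Set M} (h : SmoothOn σ U) (hU : IsOpen U) {x : M}
    (hx : x ∈ U) : DiffAt σ x :=
  (h.contMDiffAt (hU.mem_nhds hx)).mdifferentiableAt (by simp)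

/-- The derivative at `x`, as a linear map on the model space. -/
def derModel (σ : M → F) (x : M) : EuclideanSpace ℝ (Fin 2) →L[ℝ] F := der σ x

/-- At x the manifold derivative is by definition the Fréchet derivative in the preferred chart at
x. Together with `der_eq_of_hasFDerivAt` this imports the ordinary calculus rules pointwise, without
compatibility of charts. -/
theorem DiffAt.hasFDerivAt {σ : M → F} {x : M} (h : DiffAt σ x) :
    HasFDerivAt (σ ∘ (extChartAt (𝓡 2) x).symm) (derModel σ x) (extChartAt (𝓡 2) x x) := by
  have h1 := h.hasMFDerivAt.2
  simp only [modelWithCornersSelf_coe, Set.range_id] at h1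
  have h2 : HasFDerivWithinAt (σ ∘ (extChartAt (𝓡 2) x).symm) (derModel σ x) Set.univ
      (extChartAt (𝓡 2) x x) := h1
  exact hasFDerivWithinAt_univ.mp h2

theorem der_eq_of_hasFDerivAt {σ : M → F} {x : M} (hc : ContinuousAt σ x)
    {L : EuclideanSpace ℝ (Fin 2) →L[ℝ] F}
    (h : HasFDerivAt (σ ∘ (extChartAt (𝓡 2) x).symm) L (extChartAt (𝓡 2) x x)) :
    der σ x = L :=
  HasMFDerivAt.mfderiv (I := 𝓡 2) (I' := 𝓘(ℝ, F)) ⟨hc, h.hasFDerivWithinAt⟩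

/-- The product rules for scalar multiples, `form`, `wedge` and evaluation are all instances of this
one. -/
theorem der_bilin (B : F₁ →L[ℝ] F₂ →L[ℝ] F₃) {σ : M → F₁} {τ : M → F₂} {x : M}
    (hσ : DiffAt σ x) (hτ : DiffAt τ x) (X : TangentSpace (𝓡 2) x) :
    der (fun y => B (σ y) (τ y)) x X = B (der σ x X) (τ x) + B (σ x) (der τ x X) := by
  have h := B.hasFDerivAt_of_bilinear hσ.hasFDerivAt hτ.hasFDerivAt
  have hc : ContinuousAt (fun y => B (σ y) (τ y)) x :=
    (B.continuous₂.continuousAt (x := (σ x, τ x))).comp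
      (f := fun y => (σ y, τ y)) (hσ.continuousAt.prodMk hτ.continuousAt)
  have h2 := der_eq_of_hasFDerivAt hc h
  rw [h2]
  change B (σ ((extChartAt (𝓡 2) x).symm (extChartAt (𝓡 2) x x))) (der τ x X) +
    B (der σ x X) (τ ((extChartAt (𝓡 2) x).symm (extChartAt (𝓡 2) x x))) = _
  rw [extChartAt_to_inv (I := 𝓡 2) x, add_comm]

theorem der_clm (B : F₁ →L[ℝ] F₂) {σ : M → F₁} {x : M} (hσ : DiffAt σ x)
    (X : TangentSpace (𝓡 2) x) : der (fun y => B (σ y)) x X = B (der σ x X) := by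
  have h2 := der_eq_of_hasFDerivAt (σ := fun y => B (σ y)) (B.continuous.continuousAt.comp
    hσ.continuousAt) (B.hasFDerivAt.comp _ hσ.hasFDerivAt)
  rw [h2]; rfl

theorem der_add {σ τ : M → F} {x : M} (hσ : DiffAt σ x) (hτ : DiffAt τ x)
    (X : TangentSpace (𝓡 2) x) :
    der (fun y => σ y + τ y) x X = der σ x X + der τ x X := by
  have h2 := der_eq_of_hasFDerivAt (σ := fun y => σ y + τ y)
    (hσ.continuousAt.add hτ.continuousAt) (hσ.hasFDerivAt.add hτ.hasFDerivAt)
  rw [h2]; rfl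

theorem der_sub {σ τ : M → F} {x : M} (hσ : DiffAt σ x) (hτ : DiffAt τ x)
    (X : TangentSpace (𝓡 2) x) :
    der (fun y => σ y - τ y) x X = der σ x X - der τ x X := by
  have h2 := der_eq_of_hasFDerivAt (σ := fun y => σ y - τ y)
    (hσ.continuousAt.sub hτ.continuousAt) (hσ.hasFDerivAt.sub hτ.hasFDerivAt)
  rw [h2]; rfl

theorem der_const (c : F) (x : M) (X : TangentSpace (𝓡 2) x) :
    der (fun _ : M => c) x X = 0 := by
  have h2 := der_eq_of_hasFDerivAt (σ := fun _ : M => c) (x := x) continuousAt_const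
    (hasFDerivAt_const c _)
  rw [h2]; rfl

theorem der_const_smul (r : ℝ) {σ : M → F} {x : M} (hσ : DiffAt σ x)
    (X : TangentSpace (𝓡 2) x) : der (fun y => r • σ y) x X = r • der σ x X :=
  der_clm (r • ContinuousLinearMap.id ℝ F) hσ X

theorem der_smul {c : M → ℝ} {σ : M → F} {x : M} (hc : DiffAt c x) (hσ : DiffAt σ x)
    (X : TangentSpace (𝓡 2) x) :
    der (fun y => c y • σ y) x X = (der c x X : ℝ) • σ x + c x • der σ x X :=
  der_bilin (ContinuousLinearMap.lsmul ℝ ℝ) hc hσ X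

theorem der_form {σ τ : M → R42} {x : M} (hσ : DiffAt σ x) (hτ : DiffAt τ x)
    (X : TangentSpace (𝓡 2) x) :
    der (fun y => form (σ y) (τ y)) x X = form (der σ x X) (τ x) + form (σ x) (der τ x X) :=
  der_bilin formL hσ hτ X

theorem der_wedge {σ τ : M → R42} {x : M} (hσ : DiffAt σ x) (hτ : DiffAt τ x)
    (X : TangentSpace (𝓡 2) x) :
    der (fun y => wedge (σ y) (τ y)) x X = wedge (der σ x X) (τ x) + wedge (σ x) (der τ x X) :=
  der_bilin wedgeL hσ hτ X

theorem der_apply {T : M → EndR42} {σ : M → R42} {x : M} (hT : DiffAt T x) (hσ : DiffAt σ x)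
    (X : TangentSpace (𝓡 2) x) :
    der (fun y => T y (σ y)) x X = der T x X (σ x) + T x (der σ x X) :=
  der_bilin (ContinuousLinearMap.id ℝ EndR42) hT hσ X

theorem der_congr {σ τ : M → F} {U : Set M} (hU : IsOpen U) {x : M} (hx : x ∈ U)
    (h : ∀ y ∈ U, σ y = τ y) : der σ x = der τ x :=
  Filter.EventuallyEq.mfderiv_eq (Filter.eventually_of_mem (hU.mem_nhds hx) h)

theorem der_eq_zero_of_eqOn {σ : M → F} {U : Set M} (hU : IsOpen U) {x : M} (hx : x ∈ U)
    {c : F} (h : ∀ y ∈ U, σ y = c) (X : TangentSpace (𝓡 2) x) : der σ x X = 0 := by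
  rw [der_congr hU hx (τ := fun _ => c) h, der_const]

/-! Smoothness -/

theorem SmoothOn.bilin (B : F₁ →L[ℝ] F₂ →L[ℝ] F₃) {σ : M → F₁} {τ : M → F₂} {U : Set M}
    (hσ : SmoothOn σ U) (hτ : SmoothOn τ U) : SmoothOn (fun y => B (σ y) (τ y)) U :=
  (B.isBoundedBilinearMap.contDiff.contMDiff (n := ∞)).comp_contMDiffOn
    (f := fun y => (σ y, τ y)) (hσ.prodMk_space hτ)

theorem SmoothOn.form {σ τ : M → R42} {U : Set M}
    (hσ : SmoothOn σ U) (hτ : SmoothOn τ U) : SmoothOn (fun y => LieSphere.form (σ y) (τ y)) U :=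
  hσ.bilin formL hτ

theorem SmoothOn.wedge {σ τ : M → R42} {U : Set M}
    (hσ : SmoothOn σ U) (hτ : SmoothOn τ U) : SmoothOn (fun y => LieSphere.wedge (σ y) (τ y)) U :=
  hσ.bilin wedgeL hτ

theorem SmoothOn.clm_app {T : M → EndR42} {σ : M → R42} {U : Set M}
    (hT : SmoothOn T U) (hσ : SmoothOn σ U) : SmoothOn (fun y => T y (σ y)) U :=
  hT.bilin (ContinuousLinearMap.id ℝ EndR42) hσ

theorem smoothOn_const (c : F) (U : Set M) : SmoothOn (fun _ : M => c) U := contMDiffOn_const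

theorem SmoothOn.fsmul {c : M → ℝ} {σ : M → F} {U : Set M} (hc : SmoothOn c U)
    (hσ : SmoothOn σ U) : SmoothOn (fun y => c y • σ y) U :=
  hc.bilin (ContinuousLinearMap.lsmul ℝ ℝ) hσ

theorem SmoothOn.comp_contDiffAt {g : F₁ → F₂} {σ : M → F₁} {U : Set M} (hσ : SmoothOn σ U)
    (hg : ∀ y ∈ U, ContDiffAt ℝ ∞ g (σ y)) : SmoothOn (fun y => g (σ y)) U := fun y hy =>
  ((hg y hy).contMDiffAt.comp_contMDiffWithinAt (f := σ) y (hσ y hy))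

theorem SmoothOn.congr_on {σ τ : M → F} {U : Set M} (hσ : SmoothOn σ U)
    (h : ∀ y ∈ U, τ y = σ y) : SmoothOn τ U :=
  ContMDiffOn.congr hσ h

theorem SmoothOn.inv {c : M → ℝ} {U : Set M} (hc : SmoothOn c U)
    (h : ∀ y ∈ U, c y ≠ 0) : SmoothOn (fun y => (c y)⁻¹) U :=
  hc.comp_contDiffAt (g := fun t => t⁻¹) fun y hy => contDiffAt_inv ℝ (h y hy)

theorem SmoothOn.sqrt {c : M → ℝ} {U : Set M} (hc : SmoothOn c U)
    (h : ∀ y ∈ U, c y ≠ 0) : SmoothOn (fun y => Real.sqrt (c y)) U :=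
  hc.comp_contDiffAt (g := fun t => Real.sqrt t) fun y hy => Real.contDiffAt_sqrt (h y hy)

theorem SmoothOn.fmul {c d : M → ℝ} {U : Set M} (hc : SmoothOn c U) (hd : SmoothOn d U) :
    SmoothOn (fun y => c y * d y) U := hc.fsmul hd

theorem SmoothOn.fadd {σ τ : M → F} {U : Set M} (hσ : SmoothOn σ U) (hτ : SmoothOn τ U) :
    SmoothOn (fun y => σ y + τ y) U := ContMDiffOn.add hσ hτ

theorem SmoothOn.fsub {σ τ : M → F} {U : Set M} (hσ : SmoothOn σ U) (hτ : SmoothOn τ U) :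
    SmoothOn (fun y => σ y - τ y) U := ContMDiffOn.sub hσ hτ

theorem SmoothOn.fneg {σ : M → F} {U : Set M} (hσ : SmoothOn σ U) :
    SmoothOn (fun y => - σ y) U := ContMDiffOn.neg hσ

/-- A neighbourhood on which a smooth function does not vanish. -/
theorem SmoothOn.exists_open_ne_zero {c : M → ℝ} {U : Set M} (hc : SmoothOn c U) (hU : IsOpen U)
    {x : M} (hx : x ∈ U) (h : c x ≠ 0) :
    ∃ W ⊆ U, IsOpen W ∧ x ∈ W ∧ ∀ y ∈ W, c y ≠ 0 := by
  refine ⟨U ∩ c ⁻¹' {0}ᶜ, Set.inter_subset_left,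
    hc.continuousOn.isOpen_inter_preimage hU isOpen_compl_singleton, ⟨hx, h⟩, fun y hy => hy.2⟩

theorem SmoothOn.exists_open_pos {c : M → ℝ} {U : Set M} (hc : SmoothOn c U) (hU : IsOpen U)
    {x : M} (hx : x ∈ U) (h : 0 < c x) :
    ∃ W ⊆ U, IsOpen W ∧ x ∈ W ∧ ∀ y ∈ W, 0 < c y := by
  refine ⟨U ∩ c ⁻¹' (Set.Ioi 0), Set.inter_subset_left,
    hc.continuousOn.isOpen_inter_preimage hU isOpen_Ioi, ⟨hx, h⟩, fun y hy => hy.2⟩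

end Rules

/-! ### Coordinate vector fields and one-forms in charts -/

section Coordinates

variable {M : Type*} [TopologicalSpace M] [ChartedSpace (EuclideanSpace ℝ (Fin 2)) M]
variable {F : Type*} [NormedAddCommGroup F] [NormedSpace ℝ F]

local notation "𝔼" => EuclideanSpace ℝ (Fin 2)

/-- The vector field which is constantly `u` in the chart at `x₀`. -/
def coordField (x₀ : M) (u : 𝔼) (y : M) : TangentSpace (𝓡 2) y :=
  mfderiv 𝓘(ℝ, 𝔼) (𝓡 2) (chartAt 𝔼 x₀).symm (chartAt 𝔼 x₀ y) u

theorem coordField_add (x₀ : M) (u v : 𝔼) (y : M) :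
    coordField x₀ (u + v) y = coordField x₀ u y + coordField x₀ v y := map_add _ _ _

theorem inChart_apply (α : OneForm M F) (x₀ : M) {y : M} (hy : y ∈ (chartAt 𝔼 x₀).source)
    (u : 𝔼) : inChart α x₀ (chartAt 𝔼 x₀ y) u = α y (coordField x₀ u y) := by
  -- The base point differs from y only propositionally. All tangent spaces are the model space, so
  -- the equality can be substituted for a general z.
  have h : ∀ z : M, z = y → α z
      (mfderiv 𝓘(ℝ, 𝔼) (𝓡 2) (chartAt 𝔼 x₀).symm (chartAt 𝔼 x₀ y) u : 𝔼) =
      α y (mfderiv 𝓘(ℝ, 𝔼) (𝓡 2) (chartAt 𝔼 x₀).symm (chartAt 𝔼 x₀ y) u : 𝔼) := by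
    rintro z rfl; rfl
  exact h _ ((chartAt 𝔼 x₀).left_inv hy)

theorem isOpen_chart_preimage (x₀ : M) {U : Set M} (hU : IsOpen U) :
    IsOpen ((chartAt 𝔼 x₀).target ∩ (chartAt 𝔼 x₀).symm ⁻¹' U) :=
  (chartAt 𝔼 x₀).isOpen_inter_preimage_symm hU

variable [IsManifold (𝓡 2) ∞ M]

theorem coordField_bijective (x₀ : M) {y : M} (hy : y ∈ (chartAt 𝔼 x₀).source) :
    Function.Bijective fun u : 𝔼 => coordField x₀ u y := by
  have : IsManifold (𝓡 2) 1 M := .of_le (n := ∞) (by norm_num)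
  have h1 := (mdifferentiable_chart (I := 𝓡 2) x₀).symm
  exact h1.mfderiv_bijective (x := chartAt 𝔼 x₀ y) ((chartAt 𝔼 x₀).map_source hy)

theorem der_coordField {σ : M → F} (x₀ : M) {y : M} (hy : y ∈ (chartAt 𝔼 x₀).source)
    (hσ : DiffAt σ y) (u : 𝔼) :
    der σ y (coordField x₀ u y) = fderiv ℝ (σ ∘ (chartAt 𝔼 x₀).symm) (chartAt 𝔼 x₀ y) u := by
  have : IsManifold (𝓡 2) 1 M := .of_le (n := ∞) (by norm_num)
  have h1 := (mdifferentiable_chart (I := 𝓡 2) x₀).mdifferentiableAt_symm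
    ((chartAt 𝔼 x₀).map_source hy)
  have h2 : DiffAt σ ((chartAt 𝔼 x₀).symm (chartAt 𝔼 x₀ y)) := by
    rwa [(chartAt 𝔼 x₀).left_inv hy]
  have h3 := mfderiv_comp (I := 𝓘(ℝ, 𝔼)) (I' := 𝓡 2) (I'' := 𝓘(ℝ, F)) (chartAt 𝔼 x₀ y) h2 h1
  rw [← mfderiv_eq_fderiv, h3]
  exact (inChart_apply (der σ) x₀ hy u).symm

theorem SmoothOn.inChart {σ : M → F} {U : Set M} (hσ : SmoothOn σ U) (x₀ : M) :
    ContDiffOn ℝ ∞ (σ ∘ (chartAt 𝔼 x₀).symm)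
      ((chartAt 𝔼 x₀).target ∩ (chartAt 𝔼 x₀).symm ⁻¹' U) := by
  rw [← contMDiffOn_iff_contDiffOn]
  exact hσ.comp ((contMDiffOn_chart_symm (I := 𝓡 2) (x := x₀)).mono Set.inter_subset_left)
    fun y hy => hy.2

theorem smoothOn_comp_chart {g : 𝔼 → F} (x₀ : M) {U : Set M}
    (hg : ContDiffOn ℝ ∞ g ((chartAt 𝔼 x₀).target ∩ (chartAt 𝔼 x₀).symm ⁻¹' U)) :
    SmoothOn (fun y => g (chartAt 𝔼 x₀ y)) ((chartAt 𝔼 x₀).source ∩ U) := by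
  refine (contMDiffOn_iff_contDiffOn.mpr hg).comp
    ((contMDiffOn_chart (I := 𝓡 2) (x := x₀)).mono Set.inter_subset_left) fun y hy => ?_
  refine ⟨(chartAt 𝔼 x₀).map_source hy.1, ?_⟩
  simpa [(chartAt 𝔼 x₀).left_inv hy.1] using hy.2

theorem SmoothOn.der_coordField {σ : M → F} {U : Set M} (hσ : SmoothOn σ U) (hU : IsOpen U)
    (x₀ : M) (u : 𝔼) :
    SmoothOn (fun y => der σ y (coordField x₀ u y)) ((chartAt 𝔼 x₀).source ∩ U) := by
  have h1 := ((hσ.inChart x₀).fderiv_of_isOpen (isOpen_chart_preimage x₀ hU)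
    (m := ∞) (by simp)).clm_apply (contDiffOn_const (c := u))
  exact (smoothOn_comp_chart x₀ h1).congr_on fun y hy =>
    LieSphere.der_coordField x₀ hy.1 (hσ.diffAt hU hy.2) u

theorem der_comp_chart {g : 𝔼 → F} (x₀ : M) {y : M} (hy : y ∈ (chartAt 𝔼 x₀).source)
    (hg : DifferentiableAt ℝ g (chartAt 𝔼 x₀ y)) (u : 𝔼) :
    der (fun z => g (chartAt 𝔼 x₀ z)) y (coordField x₀ u y) = fderiv ℝ g (chartAt 𝔼 x₀ y) u := by
  have : IsManifold (𝓡 2) 1 M := .of_le (n := ∞) (by norm_num)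
  have h1 := (mdifferentiable_chart (I := 𝓡 2) x₀).mdifferentiableAt hy
  have h2 : DiffAt (fun z => g (chartAt 𝔼 x₀ z)) y :=
    MDifferentiableAt.comp (I' := 𝓘(ℝ, 𝔼)) (g := g) (f := chartAt 𝔼 x₀) y
      hg.mdifferentiableAt h1
  rw [LieSphere.der_coordField x₀ hy h2]
  congr 1
  refine Filter.EventuallyEq.fderiv_eq ?_
  filter_upwards [(chartAt 𝔼 x₀).open_target.mem_nhds ((chartAt 𝔼 x₀).map_source hy)] with z hz
  simp [(chartAt 𝔼 x₀).right_inv hz]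

/-- Coordinate derivatives commute. -/
theorem der_coordField_comm {σ : M → F} {U : Set M} (hσ : SmoothOn σ U) (hU : IsOpen U)
    (x₀ : M) {x : M} (hx : x ∈ U) (hx₀ : x ∈ (chartAt 𝔼 x₀).source) (u v : 𝔼) :
    der (fun y => der σ y (coordField x₀ u y)) x (coordField x₀ v x) =
      der (fun y => der σ y (coordField x₀ v y)) x (coordField x₀ u x) := by
  set g := σ ∘ (chartAt 𝔼 x₀).symm with hg
  have hmem : chartAt 𝔼 x₀ x ∈ (chartAt 𝔼 x₀).target ∩ (chartAt 𝔼 x₀).symm ⁻¹' U :=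
    ⟨(chartAt 𝔼 x₀).map_source hx₀, by simpa [(chartAt 𝔼 x₀).left_inv hx₀] using hx⟩
  have hO := isOpen_chart_preimage x₀ hU
  have hD : DifferentiableAt ℝ (fderiv ℝ g) (chartAt 𝔼 x₀ x) :=
    (((hσ.inChart x₀).fderiv_of_isOpen hO (m := ∞) (by simp)).contDiffAt
      (hO.mem_nhds hmem)).differentiableAt (by simp)
  have key : ∀ u v, der (fun y => der σ y (coordField x₀ u y)) x (coordField x₀ v x) =
      fderiv ℝ (fderiv ℝ g) (chartAt 𝔼 x₀ x) v u := by
    intro u v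
    rw [der_congr (τ := fun y => fderiv ℝ g (chartAt 𝔼 x₀ y) u)
      ((chartAt 𝔼 x₀).open_source.inter hU) ⟨hx₀, hx⟩
      fun y hy => LieSphere.der_coordField x₀ hy.1 (hσ.diffAt hU hy.2) u]
    rw [der_comp_chart (g := fun e => fderiv ℝ g e u) x₀ hx₀
      (hD.clm_apply (differentiableAt_const u))]
    rw [fderiv_clm_apply hD (differentiableAt_const u)]
    simp
  rw [key, key]
  have hc : ContDiffAt ℝ ∞ g (chartAt 𝔼 x₀ x) := (hσ.inChart x₀).contDiffAt (hO.mem_nhds hmem)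
  exact (hc.isSymmSndFDerivAt (by simpa using ENat.LEInfty.out)).eq v u

theorem IsSmoothForm.smoothOn {α : OneForm M F} (hα : IsSmoothForm α) (x₀ : M) (u : 𝔼) :
    SmoothOn (fun y => α y (coordField x₀ u y)) (chartAt 𝔼 x₀).source := by
  have h := smoothOn_comp_chart (g := fun e => LieSphere.inChart α x₀ e u) x₀ (U := Set.univ)
    (by simpa using (hα x₀).clm_apply (contDiffOn_const (c := u)))
  simp only [Set.inter_univ] at h
  exact h.congr_on fun y hy => (inChart_apply α x₀ hy u).symm

/-- Coordinate fields commute, so the invariant formula for dα has no bracket term. -/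
theorem extDer_eq {α : OneForm M F} (hα : IsSmoothForm α) (x₀ : M) {x : M}
    (hx : x ∈ (chartAt 𝔼 x₀).source) (u v : 𝔼) :
    extDer α x₀ (chartAt 𝔼 x₀ x) u v =
      der (fun y => α y (coordField x₀ v y)) x (coordField x₀ u x) -
      der (fun y => α y (coordField x₀ u y)) x (coordField x₀ v x) := by
  have hD : DifferentiableAt ℝ (inChart α x₀) (chartAt 𝔼 x₀ x) :=
    ((hα x₀).contDiffAt ((chartAt 𝔼 x₀).open_target.mem_nhds
      ((chartAt 𝔼 x₀).map_source hx))).differentiableAt (by simp)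
  have key : ∀ u v, der (fun y => α y (coordField x₀ v y)) x (coordField x₀ u x) =
      fderiv ℝ (inChart α x₀) (chartAt 𝔼 x₀ x) u v := by
    intro u v
    rw [der_congr (τ := fun y => inChart α x₀ (chartAt 𝔼 x₀ y) v)
      (chartAt 𝔼 x₀).open_source hx fun y hy => (inChart_apply α x₀ hy v).symm]
    rw [der_comp_chart (g := fun e => inChart α x₀ e v) x₀ hx
      (hD.clm_apply (differentiableAt_const v))]
    rw [fderiv_clm_apply hD (differentiableAt_const v)]
    simp
  rw [key, key, extDer]

/-- A form is smooth if its values on coordinate fields are. -/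
theorem isSmoothForm_of_smoothOn {α : OneForm M F}
    (h : ∀ (x₀ : M) (u : 𝔼),
      SmoothOn (fun y => α y (coordField x₀ u y)) (chartAt 𝔼 x₀).source) :
    IsSmoothForm α := by
  intro x₀
  rw [contDiffOn_clm_apply]
  intro u
  have h1 := (h x₀ u).inChart x₀
  refine ContDiffOn.congr (h1.mono fun y hy => ⟨hy, (chartAt 𝔼 x₀).map_target hy⟩) fun y hy => ?_
  have := inChart_apply α x₀ ((chartAt 𝔼 x₀).map_target hy) u
  rw [(chartAt 𝔼 x₀).right_inv hy] at this
  exact this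

theorem isSmoothForm_der {σ : M → F} (hσ : SmoothOn σ Set.univ) : IsSmoothForm (der σ) :=
  isSmoothForm_of_smoothOn fun x₀ u => by
    simpa using hσ.der_coordField isOpen_univ x₀ u

/-- The values of a smooth function's derivative on a smooth vector field. -/
theorem SmoothOn.der_field {σ : M → F} {U : Set M} (hσ : SmoothOn σ U) (hU : IsOpen U)
    {X : (x : M) → TangentSpace (𝓡 2) x}
    (hX : ContMDiffOn (𝓡 2) (𝓡 2).tangent ∞ (fun x => (⟨x, X x⟩ : TangentBundle (𝓡 2) M)) U) :
    SmoothOn (fun y => der σ y (X y)) U := by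
  have h1 := hσ.contMDiffOn_tangentMapWithin (m := ∞) (by simp) hU.uniqueMDiffOn
  have h2 := h1.comp hX (fun y hy => hy)
  have h3 := (contMDiff_snd_tangentBundle_modelSpace F 𝓘(ℝ, F) (n := ∞)).comp_contMDiffOn h2
  refine ContMDiffOn.congr h3 fun y hy => ?_
  simp only [Function.comp, tangentMapWithin, der]
  rw [mfderivWithin_of_isOpen hU hy]
  rfl

/-- The field is the image of a constant field under the tangent map of the inverse chart. -/
theorem contMDiffOn_coordField (x₀ : M) (u : 𝔼) :
    ContMDiffOn (𝓡 2) (𝓡 2).tangent ∞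
      (fun x => (⟨x, coordField x₀ u x⟩ : TangentBundle (𝓡 2) M)) (chartAt 𝔼 x₀).source := by
  have h1 := (contMDiffOn_chart_symm (I := 𝓡 2) (n := ∞) (x := x₀)).contMDiffOn_tangentMapWithin
    (m := ∞) (by simp) (chartAt 𝔼 x₀).open_target.uniqueMDiffOn
  have h0 : ContMDiffOn (𝓡 2) (𝓘(ℝ, 𝔼)).tangent ∞
      (fun x => (⟨chartAt 𝔼 x₀ x, u⟩ : TangentBundle 𝓘(ℝ, 𝔼) 𝔼)) (chartAt 𝔼 x₀).source := by
    have hc : ContMDiff 𝓘(ℝ, 𝔼) (𝓘(ℝ, 𝔼)).tangent ∞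
        (fun x : 𝔼 => (⟨x, u⟩ : TangentBundle 𝓘(ℝ, 𝔼) 𝔼)) :=
      contMDiff_vectorSpace_iff_contDiff.mpr contDiff_const
    exact hc.comp_contMDiffOn (contMDiffOn_chart (I := 𝓡 2) (x := x₀))
  have h2 := h1.comp h0 (fun y hy => (chartAt 𝔼 x₀).map_source hy)
  refine ContMDiffOn.congr h2 fun y hy => ?_
  simp only [Function.comp, tangentMapWithin]
  rw [mfderivWithin_of_isOpen (chartAt 𝔼 x₀).open_target ((chartAt 𝔼 x₀).map_source hy)]
  have h : ∀ z : M, z = y → ∀ w : 𝔼, (⟨y, w⟩ : TangentBundle (𝓡 2) M) = ⟨z, w⟩ := by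
    rintro z rfl w; rfl
  exact h _ ((chartAt 𝔼 x₀).left_inv hy) _

end Coordinates

/-! ### Pairs of vectors -/

theorem exists_basis_pair {F : Submodule ℝ R42} {a b : R42} (hi : LinearIndependent ℝ ![a, b])
    (hs : Submodule.span ℝ {a, b} = F) :
    ∃ B : Module.Basis (Fin 2) ℝ F, (B 0 : R42) = a ∧ (B 1 : R42) = b := by
  have hr : Submodule.span ℝ (Set.range ![a, b]) = F := by simpa [Set.pair_comm] using hs
  refine ⟨(Module.Basis.span hi).map (LinearEquiv.ofEq _ _ hr), ?_, ?_⟩ <;>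
  simp [Module.Basis.span_apply]

theorem finrank_pair {F : Submodule ℝ R42} {a b : R42} (hi : LinearIndependent ℝ ![a, b])
    (hs : Submodule.span ℝ {a, b} = F) : Module.finrank ℝ F = 2 := by
  obtain ⟨B, -, -⟩ := exists_basis_pair hi hs
  simpa using Module.finrank_eq_card_basis B

theorem trace_pair {F : Submodule ℝ R42} (B : Module.Basis (Fin 2) ℝ F)
    {L : F →ₗ[ℝ] F} {m₁₁ m₁₂ m₂₁ m₂₂ : ℝ}
    (h₁ : L (B 0) = m₁₁ • B 0 + m₁₂ • B 1) (h₂ : L (B 1) = m₂₁ • B 0 + m₂₂ • B 1) :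
    LinearMap.trace ℝ F L = m₁₁ + m₂₂ := by
  rw [LinearMap.trace_eq_matrix_trace ℝ B, Matrix.trace_fin_two, LinearMap.toMatrix_apply,
    LinearMap.toMatrix_apply, h₁, h₂]
  simp

theorem linearIndependent_pair {a b : R42} (h : ∀ s t : ℝ, s • a + t • b = 0 → s = 0 ∧ t = 0) :
    LinearIndependent ℝ ![a, b] := LinearIndependent.pair_iff.mpr h

/-- The space F^⊥ / F is two-dimensional, and the Gram determinant makes n₁, n₂ independent modulo
F. So F ⊕ ⟨n₁, n₂⟩ has dimension four and its orthogonal complement, of dimension two, is F itself.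
-/
theorem mem_of_perp_pair {F : Submodule ℝ R42} (h2 : Module.finrank ℝ F = 2)
    (hF : IsIsotropic F) {n₁ n₂ v : R42} (h₁ : n₁ ∈ perp F) (h₂ : n₂ ∈ perp F)
    (hg : form n₁ n₁ * form n₂ n₂ - form n₁ n₂ ^ 2 ≠ 0)
    (hv : v ∈ perp F) (hv₁ : form n₁ v = 0) (hv₂ : form n₂ v = 0) : v ∈ F := by
  have key : ∀ s t : ℝ, s • n₁ + t • n₂ ∈ F → s = 0 ∧ t = 0 := by
    intro s t hst
    have e₁ : form (s • n₁ + t • n₂) n₁ = 0 := h₁ _ hst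
    have e₂ : form (s • n₁ + t • n₂) n₂ = 0 := h₂ _ hst
    simp only [map_add, map_smul, LinearMap.add_apply, LinearMap.smul_apply, smul_eq_mul,
      form_comm n₂ n₁] at e₁ e₂
    constructor
    · have : s * (form n₁ n₁ * form n₂ n₂ - form n₁ n₂ ^ 2) = 0 := by
        linear_combination form n₂ n₂ * e₁ - form n₁ n₂ * e₂
      exact (mul_eq_zero.mp this).resolve_right hg
    · have : t * (form n₁ n₁ * form n₂ n₂ - form n₁ n₂ ^ 2) = 0 := by
        linear_combination form n₁ n₁ * e₂ - form n₁ n₂ * e₁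
      exact (mul_eq_zero.mp this).resolve_right hg
  have hi : LinearIndependent ℝ ![n₁, n₂] :=
    linearIndependent_pair fun s t hst => key s t (hst ▸ F.zero_mem)
  have hr := finrank_pair hi rfl
  have hd : F ⊓ Submodule.span ℝ {n₁, n₂} = ⊥ := by
    rw [eq_bot_iff]
    rintro w ⟨hw, hw'⟩
    obtain ⟨s, t, rfl⟩ := Submodule.mem_span_pair.mp hw'
    obtain ⟨rfl, rfl⟩ := key s t hw
    simp
  have hsum := Submodule.finrank_sup_add_finrank_inf_eq F (Submodule.span ℝ {n₁, n₂})
  rw [hd, finrank_bot, h2, hr] at hsum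
  have h4 := finrank_perp (F ⊔ Submodule.span ℝ {n₁, n₂})
  have hle : F ≤ perp (F ⊔ Submodule.span ℝ {n₁, n₂}) := by
    intro w hw u hu
    obtain ⟨x, hx, y, hy, rfl⟩ := Submodule.mem_sup.mp hu
    obtain ⟨s, t, rfl⟩ := Submodule.mem_span_pair.mp hy
    have e₁ : form w n₁ = 0 := h₁ w hw
    have e₂ : form w n₂ = 0 := h₂ w hw
    have e₃ : form x w = 0 := hF hw x hx
    change form _ _ = 0
    simp [e₃, form_comm _ w, e₁, e₂]
  have heq := Submodule.eq_of_le_of_finrank_le hle (by omega)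
  rw [heq]
  intro u hu
  obtain ⟨x, hx, y, hy, rfl⟩ := Submodule.mem_sup.mp hu
  obtain ⟨s, t, rfl⟩ := Submodule.mem_span_pair.mp hy
  have e₃ : form x v = 0 := hv x hx
  change form _ _ = 0
  simp [e₃, hv₁, hv₂]

/-! ### Frames and sections -/

section Frames

variable {M : Type*} [TopologicalSpace M] [ChartedSpace (EuclideanSpace ℝ (Fin 2)) M]

/-- The coefficients of a smooth section with respect to a smooth frame are smooth. -/
theorem exists_smooth_coeff {k : ℕ} {U : Set M} (hU : IsOpen U) {e : Fin k → M → R42}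
    (he : ∀ i, SmoothOn (e i) U) {x : M} (hx : x ∈ U)
    (hi : LinearIndependent ℝ fun i => e i x) {σ : M → R42} (hσ : SmoothOn σ U)
    (hs : ∀ y ∈ U, σ y ∈ Submodule.span ℝ (Set.range fun i => e i y)) :
    ∃ W ⊆ U, IsOpen W ∧ x ∈ W ∧ ∃ c : Fin k → M → ℝ, (∀ i, SmoothOn (c i) W) ∧
      ∀ y ∈ W, σ y = ∑ i, c i y • e i y := by
  -- With L a left inverse of the frame at x, the map A y = L ∘ (frame at y) is the identity at x,
  -- hence invertible nearby, and the coefficients of σ are A⁻¹ L σ.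
  obtain ⟨L₀, hL₀⟩ := (Fintype.linearCombination ℝ fun i => e i x).exists_leftInverse_of_injective
    (LinearMap.ker_eq_bot.mpr (linearIndependent_iff_injective_fintypeLinearCombination.mp hi))
  let L : R42 →L[ℝ] (Fin k → ℝ) := LinearMap.toContinuousLinearMap L₀
  let C : Fin k → R42 →L[ℝ] ((Fin k → ℝ) →L[ℝ] (Fin k → ℝ)) := fun i =>
    (ContinuousLinearMap.smulRightL ℝ (Fin k → ℝ) (Fin k → ℝ)
      (ContinuousLinearMap.proj (R := ℝ) i)).comp L
  let A : M → ((Fin k → ℝ) →L[ℝ] (Fin k → ℝ)) := fun y => ∑ i, C i (e i y)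
  have hAv : ∀ y v, A y v = L (∑ i, v i • e i y) := by
    intro y v
    simp [A, C]
  have hA : SmoothOn A U := contMDiffOn_finsetSum fun i _ =>
    ((C i).contDiff.contMDiff (n := ∞)).comp_contMDiffOn (he i)
  have hAx : IsUnit (A x) := by
    have : A x = 1 := by
      ext1 v
      rw [hAv]
      exact LinearMap.congr_fun hL₀ v
    rw [this]; exact isUnit_one
  let W : Set M := U ∩ A ⁻¹' {T | IsUnit T}
  have hW : IsOpen W := hA.continuousOn.isOpen_inter_preimage hU Units.isOpen
  have hinv : SmoothOn (fun y => Ring.inverse (A y)) W :=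
    SmoothOn.comp_contDiffAt (hA.mono Set.inter_subset_left) (g := Ring.inverse) fun y hy => by
      obtain ⟨u, hu⟩ := hy.2
      rw [← hu]; exact contDiffAt_ringInverse ℝ u
  have hLσ : SmoothOn (fun y => L (σ y)) W :=
    (L.contDiff.contMDiff (n := ∞)).comp_contMDiffOn (hσ.mono Set.inter_subset_left)
  have hc := hinv.bilin (ContinuousLinearMap.id ℝ _) hLσ
  refine ⟨W, Set.inter_subset_left, hW, ⟨hx, hAx⟩, fun i y => Ring.inverse (A y) (L (σ y)) i,
    fun i => ?_, fun y hy => ?_⟩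
  · exact ((ContinuousLinearMap.proj (R := ℝ) (φ := fun _ : Fin k => ℝ) i).contDiff.contMDiff
      (n := ∞)).comp_contMDiffOn hc
  · obtain ⟨d, hd⟩ := (Submodule.mem_span_range_iff_exists_fun ℝ).mp (hs y hy.1)
    have : Ring.inverse (A y) (L (σ y)) = d := by
      rw [← hd, ← hAv, ← mul_apply_eq_comp, Ring.inverse_mul_cancel _ hy.2]
      rfl
    simp only [this, hd]

/-- `e₁, e₂` is a smooth frame of the rank two bundle `f` over the open set `U`. -/
structure IsFrame₂ (f : M → Submodule ℝ R42) (U : Set M) (e₁ e₂ : M → R42) : Prop where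
  isOpen : IsOpen U
  smooth₁ : SmoothOn e₁ U
  smooth₂ : SmoothOn e₂ U
  indep : ∀ y ∈ U, LinearIndependent ℝ ![e₁ y, e₂ y]
  span : ∀ y ∈ U, Submodule.span ℝ {e₁ y, e₂ y} = f y

/-- `e` is a smooth frame of the line bundle `W` over the open set `U`. -/
structure IsFrame₁ (W : M → Submodule ℝ R42) (U : Set M) (e : M → R42) : Prop where
  isOpen : IsOpen U
  smooth : SmoothOn e U
  ne_zero : ∀ y ∈ U, e y ≠ 0
  span : ∀ y ∈ U, Submodule.span ℝ {e y} = W y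

theorem IsSubbundle.exists_frame₂ {f : M → Submodule ℝ R42} (hf : IsSubbundle 2 f) (x : M) :
    ∃ U e₁ e₂, IsFrame₂ f U e₁ e₂ ∧ x ∈ U := by
  obtain ⟨U, hU, hx, σ, hσ, h⟩ := hf x
  refine ⟨U, σ 0, σ 1, ⟨hU, hσ 0, hσ 1, fun y hy => ?_, fun y hy => ?_⟩, hx⟩
  · convert (h y hy).1 using 1
    ext i; fin_cases i <;> rfl
  · rw [← (h y hy).2]
    congr 1
    ext v; simp [Fin.exists_fin_two, eq_comm]

theorem isSubbundle_of_frame₂ {f : M → Submodule ℝ R42}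
    (h : ∀ x, ∃ U e₁ e₂, IsFrame₂ f U e₁ e₂ ∧ x ∈ U) : IsSubbundle 2 f := by
  intro x
  obtain ⟨U, e₁, e₂, hfr, hx⟩ := h x
  refine ⟨U, hfr.isOpen, hx, ![e₁, e₂], fun i => ?_, fun y hy => ⟨?_, ?_⟩⟩
  · fin_cases i
    exacts [hfr.smooth₁, hfr.smooth₂]
  · convert hfr.indep y hy using 1
    ext i; fin_cases i <;> rfl
  · rw [← hfr.span y hy]
    congr 1
    ext v; simp [or_comm]

theorem IsSubbundle.exists_frame₁ {W : M → Submodule ℝ R42} (hW : IsSubbundle 1 W) (x : M) :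
    ∃ U e, IsFrame₁ W U e ∧ x ∈ U := by
  obtain ⟨U, hU, hx, σ, hσ, h⟩ := hW x
  refine ⟨U, σ 0, ⟨hU, hσ 0, fun y hy => (h y hy).1.ne_zero 0, fun y hy => ?_⟩, hx⟩
  rw [← (h y hy).2]
  congr 1
  ext v; simp [eq_comm]

theorem isSubbundle_of_frame₁ {W : M → Submodule ℝ R42}
    (h : ∀ x, ∃ U e, IsFrame₁ W U e ∧ x ∈ U) : IsSubbundle 1 W := by
  intro x
  obtain ⟨U, e, hfr, hx⟩ := h x
  refine ⟨U, hfr.isOpen, hx, fun _ => e, fun _ => hfr.smooth, fun y hy => ⟨?_, ?_⟩⟩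
  · exact LinearIndependent.of_subsingleton (0 : Fin 1) (hfr.ne_zero y hy)
  · rw [← hfr.span y hy]
    congr 1
    ext v; simp

namespace IsFrame₂

variable {f : M → Submodule ℝ R42} {U : Set M} {e₁ e₂ : M → R42}

theorem mem₁ (h : IsFrame₂ f U e₁ e₂) {y : M} (hy : y ∈ U) : e₁ y ∈ f y :=
  h.span y hy ▸ Submodule.subset_span (by simp)

theorem mem₂ (h : IsFrame₂ f U e₁ e₂) {y : M} (hy : y ∈ U) : e₂ y ∈ f y :=
  h.span y hy ▸ Submodule.subset_span (by simp)

theorem exists_of_mem (h : IsFrame₂ f U e₁ e₂) {y : M} (hy : y ∈ U) {v : R42} (hv : v ∈ f y) :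
    ∃ a b : ℝ, v = a • e₁ y + b • e₂ y := by
  rw [← h.span y hy] at hv
  obtain ⟨a, b, hab⟩ := Submodule.mem_span_pair.mp hv
  exact ⟨a, b, hab.symm⟩

theorem finrank (h : IsFrame₂ f U e₁ e₂) {y : M} (hy : y ∈ U) : Module.finrank ℝ (f y) = 2 :=
  finrank_pair (h.indep y hy) (h.span y hy)

theorem section_const (h : IsFrame₂ f U e₁ e₂) {y : M} (hy : y ∈ U) (a b : ℝ) :
    IsSectionNear f y fun z => a • e₁ z + b • e₂ z :=
  ⟨U, h.isOpen, hy, (((smoothOn_const a U).fsmul h.smooth₁).fadd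
    ((smoothOn_const b U).fsmul h.smooth₂)), fun _ hz =>
      (f _).add_mem ((f _).smul_mem a (h.mem₁ hz)) ((f _).smul_mem b (h.mem₂ hz))⟩

theorem section₁ (h : IsFrame₂ f U e₁ e₂) {y : M} (hy : y ∈ U) : IsSectionNear f y e₁ :=
  ⟨U, h.isOpen, hy, h.smooth₁, fun _ hz => h.mem₁ hz⟩

theorem section₂ (h : IsFrame₂ f U e₁ e₂) {y : M} (hy : y ∈ U) : IsSectionNear f y e₂ :=
  ⟨U, h.isOpen, hy, h.smooth₂, fun _ hz => h.mem₂ hz⟩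

theorem exists_coeff (h : IsFrame₂ f U e₁ e₂) {x : M} (hx : x ∈ U) {σ : M → R42}
    (hσ : IsSectionNear f x σ) :
    ∃ W ⊆ U, IsOpen W ∧ x ∈ W ∧ ∃ c₁ c₂ : M → ℝ, SmoothOn c₁ W ∧ SmoothOn c₂ W ∧
      ∀ y ∈ W, σ y = c₁ y • e₁ y + c₂ y • e₂ y := by
  obtain ⟨U', hU', hx', hs, hm⟩ := hσ
  obtain ⟨W, hWU, hW, hxW, c, hc, hce⟩ := exists_smooth_coeff (k := 2) (h.isOpen.inter hU')
    (e := ![e₁, e₂]) (σ := σ) (fun i => by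
      fin_cases i
      exacts [h.smooth₁.mono Set.inter_subset_left, h.smooth₂.mono Set.inter_subset_left])
    ⟨hx, hx'⟩ (by
      convert h.indep x hx using 1
      ext i; fin_cases i <;> rfl) (hs.mono Set.inter_subset_right) (fun y hy => by
      have h1 := hm y hy.2
      rw [← h.span y hy.1] at h1
      convert h1 using 2
      ext v; simp [or_comm])
  refine ⟨W, fun y hy => (hWU hy).1, hW, hxW, c 0, c 1, hc 0, hc 1, fun y hy => ?_⟩
  rw [hce y hy, Fin.sum_univ_two]; rfl

/-- The derivative of a section, modulo the bundle. -/
theorem exists_der (h : IsFrame₂ f U e₁ e₂) {x : M} (hx : x ∈ U) {σ : M → R42}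
    (hσ : IsSectionNear f x σ) :
    ∃ a b : ℝ, σ x = a • e₁ x + b • e₂ x ∧ ∀ X, ∃ r ∈ f x,
      der σ x X = a • der e₁ x X + b • der e₂ x X + r := by
  obtain ⟨W, hWU, hW, hxW, c₁, c₂, hc₁, hc₂, hc⟩ := h.exists_coeff hx hσ
  refine ⟨c₁ x, c₂ x, hc x hxW, fun X => ?_⟩
  have h1 := h.smooth₁.diffAt h.isOpen hx
  have h2 := h.smooth₂.diffAt h.isOpen hx
  have d1 := hc₁.diffAt hW hxW
  have d2 := hc₂.diffAt hW hxW
  refine ⟨(der c₁ x X : ℝ) • e₁ x + (der c₂ x X : ℝ) • e₂ x,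
    (f x).add_mem ((f x).smul_mem _ (h.mem₁ hx)) ((f x).smul_mem _ (h.mem₂ hx)), ?_⟩
  rw [der_congr hW hxW hc, der_add ((hc₁.fsmul (h.smooth₁.mono hWU)).diffAt hW hxW)
    ((hc₂.fsmul (h.smooth₂.mono hWU)).diffAt hW hxW), der_smul d1 h1, der_smul d2 h2]
  module

end IsFrame₂

namespace IsFrame₁

variable {W : M → Submodule ℝ R42} {U : Set M} {e : M → R42}

theorem mem (h : IsFrame₁ W U e) {y : M} (hy : y ∈ U) : e y ∈ W y :=
  h.span y hy ▸ Submodule.subset_span (by simp)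

theorem isSectionNear (h : IsFrame₁ W U e) {y : M} (hy : y ∈ U) : IsSectionNear W y e :=
  ⟨U, h.isOpen, hy, h.smooth, fun _ hz => h.mem hz⟩

theorem exists_of_mem (h : IsFrame₁ W U e) {y : M} (hy : y ∈ U) {v : R42} (hv : v ∈ W y) :
    ∃ a : ℝ, v = a • e y := by
  rw [← h.span y hy] at hv
  obtain ⟨a, ha⟩ := Submodule.mem_span_singleton.mp hv
  exact ⟨a, ha.symm⟩

/-- The derivative of a section, modulo the bundle. -/
theorem exists_der (h : IsFrame₁ W U e) {x : M} (hx : x ∈ U) {σ : M → R42}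
    (hσ : IsSectionNear W x σ) :
    ∃ a : ℝ, σ x = a • e x ∧ ∀ X, ∃ b : ℝ, der σ x X = a • der e x X + b • e x := by
  obtain ⟨U', hU', hx', hs, hm⟩ := hσ
  obtain ⟨V, hVU, hV, hxV, c, hc, hce⟩ := exists_smooth_coeff (k := 1) (h.isOpen.inter hU')
    (e := fun _ => e) (σ := σ) (fun i => h.smooth.mono Set.inter_subset_left)
    ⟨hx, hx'⟩ (LinearIndependent.of_subsingleton (0 : Fin 1) (h.ne_zero x hx))
    (hs.mono Set.inter_subset_right) (fun y hy => by
      have h1 := hm y hy.2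
      rw [← h.span y hy.1] at h1
      simpa using h1)
  have hce' : ∀ y ∈ V, σ y = c 0 y • e y := fun y hy => by rw [hce y hy]; simp
  refine ⟨c 0 x, hce' x hxV, fun X => ⟨der (c 0) x X, ?_⟩⟩
  rw [der_congr hV hxV hce', der_smul ((hc 0).diffAt hV hxV) (h.smooth.diffAt h.isOpen hx)]
  module

end IsFrame₁

/-! ### Traces on fibres -/

/-- Every vector of the fibre is the value of a section, so the endomorphism in `IsFibreTrace` is
unique and determines c. -/
theorem isFibreTrace_iff {W : M → Submodule ℝ R42} {x : M} {A : (M → R42) → R42} {c : ℝ}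
    (L : W x →ₗ[ℝ] W x) (hex : ∀ v : W x, ∃ σ, IsSectionNear W x σ ∧ σ x = v)
    (hL : ∀ σ, IsSectionNear W x σ → ∀ v : W x, σ x = v → (L v : R42) = A σ) :
    IsFibreTrace W x A c ↔ c = LinearMap.trace ℝ (W x) L := by
  constructor
  · rintro ⟨L', hL', rfl⟩
    congr 1
    ext v
    obtain ⟨σ, hσ, hv⟩ := hex v
    rw [hL σ hσ v hv, hL' σ hσ v hv]
  · rintro rfl
    exact ⟨L, hL, rfl⟩

theorem IsFrame₁.isFibreTrace_iff {W : M → Submodule ℝ R42} {U : Set M} {e : M → R42}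
    (h : IsFrame₁ W U e) {x : M} (hx : x ∈ U) {A : (M → R42) → R42} {c m : ℝ}
    (hA : ∀ σ, IsSectionNear W x σ → A σ = m • σ x) :
    IsFibreTrace W x A c ↔ c = m := by
  rw [LieSphere.isFibreTrace_iff (m • LinearMap.id)]
  · have h1 : Module.finrank ℝ (W x) = 1 := by
      rw [← h.span x hx]; exact finrank_span_singleton (h.ne_zero x hx)
    rw [map_smul, LinearMap.trace_id, h1]; simp
  · rintro ⟨v, hv⟩
    obtain ⟨a, rfl⟩ := h.exists_of_mem hx hv
    refine ⟨fun y => a • e y, ⟨U, h.isOpen, hx, (smoothOn_const a U).fsmul h.smooth,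
      fun y hy => (W y).smul_mem a (h.mem hy)⟩, rfl⟩
  · intro σ hσ v hv
    rw [hA σ hσ, hv]; rfl

/-- As T kills f, derivatives of the coefficients of σ do not contribute to T (d_Y σ); the map is
tensorial and its trace is read off in the frame. -/
theorem IsFrame₂.isFibreTrace_iff {f : M → Submodule ℝ R42} {U : Set M} {e₁ e₂ : M → R42}
    (h : IsFrame₂ f U e₁ e₂) {x : M} (hx : x ∈ U) {T : EndR42} (hT : ∀ v ∈ f x, T v = 0)
    {Y : TangentSpace (𝓡 2) x} {m₁₁ m₁₂ m₂₁ m₂₂ c : ℝ}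
    (h₁ : T (der e₁ x Y) = m₁₁ • e₁ x + m₁₂ • e₂ x)
    (h₂ : T (der e₂ x Y) = m₂₁ • e₁ x + m₂₂ • e₂ x) :
    IsFibreTrace f x (fun σ => T (der σ x Y)) c ↔ c = m₁₁ + m₂₂ := by
  obtain ⟨B, hB0, hB1⟩ := exists_basis_pair (h.indep x hx) (h.span x hx)
  let L : f x →ₗ[ℝ] f x :=
    B.constr ℝ ![m₁₁ • B 0 + m₁₂ • B 1, m₂₁ • B 0 + m₂₂ • B 1]
  have hL0 : L (B 0) = m₁₁ • B 0 + m₁₂ • B 1 := by simp [L]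
  have hL1 : L (B 1) = m₂₁ • B 0 + m₂₂ • B 1 := by simp [L]
  rw [LieSphere.isFibreTrace_iff L, trace_pair B hL0 hL1]
  · rintro ⟨v, hv⟩
    obtain ⟨a, b, rfl⟩ := h.exists_of_mem hx hv
    exact ⟨_, h.section_const hx a b, rfl⟩
  · intro σ hσ v hv
    obtain ⟨a, b, hab, hd⟩ := h.exists_der hx hσ
    obtain ⟨r, hr, hdr⟩ := hd Y
    have hv' : v = a • B 0 + b • B 1 := by
      apply Subtype.ext
      rw [← hv, hab]; simp [hB0, hB1]
    rw [hv', map_add, map_smul, map_smul, hL0, hL1]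
    change _ = T (der σ x Y)
    rw [hdr, map_add, map_add, map_smul, map_smul, hT r hr, h₁, h₂]
    simp [hB0, hB1]

end Frames

/-! ### Legendre maps -/

section Legendre

variable {M : Type*} [TopologicalSpace M] [ChartedSpace (EuclideanSpace ℝ (Fin 2)) M]

local notation "𝔼" => EuclideanSpace ℝ (Fin 2)

variable {f : M → Submodule ℝ R42}

theorem IsSectionNear.diffAt {W : M → Submodule ℝ R42} {x : M} {σ : M → R42}
    (h : IsSectionNear W x σ) : DiffAt σ x := by
  obtain ⟨U, hU, hx, hs, -⟩ := h
  exact SmoothOn.diffAt hs hU hx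

theorem IsSectionNear.mem {W : M → Submodule ℝ R42} {x : M} {σ : M → R42}
    (h : IsSectionNear W x σ) : σ x ∈ W x := by
  obtain ⟨U, hU, hx, hs, hm⟩ := h
  exact hm x hx

theorem IsSectionNear.der_mem_derived {W : M → Submodule ℝ R42} {x : M} {σ : M → R42}
    (h : IsSectionNear W x σ) (X : TangentSpace (𝓡 2) x) : der σ x X ∈ derived W x :=
  Submodule.subset_span ⟨σ, h, Or.inr ⟨X, rfl⟩⟩

theorem IsSectionNear.mem_derived {W : M → Submodule ℝ R42} {x : M} {σ : M → R42}
    (h : IsSectionNear W x σ) : σ x ∈ derived W x :=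
  Submodule.subset_span ⟨σ, h, Or.inl rfl⟩

namespace IsLegendre

theorem form_eq_zero (hf : IsLegendre f) {x : M} {v w : R42} (hv : v ∈ f x) (hw : w ∈ f x) :
    form v w = 0 := hf.isotropic x hw v hv

theorem der_mem_perp (hf : IsLegendre f) {x : M} {σ : M → R42} (hσ : IsSectionNear f x σ)
    (X : TangentSpace (𝓡 2) x) : der σ x X ∈ perp (f x) :=
  hf.contact x (hσ.der_mem_derived X)

theorem form_der (hf : IsLegendre f) {x : M} {σ : M → R42} (hσ : IsSectionNear f x σ)
    (X : TangentSpace (𝓡 2) x) {v : R42} (hv : v ∈ f x) : form (der σ x X) v = 0 := by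
  rw [form_comm]; exact hf.der_mem_perp hσ X v hv

theorem form_eq_zero_of_mem_of_mem_perp (_hf : IsLegendre f) {x : M} {v w : R42} (hv : v ∈ f x)
    (hw : w ∈ perp (f x)) : form v w = 0 := hw v hv

theorem mem_perp_of_mem (hf : IsLegendre f) {x : M} {v : R42} (hv : v ∈ f x) : v ∈ perp (f x) :=
  hf.isotropic x hv

theorem finrank (hf : IsLegendre f) (x : M) : Module.finrank ℝ (f x) = 2 := by
  obtain ⟨U, e₁, e₂, h, hx⟩ := hf.smooth.exists_frame₂ x
  exact h.finrank hx

variable [IsManifold (𝓡 2) ∞ M]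

/-- The second fundamental form of a Legendre map is symmetric. -/
theorem form_der_der_comm (hf : IsLegendre f) {x : M} {σ τ : M → R42}
    (hσ : IsSectionNear f x σ) (hτ : IsSectionNear f x τ) (X Y : TangentSpace (𝓡 2) x) :
    form (der σ x X) (der τ x Y) = form (der σ x Y) (der τ x X) := by
  obtain ⟨U, hU, hxU, hsU, hmU⟩ := hσ
  obtain ⟨W, hW, hxW, hsW, hmW⟩ := hτ
  have hx₀ := mem_chart_source 𝔼 x
  have hO : IsOpen ((chartAt 𝔼 x).source ∩ (U ∩ W)) := (chartAt 𝔼 x).open_source.inter (hU.inter hW)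
  have hxO : x ∈ (chartAt 𝔼 x).source ∩ (U ∩ W) := ⟨hx₀, hxU, hxW⟩
  obtain ⟨u, rfl⟩ := (coordField_bijective x hx₀).2 X
  obtain ⟨v, rfl⟩ := (coordField_bijective x hx₀).2 Y
  -- Contact gives (d_u σ, τ) = 0 near x; differentiating along v produces a second derivative that
  -- is symmetric in u and v.
  have key : ∀ u v : 𝔼, form (der (fun y => der σ y (coordField x u y)) x (coordField x v x)) (τ x)
      + form (der σ x (coordField x u x)) (der τ x (coordField x v x)) = 0 := by
    intro u v
    have h1 := SmoothOn.der_coordField hsU hU x u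
    rw [← der_form (h1.diffAt ((chartAt 𝔼 x).open_source.inter hU) ⟨hx₀, hxU⟩)
      (SmoothOn.diffAt hsW hW hxW)]
    refine der_eq_zero_of_eqOn hO hxO (c := 0) (fun y hy => ?_) _
    exact hf.form_der ⟨U, hU, hy.2.1, hsU, hmU⟩ _ (hmW y hy.2.2)
  have h1 := key u v
  have h2 := key v u
  rw [der_coordField_comm hsU hU x hxU hx₀ u v] at h1
  dsimp only
  linarith

end IsLegendre

/-- `e₁, e₂` is a frame of `f` over `U` and at the point `x` of `U` the vectors `e₁, e₂` span
the curvature spheres with curvature directions `X₁, X₂`. -/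
structure IsPrincipalAt (f : M → Submodule ℝ R42) (U : Set M) (e₁ e₂ : M → R42) (x : M)
    (X₁ X₂ : TangentSpace (𝓡 2) x) : Prop where
  frame : IsFrame₂ f U e₁ e₂
  mem : x ∈ U
  indep : LinearIndependent ℝ ![X₁, X₂]
  curv₁ : der e₁ x X₁ ∈ f x
  curv₂ : der e₂ x X₂ ∈ f x

theorem exists_smul_add_smul {x : M} {X₁ X₂ : TangentSpace (𝓡 2) x}
    (h : LinearIndependent ℝ ![X₁, X₂]) (Z : TangentSpace (𝓡 2) x) :
    ∃ a b : ℝ, Z = a • X₁ + b • X₂ := by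
  have h1 : Submodule.span ℝ (Set.range ![X₁, X₂]) = ⊤ := by
    have : FiniteDimensional ℝ (TangentSpace (𝓡 2) x) :=
      inferInstanceAs (FiniteDimensional ℝ (EuclideanSpace ℝ (Fin 2)))
    apply h.span_eq_top_of_card_eq_finrank
    have h2 : Module.finrank ℝ (EuclideanSpace ℝ (Fin 2)) = 2 := by simp
    exact (Fintype.card_fin 2).trans h2.symm
  have h2 : Z ∈ Submodule.span ℝ (Set.range ![X₁, X₂]) := h1 ▸ Submodule.mem_top
  rw [Submodule.mem_span_range_iff_exists_fun] at h2
  obtain ⟨c, hc⟩ := h2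
  refine ⟨c 0, c 1, ?_⟩
  rw [← hc, Fin.sum_univ_two]; rfl

namespace IsPrincipalAt

variable {U : Set M} {e₁ e₂ : M → R42} {x : M} {X₁ X₂ : TangentSpace (𝓡 2) x}

theorem symm (h : IsPrincipalAt f U e₁ e₂ x X₁ X₂) : IsPrincipalAt f U e₂ e₁ x X₂ X₁ where
  frame :=
    { isOpen := h.frame.isOpen
      smooth₁ := h.frame.smooth₂
      smooth₂ := h.frame.smooth₁
      indep := fun y hy => LinearIndependent.pair_symm_iff.mp (h.frame.indep y hy)
      span := fun y hy => by rw [Set.pair_comm]; exact h.frame.span y hy }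
  mem := h.mem
  indep := LinearIndependent.pair_symm_iff.mp h.indep
  curv₁ := h.curv₂
  curv₂ := h.curv₁

theorem der_mem_perp₁ (hf : IsLegendre f) (h : IsPrincipalAt f U e₁ e₂ x X₁ X₂)
    (X : TangentSpace (𝓡 2) x) : der e₁ x X ∈ perp (f x) :=
  hf.der_mem_perp (h.frame.section₁ h.mem) X

/-- Otherwise d_{X₂} would map both e₁ and e₂, hence all sections, into f, against the immersion
condition. -/
theorem der_notMem₁ (hf : IsLegendre f) (h : IsPrincipalAt f U e₁ e₂ x X₁ X₂) :
    der e₁ x X₂ ∉ f x := by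
  intro hn
  have h0 : X₂ = 0 := by
    refine hf.immersion x X₂ fun σ hσ => ?_
    obtain ⟨a, b, -, hd⟩ := h.frame.exists_der h.mem hσ
    obtain ⟨r, hr, hdr⟩ := hd X₂
    rw [hdr]
    exact (f x).add_mem ((f x).add_mem ((f x).smul_mem a hn) ((f x).smul_mem b h.curv₂)) hr
  exact h.indep.ne_zero 1 h0

theorem form_self_pos₁ (hf : IsLegendre f) (h : IsPrincipalAt f U e₁ e₂ x X₁ X₂) :
    0 < form (der e₁ x X₂) (der e₁ x X₂) :=
  form_self_pos (hf.isotropic x) (hf.finrank x) (h.der_mem_perp₁ hf X₂) (h.der_notMem₁ hf)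

theorem exists_der₁ (h : IsPrincipalAt f U e₁ e₂ x X₁ X₂) (a b : ℝ) :
    ∃ r ∈ f x, der e₁ x (a • X₁ + b • X₂) = b • der e₁ x X₂ + r :=
  ⟨a • der e₁ x X₁, (f x).smul_mem a h.curv₁, by rw [map_add, map_smul, map_smul, add_comm]⟩

variable [IsManifold (𝓡 2) ∞ M]

/-- By symmetry of the second fundamental form this is (d_{X₁} e₁, d_{X₂} e₂), a product of two
vectors of the isotropic space f. Thus d_{X₂} e₁ and d_{X₁} e₂ form an orthogonal basis of the
positive definite plane f^⊥ / f. -/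
theorem form_eq_zero (hf : IsLegendre f) (h : IsPrincipalAt f U e₁ e₂ x X₁ X₂) :
    form (der e₁ x X₂) (der e₂ x X₁) = 0 := by
  rw [hf.form_der_der_comm (h.frame.section₁ h.mem) (h.frame.section₂ h.mem)]
  exact hf.form_eq_zero h.curv₁ h.curv₂

theorem mem_of_perp (hf : IsLegendre f) (h : IsPrincipalAt f U e₁ e₂ x X₁ X₂) {v : R42}
    (hv : v ∈ perp (f x)) (h₁ : form (der e₁ x X₂) v = 0) (h₂ : form (der e₂ x X₁) v = 0) :
    v ∈ f x := by
  refine mem_of_perp_pair (hf.finrank x) (hf.isotropic x) (h.der_mem_perp₁ hf X₂)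
    (h.symm.der_mem_perp₁ hf X₁) ?_ hv h₁ h₂
  rw [h.form_eq_zero hf]
  have := h.form_self_pos₁ hf
  have := h.symm.form_self_pos₁ hf
  simp; constructor <;> linarith

/-- `f^⊥` is spanned by `e₁, e₂` and their derivatives. -/
theorem exists_of_mem_perp (hf : IsLegendre f) (h : IsPrincipalAt f U e₁ e₂ x X₁ X₂) {v : R42}
    (hv : v ∈ perp (f x)) : ∃ a b c d : ℝ,
      v = a • e₁ x + b • e₂ x + c • der e₁ x X₂ + d • der e₂ x X₁ := by
  set n₁ := der e₁ x X₂ with hn₁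
  set n₂ := der e₂ x X₁ with hn₂
  have p₁ : 0 < form n₁ n₁ := h.form_self_pos₁ hf
  have p₂ : 0 < form n₂ n₂ := h.symm.form_self_pos₁ hf
  have h12 : form n₁ n₂ = 0 := h.form_eq_zero hf
  have h21 : form n₂ n₁ = 0 := by rw [form_comm, h12]
  have hw : v - (form n₁ v / form n₁ n₁) • n₁ - (form n₂ v / form n₂ n₂) • n₂ ∈ f x := by
    refine h.mem_of_perp hf ?_ ?_ ?_
    · exact Submodule.sub_mem _ (Submodule.sub_mem _ hv
        (Submodule.smul_mem _ _ (h.der_mem_perp₁ hf X₂)))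
        (Submodule.smul_mem _ _ (h.symm.der_mem_perp₁ hf X₁))
    · rw [← hn₁]; simp [h12]; field_simp; ring
    · rw [← hn₂]; simp [h21]; field_simp; ring
  obtain ⟨a, b, hab⟩ := h.frame.exists_of_mem h.mem hw
  exact ⟨a, b, form n₁ v / form n₁ n₁, form n₂ v / form n₂ n₂, by rw [← hab]; module⟩

/-- Elements of `f ∧ f^⊥` in terms of a principal frame. -/
theorem exists_wedge (hf : IsLegendre f) (h : IsPrincipalAt f U e₁ e₂ x X₁ X₂) {T : EndR42}
    (hT : T ∈ wedgeSpan (f x) (perp (f x))) : ∃ α β γ δ ε : ℝ,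
      T = α • wedge (e₁ x) (der e₁ x X₂) + β • wedge (e₂ x) (der e₂ x X₁) +
        γ • wedge (e₁ x) (e₂ x) + δ • wedge (e₁ x) (der e₂ x X₁) +
        ε • wedge (e₂ x) (der e₁ x X₂) := by
  have key := wedgeSpan_induction hT (Submodule.span ℝ
    {wedge (e₁ x) (der e₁ x X₂), wedge (e₂ x) (der e₂ x X₁), wedge (e₁ x) (e₂ x),
      wedge (e₁ x) (der e₂ x X₁), wedge (e₂ x) (der e₁ x X₂)}) fun v hv w hw => by
    obtain ⟨a, b, rfl⟩ := h.frame.exists_of_mem h.mem hv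
    obtain ⟨a', b', c, d, rfl⟩ := h.exists_of_mem_perp hf hw
    simp only [Submodule.mem_span_insert, Submodule.mem_span_singleton, exists_exists_eq_and]
    refine ⟨a * c, _, ⟨b * d, _, ⟨a * b' - b * a', _, ⟨a * d, b * c, rfl⟩, rfl⟩, rfl⟩, ?_⟩
    simp only [wedge_add_left, wedge_add_right, wedge_smul_left, wedge_smul_right, wedge_self,
      wedge_swap (e₂ x) (e₁ x)]
    module
  simp only [Submodule.mem_span_insert, Submodule.mem_span_singleton, exists_exists_eq_and] at key
  obtain ⟨α, _, ⟨β, _, ⟨γ, _, ⟨δ, ε, rfl⟩, rfl⟩, rfl⟩, rfl⟩ := key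
  exact ⟨α, β, γ, δ, ε, by module⟩

end IsPrincipalAt

theorem IsCurvatureFrame.isPrincipalAt [IsManifold (𝓡 2) ∞ M] {U : Set M} {σ₁ σ₂ : M → R42}
    {X₁ X₂ : (x : M) → TangentSpace (𝓡 2) x} (h : IsCurvatureFrame f U σ₁ σ₂ X₁ X₂)
    (hU : IsOpen U) {x : M} (hx : x ∈ U) : IsPrincipalAt f U σ₁ σ₂ x (X₁ x) (X₂ x) where
  frame := ⟨hU, h.smooth₁, h.smooth₂, h.indep, h.span⟩
  mem := hx
  indep := h.indep_field x hx
  curv₁ := h.curv₁ x hx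
  curv₂ := h.curv₂ x hx

end Legendre

/-! ### Linear combinations of one-forms -/

section Forms

variable {M : Type*} [TopologicalSpace M] [ChartedSpace (EuclideanSpace ℝ (Fin 2)) M]
variable {F : Type*} [NormedAddCommGroup F] [NormedSpace ℝ F]

local notation "𝔼" => EuclideanSpace ℝ (Fin 2)

theorem inChart_lin (r s : ℝ) (α β : OneForm M F) (x₀ : M) :
    inChart (fun x => r • α x + s • β x) x₀ =
      fun y => r • inChart α x₀ y + s • inChart β x₀ y := by
  funext y
  ext u
  rfl

theorem IsSmoothForm.lin {α β : OneForm M F} (hα : IsSmoothForm α) (hβ : IsSmoothForm β)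
    (r s : ℝ) : IsSmoothForm (fun x => r • α x + s • β x) := by
  intro x₀
  rw [inChart_lin]
  exact ((hα x₀).const_smul r).add ((hβ x₀).const_smul s)

theorem IsSmoothForm.differentiableAt {α : OneForm M F} (hα : IsSmoothForm α) {x₀ : M} {y : 𝔼}
    (hy : y ∈ (chartAt 𝔼 x₀).target) : DifferentiableAt ℝ (inChart α x₀) y :=
  ((hα x₀).contDiffAt ((chartAt 𝔼 x₀).open_target.mem_nhds hy)).differentiableAt (by simp)

theorem extDer_lin {α β : OneForm M F} (hα : IsSmoothForm α) (hβ : IsSmoothForm β)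
    (r s : ℝ) {x₀ : M} {y : 𝔼} (hy : y ∈ (chartAt 𝔼 x₀).target) (u v : 𝔼) :
    extDer (fun x => r • α x + s • β x) x₀ y u v =
      r • extDer α x₀ y u v + s • extDer β x₀ y u v := by
  have h1 := ((hα.differentiableAt hy).hasFDerivAt.const_smul r).add
    ((hβ.differentiableAt hy).hasFDerivAt.const_smul s)
  rw [extDer, inChart_lin, HasFDerivAt.fderiv (f := fun y => r • inChart α x₀ y +
    s • inChart β x₀ y) h1, extDer, extDer]
  simp only [add_apply, smul_apply]
  module

/-- The one-form `X ↦ σ ∧ d_X τ`. -/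
def wedgeDer (σ τ : M → R42) : OneForm M EndR42 := fun x => (wedgeL (σ x)).comp (der τ x)

theorem wedgeDer_apply (σ τ : M → R42) (x : M) (X : TangentSpace (𝓡 2) x) :
    wedgeDer σ τ x X = wedge (σ x) (der τ x X) := rfl

variable [IsManifold (𝓡 2) ∞ M]

theorem isSmoothForm_wedgeDer {σ τ : M → R42} (hσ : SmoothOn σ Set.univ)
    (hτ : SmoothOn τ Set.univ) : IsSmoothForm (wedgeDer σ τ) :=
  isSmoothForm_of_smoothOn fun x₀ u => by
    have := hτ.der_coordField isOpen_univ x₀ u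
    rw [Set.inter_univ] at this
    exact SmoothOn.wedge (hσ.mono (Set.subset_univ _)) this

/-- The terms σ ∧ d_u d_v τ cancel because coordinate derivatives commute. -/
theorem extDer_wedgeDer {σ τ : M → R42} (hσ : SmoothOn σ Set.univ)
    (hτ : SmoothOn τ Set.univ) (x₀ : M) {x : M} (hx : x ∈ (chartAt 𝔼 x₀).source) (u v : 𝔼) :
    extDer (wedgeDer σ τ) x₀ (chartAt 𝔼 x₀ x) u v =
      wedge (der σ x (coordField x₀ u x)) (der τ x (coordField x₀ v x)) -
      wedge (der σ x (coordField x₀ v x)) (der τ x (coordField x₀ u x)) := by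
  rw [extDer_eq (isSmoothForm_wedgeDer hσ hτ) x₀ hx]
  have hd : ∀ u, DiffAt (fun y => der τ y (coordField x₀ u y)) x := fun u =>
    (hτ.der_coordField isOpen_univ x₀ u).diffAt
      ((chartAt 𝔼 x₀).open_source.inter isOpen_univ) ⟨hx, trivial⟩
  have hs : DiffAt σ x := hσ.diffAt isOpen_univ trivial
  simp only [wedgeDer_apply]
  rw [der_wedge hs (hd v), der_wedge hs (hd u),
    der_coordField_comm hτ isOpen_univ x₀ (Set.mem_univ x) hx u v]
  abel

theorem extDer_der {τ : M → F} (hτ : SmoothOn τ Set.univ) (x₀ : M) {x : M}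
    (hx : x ∈ (chartAt 𝔼 x₀).source) (u v : 𝔼) :
    extDer (der τ) x₀ (chartAt 𝔼 x₀ x) u v = 0 := by
  rw [extDer_eq (isSmoothForm_der hτ) x₀ hx,
    der_coordField_comm hτ isOpen_univ x₀ (Set.mem_univ x) hx u v, sub_self]

end Forms

/-! ### The sphere congruence orthogonal to a constant and a null vector field -/

section NullPair

/-- The rank one endomorphism `v ↦ (a, v) b`. -/
def rankOne : R42 →L[ℝ] R42 →L[ℝ] EndR42 :=
  (ContinuousLinearMap.smulRightL ℝ R42 R42).comp formL

theorem rankOne_apply (a b v : R42) : rankOne a b v = form a v • b := rfl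

/-- `m = k⁻¹ 𝔭 - (a / k²) p`, the vector with `(m, 𝔭) = 0` and `(m, p) = 1`. -/
def dualVec (𝔭 : R42) (a k : ℝ) (p : R42) : R42 := k⁻¹ • 𝔭 - (a / k ^ 2) • p

/-- The explicit orthogonal projection onto `⟨𝔭, p⟩^⊥`. -/
def perpProj (𝔭 : R42) (a k : ℝ) (p : R42) : EndR42 :=
  1 - (rankOne (dualVec 𝔭 a k p) p + k⁻¹ • rankOne p 𝔭)

variable {𝔭 p : R42} {a k : ℝ}

theorem perpProj_apply (v : R42) :
    perpProj 𝔭 a k p v = v - (form (dualVec 𝔭 a k p) v • p + (k⁻¹ * form p v) • 𝔭) := by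
  simp [perpProj, rankOne_apply, smul_smul]

theorem form_dualVec (v : R42) :
    form (dualVec 𝔭 a k p) v = k⁻¹ * form 𝔭 v - a / k ^ 2 * form p v := by
  simp [dualVec]

/-- The Gram determinant of 𝔭, p is -k², so their plane is non-degenerate, and `dualVec` and k⁻¹ p
form the basis dual to p, 𝔭. -/
theorem orthProj_perp_pair (ha : form 𝔭 𝔭 = a) (hk : form 𝔭 p = k) (hn : form p p = 0)
    (hk0 : k ≠ 0) :
    IsCompl (perp (Submodule.span ℝ {𝔭, p})) (perp (perp (Submodule.span ℝ {𝔭, p}))) ∧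
    orthProj (perp (Submodule.span ℝ {𝔭, p})) = perpProj 𝔭 a k p := by
  have hk' : form p 𝔭 = k := by rw [form_comm, hk]
  have hcomp : IsCompl (perp (Submodule.span ℝ {𝔭, p}))
      (perp (perp (Submodule.span ℝ {𝔭, p}))) := by
    refine (LinearMap.BilinForm.isCompl_orthogonal_iff_disjoint form_isRefl).mpr ?_
    rw [Submodule.disjoint_def]
    intro v hv hv'
    have hv' : v ∈ perp (perp (Submodule.span ℝ {𝔭, p})) := hv'
    rw [perp_perp] at hv'
    obtain ⟨s, t, rfl⟩ := Submodule.mem_span_pair.mp hv'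
    rw [mem_perp_span_pair] at hv
    simp only [map_add, map_smul, smul_eq_mul, ha, hk, hk', hn] at hv
    have hs : s = 0 := by
      have := hv.2
      simpa [hk0] using this
    subst hs
    have ht : t = 0 := by simpa [hk0] using hv.1
    simp [ht]
  refine ⟨hcomp, ?_⟩
  rw [orthProj, dif_pos hcomp]
  ext1 v
  rw [perpProj_apply]
  change Submodule.projection _ _ hcomp v = _
  set w := form (dualVec 𝔭 a k p) v • p + (k⁻¹ * form p v) • 𝔭 with hw
  have h1 : v - w ∈ perp (Submodule.span ℝ {𝔭, p}) := by
    rw [mem_perp_span_pair, hw]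
    simp only [map_sub, map_add, map_smul, smul_eq_mul, ha, hk, hk', hn, form_dualVec]
    constructor <;> field_simp <;> ring
  have h2 : w ∈ perp (perp (Submodule.span ℝ {𝔭, p})) := by
    rw [perp_perp]
    exact Submodule.add_mem _ (Submodule.smul_mem _ _ (Submodule.subset_span (by simp)))
      (Submodule.smul_mem _ _ (Submodule.subset_span (by simp)))
  have h3 : v = (v - w) + w := by abel
  conv_lhs => rw [h3]
  rw [map_add, Submodule.projection_apply_of_mem_left hcomp h1,
    Submodule.projection_apply_of_mem_right hcomp h2, add_zero]

theorem linearIndependent_null_pair (hk : form 𝔭 p = k) (hn : form p p = 0)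
    (hk0 : k ≠ 0) : LinearIndependent ℝ ![𝔭, p] := by
  refine linearIndependent_pair fun s t h => ?_
  have h1 : form (s • 𝔭 + t • p) p = 0 := by rw [h]; simp
  have hs : s = 0 := by simpa [hk, hn, hk0] using h1
  subst hs
  have h2 : form 𝔭 ((0 : ℝ) • 𝔭 + t • p) = 0 := by rw [h]; simp
  exact ⟨rfl, by simpa [hk, hk0] using h2⟩

theorem finrank_perp_null_pair (hk : form 𝔭 p = k) (hn : form p p = 0)
    (hk0 : k ≠ 0) : Module.finrank ℝ (perp (Submodule.span ℝ {𝔭, p})) = 4 := by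
  rw [finrank_perp, finrank_pair (linearIndependent_null_pair hk hn hk0) rfl]

end NullPair

/-- The bundle `⟨𝔭, p⟩^⊥`. -/
def perpBundle {M : Type*} (𝔭 : R42) (p : M → R42) (x : M) : Submodule ℝ R42 :=
  perp (Submodule.span ℝ {𝔭, p x})

theorem mem_perpBundle {M : Type*} {𝔭 : R42} {p : M → R42} {x : M} {v : R42} :
    v ∈ perpBundle 𝔭 p x ↔ form 𝔭 v = 0 ∧ form (p x) v = 0 := mem_perp_span_pair

theorem perp_perpBundle {M : Type*} {𝔭 : R42} {p : M → R42} (x : M) :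
    perp (perpBundle 𝔭 p x) = Submodule.span ℝ {𝔭, p x} :=
  perp_perp _

/-! ### The bundle orthogonal to 𝔭 and a varying null vector -/

section NullField

variable {M : Type*} [TopologicalSpace M] [ChartedSpace (EuclideanSpace ℝ (Fin 2)) M]

local notation "𝔼" => EuclideanSpace ℝ (Fin 2)

/-- A smooth null vector field `p` with `(𝔭, p) = k ≠ 0` constant; `a = (𝔭, 𝔭)`. -/
structure IsNullField (𝔭 : R42) (p : M → R42) (a k : ℝ) : Prop where
  smooth : SmoothOn p Set.univ
  form_const : form 𝔭 𝔭 = a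
  form_eq : ∀ x, form 𝔭 (p x) = k
  null : ∀ x, form (p x) (p x) = 0
  ne_zero : k ≠ 0

variable {𝔭 : R42} {p : M → R42} {a k : ℝ}

namespace IsNullField

theorem orthProj_eq (h : IsNullField 𝔭 p a k) (x : M) :
    orthProj (perpBundle 𝔭 p x) = perpProj 𝔭 a k (p x) :=
  (orthProj_perp_pair h.form_const (h.form_eq x) (h.null x) h.ne_zero).2

theorem orthProj_of_mem (h : IsNullField 𝔭 p a k) {x : M} {v : R42}
    (hv : v ∈ perpBundle 𝔭 p x) : orthProj (perpBundle 𝔭 p x) v = v := by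
  rw [mem_perpBundle] at hv
  rw [h.orthProj_eq, perpProj_apply, form_dualVec, hv.1, hv.2]; simp

theorem orthProj_mem (h : IsNullField 𝔭 p a k) (x : M) (v : R42) :
    orthProj (perpBundle 𝔭 p x) v ∈ perpBundle 𝔭 p x := by
  have h0 := h.ne_zero
  rw [mem_perpBundle, h.orthProj_eq, perpProj_apply]
  simp only [map_sub, map_add, map_smul, smul_eq_mul, h.form_const, h.form_eq x,
    form_comm (p x) 𝔭, h.null x, form_dualVec]
  constructor <;> field_simp <;> ring

theorem orthProj_const (h : IsNullField 𝔭 p a k) (x : M) :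
    orthProj (perpBundle 𝔭 p x) 𝔭 = 0 := by
  have h0 := h.ne_zero
  rw [h.orthProj_eq, perpProj_apply, form_dualVec, h.form_const, form_comm (p x), h.form_eq x]
  have : k⁻¹ * a - a / k ^ 2 * k = 0 := by field_simp; ring
  rw [this, inv_mul_cancel₀ h0]; simp

theorem orthProj_field (h : IsNullField 𝔭 p a k) (x : M) :
    orthProj (perpBundle 𝔭 p x) (p x) = 0 := by
  have h0 := h.ne_zero
  rw [h.orthProj_eq, perpProj_apply, form_dualVec, h.form_eq x, h.null x]
  rw [inv_mul_cancel₀ h0]; simp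

theorem diffAt (h : IsNullField 𝔭 p a k) (x : M) : DiffAt p x :=
  h.smooth.diffAt isOpen_univ trivial

theorem smooth_dualVec (h : IsNullField 𝔭 p a k) :
    SmoothOn (fun x => dualVec 𝔭 a k (p x)) Set.univ :=
  (smoothOn_const _ _).fsub ((smoothOn_const (a / k ^ 2) _).fsmul h.smooth)

theorem der_dualVec (h : IsNullField 𝔭 p a k) (x : M) (X : TangentSpace (𝓡 2) x) :
    der (fun y => dualVec 𝔭 a k (p y)) x X = -(a / k ^ 2) • der p x X := by
  unfold dualVec
  rw [der_sub ((smoothOn_const _ _).diffAt isOpen_univ trivial)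
    (((smoothOn_const (a / k ^ 2) _).fsmul h.smooth).diffAt isOpen_univ trivial), der_const,
    der_const_smul _ (h.diffAt x)]
  module

theorem form_der (h : IsNullField 𝔭 p a k) (x : M) (X : TangentSpace (𝓡 2) x) :
    form 𝔭 (der p x X) = 0 ∧ form (p x) (der p x X) = 0 := by
  constructor
  · have h1 := der_form (σ := fun _ => 𝔭) ((smoothOn_const 𝔭 _).diffAt isOpen_univ trivial)
      (h.diffAt x) X
    rw [der_eq_zero_of_eqOn isOpen_univ (Set.mem_univ x) (c := k) fun y _ => h.form_eq y,
      der_const] at h1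
    simpa using h1.symm
  · have h1 := der_form (h.diffAt x) (h.diffAt x) X
    rw [der_eq_zero_of_eqOn isOpen_univ (Set.mem_univ x) (c := 0) fun y _ => h.null y,
      form_comm (der p x X)] at h1
    linarith

theorem der_mem (h : IsNullField 𝔭 p a k) (x : M) (X : TangentSpace (𝓡 2) x) :
    der p x X ∈ perpBundle 𝔭 p x := mem_perpBundle.mpr (h.form_der x X)

theorem smooth_orthProj (h : IsNullField 𝔭 p a k) :
    SmoothOn (fun x => orthProj (perpBundle 𝔭 p x)) Set.univ := by
  simp only [h.orthProj_eq]
  exact (smoothOn_const _ _).fsub ((h.smooth_dualVec.bilin rankOne h.smooth).fadd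
    ((smoothOn_const k⁻¹ _).fsmul (h.smooth.bilin rankOne (smoothOn_const 𝔭 _))))

/-- Write m for `dualVec` and π for the projection onto V. Differentiating π gives v ↦ -(dp, v) m -
(m, v) dp. As m lies in V^⊥ and dp in V, the factor 1 - 2π reverses only the sign of the second
term, leaving m ∧ dp. -/
theorem normalForm_eq (h : IsNullField 𝔭 p a k) :
    normalForm (perpBundle 𝔭 p) = wedgeDer (fun x => dualVec 𝔭 a k (p x)) p := by
  funext x
  ext1 X
  ext1 v
  have h0 := h.ne_zero
  have hd := h.diffAt x
  have hm := h.smooth_dualVec.diffAt isOpen_univ (Set.mem_univ x)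
  have h𝔭 : DiffAt (fun _ : M => 𝔭) x := (smoothOn_const 𝔭 _).diffAt isOpen_univ trivial
  have hr : DiffAt (fun y => rankOne (dualVec 𝔭 a k (p y)) (p y)) x :=
    (h.smooth_dualVec.bilin rankOne h.smooth).diffAt isOpen_univ trivial
  have hr' : DiffAt (fun y => rankOne (p y) 𝔭) x :=
    (h.smooth.bilin rankOne (smoothOn_const 𝔭 _)).diffAt isOpen_univ trivial
  have hr'' : DiffAt (fun y => k⁻¹ • rankOne (p y) 𝔭) x :=
    ((smoothOn_const k⁻¹ _).fsmul
      (h.smooth.bilin rankOne (smoothOn_const 𝔭 _))).diffAt isOpen_univ trivial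
  have key : der (fun y => orthProj (perpBundle 𝔭 p y)) x X =
      (a / k ^ 2) • rankOne (der p x X) (p x) - rankOne (dualVec 𝔭 a k (p x)) (der p x X) -
        k⁻¹ • rankOne (der p x X) 𝔭 := by
    simp only [h.orthProj_eq, perpProj]
    rw [der_sub ((smoothOn_const _ _).diffAt isOpen_univ trivial) (((h.smooth_dualVec.bilin
      rankOne h.smooth).fadd ((smoothOn_const k⁻¹ _).fsmul (h.smooth.bilin rankOne
      (smoothOn_const 𝔭 _)))).diffAt isOpen_univ trivial), der_const, der_add hr hr'',
      der_const_smul _ hr', der_bilin rankOne hm hd, der_bilin rankOne hd h𝔭, h.der_dualVec,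
      der_const]
    simp only [map_zero, map_smul, smul_apply, add_zero, zero_sub]
    module
  have hN : normalForm (perpBundle 𝔭 p) x X v =
      der (fun y => orthProj (perpBundle 𝔭 p y)) x X v - (2 : ℝ) •
        orthProj (perpBundle 𝔭 p x) (der (fun y => orthProj (perpBundle 𝔭 p y)) x X v) := by
    simp [normalForm]
  rw [hN, key, wedgeDer_apply]
  simp only [sub_apply, smul_apply, rankOne_apply, map_sub, map_smul,
    h.orthProj_const, h.orthProj_field, h.orthProj_of_mem (h.der_mem x X), wedge_apply]
  rw [show dualVec 𝔭 a k (p x) = k⁻¹ • 𝔭 - (a / k ^ 2) • p x from rfl]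
  module

theorem inducedConn_eq (h : IsNullField 𝔭 p a k) {x : M} {σ : M → R42}
    (hσ : IsSectionNear (perpBundle 𝔭 p) x σ) (Y : TangentSpace (𝓡 2) x) :
    inducedConn (perpBundle 𝔭 p) σ x Y = orthProj (perpBundle 𝔭 p x) (der σ x Y) := by
  obtain ⟨U, hU, hx, -, hm⟩ := hσ
  have h1 : ∀ y ∈ U, orthProj (perpBundle 𝔭 p y) (σ y) = σ y := fun y hy =>
    h.orthProj_of_mem (hm y hy)
  have h2 : ∀ y ∈ U, (1 - orthProj (perpBundle 𝔭 p y)) (σ y) = 0 := fun y hy => by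
    simp [h1 y hy]
  rw [inducedConn, der_congr hU hx h1, der_eq_zero_of_eqOn hU hx h2]
  simp

/-- `⟨𝔭, p⟩^⊥` is a rank four bundle. -/
theorem isSubbundle (h : IsNullField 𝔭 p a k) : IsSubbundle 4 (perpBundle 𝔭 p) := by
  intro x
  have hfr : ∀ y, Module.finrank ℝ (perpBundle 𝔭 p y) = 4 := fun y =>
    finrank_perp_null_pair (h.form_eq y) (h.null y) h.ne_zero
  let B := Module.finBasisOfFinrankEq ℝ (perpBundle 𝔭 p x) (hfr x)
  -- Projections of a basis of the fibre at x are sections of the bundle that stay independent near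
  -- x.
  let σ : Fin 4 → M → R42 := fun i y => orthProj (perpBundle 𝔭 p y) (B i)
  have hσ : ∀ i, SmoothOn (σ i) Set.univ := fun i =>
    h.smooth_orthProj.clm_app (smoothOn_const _ _)
  have hc : Continuous fun y => fun i => σ i y :=
    continuous_pi fun i => continuousOn_univ.mp (hσ i).continuousOn
  have hx : LinearIndependent ℝ fun i => σ i x := by
    have : (fun i => σ i x) = fun i => (B i : R42) := by
      funext i; exact h.orthProj_of_mem (B i).2
    rw [this]
    exact LinearIndependent.map' B.linearIndependent (Submodule.subtype _)
      (Submodule.ker_subtype _)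
  refine ⟨{y | LinearIndependent ℝ fun i => σ i y},
    isOpen_setOfPred_linearIndependent.preimage hc, hx, σ, fun i => (hσ i).mono (Set.subset_univ _),
    fun y hy => ⟨hy, ?_⟩⟩
  refine Submodule.eq_of_le_of_finrank_eq (Submodule.span_le.mpr ?_) ?_
  · rintro _ ⟨i, rfl⟩
    exact h.orthProj_mem y _
  · rw [hfr y]
    exact (finrank_span_eq_card hy).trans (by simp)

end IsNullField

end NullField

/-! ### The signature of `⟨𝔭, p⟩^⊥` -/

/-- A non-degenerate plane with a null vector represents every value; the coefficient μ of p solves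
(𝔭, 𝔭) + 2kμ = c. -/
theorem exists_form_eq {𝔭 p : R42} {k : ℝ} (hk : form 𝔭 p = k) (hn : form p p = 0)
    (hk0 : k ≠ 0) (c : ℝ) : ∃ n ∈ Submodule.span ℝ {𝔭, p}, form n n = c := by
  refine ⟨𝔭 + ((c - form 𝔭 𝔭) / (2 * k)) • p, Submodule.add_mem _
    (Submodule.subset_span (by simp)) (Submodule.smul_mem _ _ (Submodule.subset_span (by simp))), ?_⟩
  simp only [map_add, map_smul, LinearMap.add_apply, LinearMap.smul_apply, smul_eq_mul, hn,
    form_comm p 𝔭, hk]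
  field_simp; ring

/-- A sum of orthogonal vectors with non-zero squares vanishes only trivially. -/
theorem linearIndependent_of_orthogonal {n : ℕ} {v : Fin n → R42}
    (ho : ∀ i j, i ≠ j → form (v i) (v j) = 0) (hv : ∀ i, form (v i) (v i) ≠ 0) :
    LinearIndependent ℝ v := by
  rw [Fintype.linearIndependent_iff]
  intro g hg i
  have h1 : form (∑ j, g j • v j) (v i) = 0 := by rw [hg]; simp
  rw [map_sum, LinearMap.sum_apply, Finset.sum_eq_single i] at h1
  · simpa [hv i] using h1
  · intro j _ hj; simp [ho j i hj]
  · simp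

theorem form_sum_orthogonal {n : ℕ} {v : Fin n → R42}
    (ho : ∀ i j, i ≠ j → form (v i) (v j) = 0) (c : Fin n → ℝ) :
    form (∑ i, c i • v i) (∑ i, c i • v i) = ∑ i, c i ^ 2 * form (v i) (v i) := by
  rw [map_sum]
  refine Finset.sum_congr rfl fun i _ => ?_
  rw [map_sum, LinearMap.sum_apply, Finset.sum_eq_single i]
  · simp; ring
  · intro j _ hj; simp [ho j i hj]
  · simp

theorem card_le_two_of_orthogonal_neg {n : ℕ} {v : Fin n → R42}
    (ho : ∀ i j, i ≠ j → form (v i) (v j) = 0) (hv : ∀ i, form (v i) (v i) < 0) : n ≤ 2 := by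
  have hi := linearIndependent_of_orthogonal ho fun i => (hv i).ne
  have h1 := finrank_span_eq_card hi
  rw [Fintype.card_fin] at h1
  rw [← h1]
  refine finrank_le_two_of_nonpos fun w hw => ?_
  obtain ⟨c, rfl⟩ := (Submodule.mem_span_range_iff_exists_fun ℝ).mp hw
  rw [form_sum_orthogonal ho]
  exact Finset.sum_nonpos fun i _ => mul_nonpos_of_nonneg_of_nonpos (sq_nonneg _) (hv i).le

theorem card_le_four_of_orthogonal_pos {n : ℕ} {v : Fin n → R42}
    (ho : ∀ i j, i ≠ j → form (v i) (v j) = 0) (hv : ∀ i, 0 < form (v i) (v i)) : n ≤ 4 := by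
  have hi := linearIndependent_of_orthogonal ho fun i => (hv i).ne'
  have h1 := finrank_span_eq_card hi
  rw [Fintype.card_fin] at h1
  rw [← h1]
  refine finrank_le_four_of_pos fun w hw hn => ?_
  obtain ⟨c, rfl⟩ := (Submodule.mem_span_range_iff_exists_fun ℝ).mp hw
  rw [form_sum_orthogonal ho] at hn
  have hnn : ∀ i ∈ Finset.univ, 0 ≤ c i ^ 2 * form (v i) (v i) := fun i _ =>
    mul_nonneg (sq_nonneg _) (hv i).le
  have h0 := (Finset.sum_eq_zero_iff_of_nonneg hnn).mp
    (le_antisymm hn (Finset.sum_nonneg hnn))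
  refine Finset.sum_eq_zero fun i hi => ?_
  have := h0 i hi
  have hc : c i = 0 := by simpa [(hv i).ne'] using this
  simp [hc]

/-- The plane ⟨𝔭, p⟩ contains n₁, n₂ of squares 1 and -1. In an orthogonal basis of its complement,
two negative vectors together with n₂ would be three orthogonal negative vectors, and four positive
ones together with n₁ would be five orthogonal positive vectors. Hence exactly one basis vector is
negative. -/
theorem hasSignature31_perp_null_pair {𝔭 p : R42} {k : ℝ} (hk : form 𝔭 p = k)
    (hn : form p p = 0) (hk0 : k ≠ 0) : HasSignature31 (perp (Submodule.span ℝ {𝔭, p})) := by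
  set V := perp (Submodule.span ℝ {𝔭, p}) with hV
  have hcomp := (orthProj_perp_pair (a := form 𝔭 𝔭) rfl hk hn hk0).1
  have hfr : Module.finrank ℝ V = 4 := finrank_perp_null_pair hk hn hk0
  have hsymm : LinearMap.IsSymm (form.restrict V) := ⟨fun x y => form_comm _ _⟩
  obtain ⟨B, hB⟩ := LinearMap.BilinForm.exists_orthogonal_basis hsymm
  let B' : Module.Basis (Fin 4) ℝ V := B.reindex (finCongr hfr)
  let v : Fin 4 → R42 := fun i => (B' i : R42)
  have ho : ∀ i j, i ≠ j → form (v i) (v j) = 0 := by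
    intro i j hij
    have := hB (i := (finCongr hfr).symm i) (j := (finCongr hfr).symm j)
      (fun h => hij ((finCongr hfr).symm.injective h))
    simp only [v, B', Module.Basis.reindex_apply]
    exact this
  have hspan : Submodule.span ℝ (Set.range v) = V := by
    have h1 := congrArg (Submodule.map V.subtype) B'.span_eq
    rw [Submodule.map_span, Submodule.map_top, Submodule.range_subtype, ← Set.range_comp] at h1
    exact h1
  have hmem : ∀ i, v i ∈ V := fun i => (B' i).2
  have hperp : ∀ i, ∀ n ∈ Submodule.span ℝ {𝔭, p}, form n (v i) = 0 := fun i => (hmem i : _)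
  have hne : ∀ i, form (v i) (v i) ≠ 0 := by
    intro i h0
    have h1 : v i ∈ perp V := by
      rw [← hspan, mem_perp_span]
      rintro _ ⟨j, rfl⟩
      by_cases hij : j = i
      · rw [hij, h0]
      · exact ho j i hij
    have h2 : v i = 0 := by
      have := Submodule.disjoint_def.mp hcomp.disjoint (v i) (hmem i) h1
      exact this
    exact B'.ne_zero i (Subtype.ext h2)
  obtain ⟨n₁, hn₁, hn₁'⟩ := exists_form_eq hk hn hk0 1
  obtain ⟨n₂, hn₂, hn₂'⟩ := exists_form_eq hk hn hk0 (-1)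
  have hneg : ∀ i j, i ≠ j → form (v i) (v i) < 0 → ¬ form (v j) (v j) < 0 := by
    intro i j hij hi hj
    have := card_le_two_of_orthogonal_neg (v := ![v i, v j, n₂]) (fun a b hab => by
      fin_cases a <;> fin_cases b <;>
        simp [ho i j hij, ho j i hij.symm, hperp _ n₂ hn₂, form_comm _ n₂] at hab ⊢) (fun a => by
      fin_cases a <;> simp [hi, hj, hn₂'])
    omega
  have hpos : ∃ j, form (v j) (v j) < 0 := by
    by_contra hcon
    push Not at hcon
    have hp : ∀ i, 0 < form (v i) (v i) := fun i => lt_of_le_of_ne (hcon i) (hne i).symm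
    have := card_le_four_of_orthogonal_pos (v := Fin.cons n₁ v) (fun a b hab => by
      refine Fin.cases (fun hab => ?_) (fun a hab => ?_) a hab <;>
      refine Fin.cases (fun hab => ?_) (fun b hab => ?_) b hab
      · exact absurd rfl hab
      · simpa using hperp _ n₁ hn₁
      · simpa [form_comm _ n₁] using hperp _ n₁ hn₁
      · simpa using ho a b (fun h => hab (by rw [h]))) (fun a => by
      refine Fin.cases ?_ (fun a => ?_) a
      · simp [hn₁']
      · simpa using hp a)
    omega
  obtain ⟨j, hj⟩ := hpos
  have hp : ∀ i, i ≠ j → 0 < form (v i) (v i) := fun i hi =>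
    lt_of_le_of_ne (not_lt.mp (hneg j i hi.symm hj)) (hne i).symm
  -- The swap puts the timelike vector last, and r normalises all squares to 1 or -1.
  let s := Equiv.swap j (3 : Fin 4)
  let r : Fin 4 → ℝ := fun i => (Real.sqrt |form (v i) (v i)|)⁻¹
  have hr : ∀ i, r i ≠ 0 := fun i =>
    inv_ne_zero (Real.sqrt_ne_zero'.mpr (abs_pos.mpr (hne i)))
  have hrr : ∀ i, r i * r i * |form (v i) (v i)| = 1 := fun i => by
    have h1 : Real.sqrt |form (v i) (v i)| ≠ 0 := Real.sqrt_ne_zero'.mpr (abs_pos.mpr (hne i))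
    have h2 := Real.mul_self_sqrt (abs_nonneg (form (v i) (v i)))
    calc r i * r i * |form (v i) (v i)| = r i * r i * (Real.sqrt |form (v i) (v i)| *
          Real.sqrt |form (v i) (v i)|) := by rw [h2]
      _ = 1 := by simp only [r]; field_simp
  refine ⟨fun i => r (s i) • v (s i), ?_, fun i i' => ?_⟩
  · rw [← hspan]
    apply le_antisymm
    · rw [Submodule.span_le]
      rintro _ ⟨i, rfl⟩
      exact Submodule.smul_mem _ _ (Submodule.subset_span ⟨_, rfl⟩)
    · rw [Submodule.span_le]
      rintro _ ⟨i, rfl⟩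
      have h1 : v i = (r i)⁻¹ • (r (s (s.symm i)) • v (s (s.symm i))) := by
        rw [s.apply_symm_apply, smul_smul, inv_mul_cancel₀ (hr i), one_smul]
      rw [h1]
      exact Submodule.smul_mem _ _ (Submodule.subset_span ⟨_, rfl⟩)
  · by_cases hii : i = i'
    · subst hii
      have h1 : form (r (s i) • v (s i)) (r (s i) • v (s i)) =
          r (s i) * r (s i) * form (v (s i)) (v (s i)) := by simp; ring
      rw [h1, Matrix.diagonal_apply_eq]
      by_cases h3 : i = 3
      · have hs : s i = j := by rw [h3]; exact Equiv.swap_apply_right j 3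
        have h2 := hrr j
        rw [abs_of_neg hj] at h2
        rw [hs, h3]
        simp
        linarith
      · have hs : s i ≠ j := fun h => h3 (by
          have h4 : s.symm j = 3 := by simp [s]
          rw [← h4, ← h, s.symm_apply_apply])
        have h2 := hrr (s i)
        rw [abs_of_pos (hp _ hs)] at h2
        rw [h2]
        fin_cases i <;> simp at h3 ⊢
    · rw [Matrix.diagonal_apply_ne _ hii]
      simp [ho _ _ (fun h => hii (s.injective h))]

/-! ### Curvature of the Guichard family -/

/-- Dividing by t² - 1 leaves D + (t - 1) Z + (t² - 1) C, of degree two in t; the three values t =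
2, -2, 0 avoid the zeros of t² - 1 and suffice. -/
theorem eq_zero_of_guichard_polynomial {E : Type*} [AddCommGroup E] [Module ℝ E] {D Z C : E}
    (hc : ∀ t : ℝ, (t ^ 2 - 1) • D + ((t - 1) * (t ^ 2 - 1)) • Z + (t ^ 2 - 1) ^ 2 • C = 0) :
    D = 0 ∧ Z = 0 ∧ C = 0 := by
  have h1 : (12 : ℝ) • Z =
      (((2 : ℝ) ^ 2 - 1) • D + (((2 : ℝ) - 1) * ((2 : ℝ) ^ 2 - 1)) • Z + ((2 : ℝ) ^ 2 - 1) ^ 2 • C)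
      - ((((-2 : ℝ)) ^ 2 - 1) • D + (((-2 : ℝ) - 1) * ((-2 : ℝ) ^ 2 - 1)) • Z +
        ((-2 : ℝ) ^ 2 - 1) ^ 2 • C) := by module
  rw [hc 2, hc (-2), sub_zero] at h1
  have hZ : Z = 0 := by simpa using h1
  subst hZ
  have h2 : (12 : ℝ) • C =
      (((2 : ℝ) ^ 2 - 1) • D + (((2 : ℝ) - 1) * ((2 : ℝ) ^ 2 - 1)) • (0 : E) +
        ((2 : ℝ) ^ 2 - 1) ^ 2 • C) + (3 : ℝ) • (((0 : ℝ) ^ 2 - 1) • D +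
        (((0 : ℝ) - 1) * ((0 : ℝ) ^ 2 - 1)) • (0 : E) + ((0 : ℝ) ^ 2 - 1) ^ 2 • C) := by module
  rw [hc 2, hc 0, smul_zero, add_zero] at h2
  have hC : C = 0 := by simpa using h2
  subst hC
  exact ⟨by simpa using hc 0, rfl, rfl⟩

section Curvature

variable {M : Type*} [TopologicalSpace M] [ChartedSpace (EuclideanSpace ℝ (Fin 2)) M]

local notation "𝔼" => EuclideanSpace ℝ (Fin 2)

variable {𝔭 : R42} {p : M → R42} {a k : ℝ}

namespace IsNullField

theorem isSphereCongruence (h : IsNullField 𝔭 p a k) :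
    IsSphereCongruence 𝔭 (perpBundle 𝔭 p) where
  smooth := h.isSubbundle
  le _ _ hv := mem_vperp.mpr (mem_perpBundle.mp hv).1
  signature x := hasSignature31_perp_null_pair (h.form_eq x) (h.null x) h.ne_zero

theorem form_dualVec_self (h : IsNullField 𝔭 p a k) (x : M) :
    form (dualVec 𝔭 a k (p x)) (dualVec 𝔭 a k (p x)) = -(a / k ^ 2) := by
  have h0 := h.ne_zero
  rw [form_dualVec, dualVec]
  simp only [map_sub, map_smul, smul_eq_mul, h.form_const, h.form_eq x, form_comm (p x) 𝔭, h.null x]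
  field_simp; ring

theorem form_dualVec_of_mem (_h : IsNullField 𝔭 p a k) {x : M} {v : R42}
    (hv : v ∈ perpBundle 𝔭 p x) : form (dualVec 𝔭 a k (p x)) v = 0 := by
  rw [mem_perpBundle] at hv
  rw [form_dualVec, hv.1, hv.2]; simp

variable [IsManifold (𝓡 2) ∞ M]

/-- The curvature of `d + (t - 1) 𝒩 + (t² - 1) χ`. -/
theorem curvature_eq (h : IsNullField 𝔭 p a k) {χ : OneForm M EndR42} (hχ : IsSmoothForm χ)
    (hs : ∀ x X, IsSkew (χ x X)) (h𝔭 : ∀ x X, χ x X 𝔭 = 0) (hp : ∀ x X, χ x X (p x) = 0)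
    (t : ℝ) (x₀ : M) {x : M} (hx : x ∈ (chartAt 𝔼 x₀).source) (u v : 𝔼) :
    let α : OneForm M EndR42 :=
      fun x => (t - 1) • normalForm (perpBundle 𝔭 p) x + (t ^ 2 - 1) • χ x
    let y := chartAt 𝔼 x₀ x
    let X := coordField x₀ u x
    let Y := coordField x₀ v x
    extDer α x₀ y u v +
      (inChart α x₀ y u * inChart α x₀ y v - inChart α x₀ y v * inChart α x₀ y u) =
    (t ^ 2 - 1) • (extDer χ x₀ y u v - (a / k ^ 2) • wedge (der p x X) (der p x Y)) +
    ((t - 1) * (t ^ 2 - 1)) •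
      wedge (dualVec 𝔭 a k (p x)) (χ x X (der p x Y) - χ x Y (der p x X)) +
    (t ^ 2 - 1) ^ 2 • (χ x X * χ x Y - χ x Y * χ x X) := by
  intro α y X Y
  have hN := h.normalForm_eq
  have hsm : IsSmoothForm (wedgeDer (fun x => dualVec 𝔭 a k (p x)) p) :=
    isSmoothForm_wedgeDer h.smooth_dualVec h.smooth
  have e1 : extDer α x₀ y u v = (t - 1) • (-(2 * (a / k ^ 2)) • wedge (der p x X) (der p x Y)) +
      (t ^ 2 - 1) • extDer χ x₀ y u v := by
    simp only [α, hN]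
    rw [extDer_lin hsm hχ _ _ ((chartAt 𝔼 x₀).map_source hx),
      extDer_wedgeDer h.smooth_dualVec h.smooth x₀ hx, h.der_dualVec, h.der_dualVec,
      wedge_smul_left, wedge_smul_left,
      wedge_swap (der p x (coordField x₀ v x)) (der p x (coordField x₀ u x))]
    congr 2
    module
  have e2 : ∀ w, inChart α x₀ y w = (t - 1) • wedge (dualVec 𝔭 a k (p x))
      (der p x (coordField x₀ w x)) + (t ^ 2 - 1) • χ x (coordField x₀ w x) := by
    intro w
    rw [inChart_apply α x₀ hx]
    simp only [α, hN]
    rfl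
  have hχm : ∀ X, χ x X (dualVec 𝔭 a k (p x)) = 0 := by
    intro X; simp [dualVec, h𝔭, hp]
  -- For u, v orthogonal to m, the commutator of m ∧ u and m ∧ v is (m, m) u ∧ v, and (m, m) =
  -- -a/k².
  have c1 : wedge (dualVec 𝔭 a k (p x)) (der p x X) * wedge (dualVec 𝔭 a k (p x)) (der p x Y) -
      wedge (dualVec 𝔭 a k (p x)) (der p x Y) * wedge (dualVec 𝔭 a k (p x)) (der p x X) =
      -(a / k ^ 2) • wedge (der p x X) (der p x Y) := by
    rw [(isSkew_wedge _ _).commutator_wedge, wedge_apply, wedge_apply, h.form_dualVec_self,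
      h.form_dualVec_of_mem (h.der_mem x Y), form_comm (der p x X) (dualVec _ _ _ _),
      h.form_dualVec_of_mem (h.der_mem x X)]
    simp only [zero_smul, sub_zero, zero_sub, wedge_smul_left, wedge_neg_right, wedge_smul_right,
      wedge_self, smul_zero, neg_zero, add_zero]
  have c2 : ∀ X Y, χ x X * wedge (dualVec 𝔭 a k (p x)) (der p x Y) -
      wedge (dualVec 𝔭 a k (p x)) (der p x Y) * χ x X =
      wedge (dualVec 𝔭 a k (p x)) (χ x X (der p x Y)) := by
    intro X Y
    rw [(hs x X).commutator_wedge, hχm, wedge_zero_left, zero_add]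
  rw [e1, e2, e2]
  change _ + (((t - 1) • wedge (dualVec 𝔭 a k (p x)) (der p x X) + (t ^ 2 - 1) • χ x X) *
    ((t - 1) • wedge (dualVec 𝔭 a k (p x)) (der p x Y) + (t ^ 2 - 1) • χ x Y) -
    ((t - 1) • wedge (dualVec 𝔭 a k (p x)) (der p x Y) + (t ^ 2 - 1) • χ x Y) *
    ((t - 1) • wedge (dualVec 𝔭 a k (p x)) (der p x X) + (t ^ 2 - 1) • χ x X)) = _
  have c3 : ∀ A B C D : EndR42, ((t - 1) • A + (t ^ 2 - 1) • C) * ((t - 1) • B + (t ^ 2 - 1) • D) -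
      ((t - 1) • B + (t ^ 2 - 1) • D) * ((t - 1) • A + (t ^ 2 - 1) • C) =
      (t - 1) ^ 2 • (A * B - B * A) + ((t - 1) * (t ^ 2 - 1)) • ((C * B - B * C) - (D * A - A * D))
      + (t ^ 2 - 1) ^ 2 • (C * D - D * C) := by
    intro A B C D
    simp only [mul_add, add_mul, smul_mul_assoc, mul_smul_comm]
    module
  -- The exterior derivative and the bracket give d_X p ∧ d_Y p the coefficient -(a/k²) (2 (t - 1) +
  -- (t - 1)²) = -(a/k²) (t² - 1), so the whole curvature is divisible by t² - 1.
  rw [c3, c1, c2, c2, wedge_sub_right]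
  module

/-- The equations on `χ` equivalent to flatness of the Guichard family. -/
theorem flat_iff (h : IsNullField 𝔭 p a k) {χ : OneForm M EndR42} (hχ : IsSmoothForm χ)
    (hs : ∀ x X, IsSkew (χ x X)) (h𝔭 : ∀ x X, χ x X 𝔭 = 0) (hp : ∀ x X, χ x X (p x) = 0) :
    (∀ t : ℝ, IsFlat fun x => (t - 1) • normalForm (perpBundle 𝔭 p) x + (t ^ 2 - 1) • χ x) ↔
    (∀ x₀ x : M, x ∈ (chartAt 𝔼 x₀).source → ∀ u v : 𝔼,
      extDer χ x₀ (chartAt 𝔼 x₀ x) u v = (a / k ^ 2) •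
        wedge (der p x (coordField x₀ u x)) (der p x (coordField x₀ v x))) ∧
    (∀ x X Y, χ x X (der p x Y) = χ x Y (der p x X)) ∧ BracketVanishes χ := by
  constructor
  · intro hfl
    have key : ∀ x₀ x : M, x ∈ (chartAt 𝔼 x₀).source → ∀ u v : 𝔼,
        extDer χ x₀ (chartAt 𝔼 x₀ x) u v - (a / k ^ 2) •
          wedge (der p x (coordField x₀ u x)) (der p x (coordField x₀ v x)) = 0 ∧
        wedge (dualVec 𝔭 a k (p x)) (χ x (coordField x₀ u x) (der p x (coordField x₀ v x)) -
          χ x (coordField x₀ v x) (der p x (coordField x₀ u x))) = 0 ∧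
        χ x (coordField x₀ u x) * χ x (coordField x₀ v x) -
          χ x (coordField x₀ v x) * χ x (coordField x₀ u x) = 0 := by
      intro x₀ x hx u v
      have hc := fun t => (h.curvature_eq hχ hs h𝔭 hp t x₀ hx u v).symm.trans
        (hfl t x₀ _ ((chartAt 𝔼 x₀).map_source hx) u v)
      exact eq_zero_of_guichard_polynomial hc
    refine ⟨fun x₀ x hx u v => sub_eq_zero.mp (key x₀ x hx u v).1, fun x X Y => ?_,
      fun x X Y => ?_⟩
    · obtain ⟨u, rfl⟩ := (coordField_bijective x (mem_chart_source 𝔼 x)).2 X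
      obtain ⟨v, rfl⟩ := (coordField_bijective x (mem_chart_source 𝔼 x)).2 Y
      have h1 := (key x x (mem_chart_source 𝔼 x) u v).2.1
      -- Evaluating m ∧ w at p returns w, because (m, p) = 1 and w is orthogonal to p.
      have h2 := congrArg (fun T : EndR42 => T (p x)) h1
      have h4 : form (dualVec 𝔭 a k (p x)) (p x) = 1 := by
        rw [form_dualVec, h.form_eq, h.null, inv_mul_cancel₀ h.ne_zero]; simp
      have h5 : ∀ X w, form (χ x X w) (p x) = 0 := fun X w => by
        rw [hs x X w, hp]; simp
      simp only [wedge_apply, h4, one_smul, map_sub, LinearMap.sub_apply, h5, sub_zero, zero_smul,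
        zero_apply] at h2
      exact sub_eq_zero.mp h2
    · obtain ⟨u, rfl⟩ := (coordField_bijective x (mem_chart_source 𝔼 x)).2 X
      obtain ⟨v, rfl⟩ := (coordField_bijective x (mem_chart_source 𝔼 x)).2 Y
      exact (key x x (mem_chart_source 𝔼 x) u v).2.2
  · rintro ⟨h1, h2, h3⟩ t x₀ y hy u v
    have hx := (chartAt 𝔼 x₀).map_target hy
    have hc := h.curvature_eq hχ hs h𝔭 hp t x₀ hx u v
    dsimp only at hc
    rw [(chartAt 𝔼 x₀).right_inv hy] at hc
    refine hc.trans ?_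
    have h1' := h1 x₀ _ hx u v
    rw [(chartAt 𝔼 x₀).right_inv hy] at h1'
    rw [h1', h2 _ (coordField x₀ u _) (coordField x₀ v _), h3]
    simp [wedge_zero_right]

end IsNullField

end Curvature

/-! ### The correspondence between potentials and Guichard families -/

theorem apply_mem_of_perp_left {U W : Submodule ℝ R42} {T : EndR42} (hT : T ∈ wedgeSpan U W)
    {v : R42} (hv : v ∈ perp U) : T v ∈ U := by
  refine wedgeSpan_induction hT (mapsSubmodule (perp U) U) (fun a ha b _ u hu => ?_) v hv
  have h : form a u = 0 := hu a ha
  rw [wedge_apply, h, zero_smul, zero_sub]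
  exact U.neg_mem (U.smul_mem _ ha)

section Correspondence

variable {M : Type*} [TopologicalSpace M] [ChartedSpace (EuclideanSpace ℝ (Fin 2)) M]

local notation "𝔼" => EuclideanSpace ℝ (Fin 2)

variable {𝔭 : R42} {p : M → R42} {a k : ℝ} {f Λ : M → Submodule ℝ R42} {χ η : OneForm M EndR42}

theorem IsNullField.form_dualVec_field (h : IsNullField 𝔭 p a k) (x : M) :
    form (dualVec 𝔭 a k (p x)) (p x) = 1 := by
  rw [form_dualVec, h.form_eq, h.null, inv_mul_cancel₀ h.ne_zero]; simp

theorem IsNullField.form_dualVec_const (h : IsNullField 𝔭 p a k) (x : M) :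
    form (dualVec 𝔭 a k (p x)) 𝔭 = 0 := by
  have := h.ne_zero
  rw [form_dualVec, form_comm (p x), h.form_eq, h.form_const]; field_simp; ring

/-- The trace of `𝒩_X ∘ 𝒩_Y` on the normal bundle. -/
theorem IsNullField.exists_normal_trace (h : IsNullField 𝔭 p a k) (x : M)
    (X Y : TangentSpace (𝓡 2) x) :
    (∃ K : perp (perpBundle 𝔭 p x) →ₗ[ℝ] perp (perpBundle 𝔭 p x), ∀ v, (K v : R42) =
      normalForm (perpBundle 𝔭 p) x X (normalForm (perpBundle 𝔭 p) x Y v)) ∧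
    ∀ K : perp (perpBundle 𝔭 p x) →ₗ[ℝ] perp (perpBundle 𝔭 p x), (∀ v, (K v : R42) =
      normalForm (perpBundle 𝔭 p) x X (normalForm (perpBundle 𝔭 p) x Y v)) →
      LinearMap.trace ℝ (perp (perpBundle 𝔭 p x)) K =
        a / k ^ 2 * form (der p x X) (der p x Y) := by
  have hmX : form (der p x X) (dualVec 𝔭 a k (p x)) = 0 := by
    rw [form_comm, h.form_dualVec_of_mem (h.der_mem x X)]
  -- On V^⊥, 𝒩_Y = m ∧ d_Y p sends v to (m, v) d_Y p, which 𝒩_X sends back to a multiple of m. The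
  -- trace is therefore -(d_X p, d_Y p) (m, m).
  have hNN : ∀ v ∈ perp (perpBundle 𝔭 p x),
      normalForm (perpBundle 𝔭 p) x X (normalForm (perpBundle 𝔭 p) x Y v) =
      (-(form (der p x X) (der p x Y)) * form (dualVec 𝔭 a k (p x)) v) •
        dualVec 𝔭 a k (p x) := by
    intro v hv
    have h1 : form (der p x Y) v = 0 := hv _ (h.der_mem x Y)
    rw [h.normalForm_eq, wedgeDer_apply, wedgeDer_apply, wedge_apply _ _ v, h1, zero_smul, sub_zero,
      map_smul, wedge_apply, h.form_dualVec_of_mem (h.der_mem x Y)]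
    module
  have hmem : dualVec 𝔭 a k (p x) ∈ perp (perpBundle 𝔭 p x) := by
    rw [perp_perpBundle, dualVec]
    exact Submodule.sub_mem _ (Submodule.smul_mem _ _ (Submodule.subset_span (by simp)))
      (Submodule.smul_mem _ _ (Submodule.subset_span (by simp)))
  constructor
  · refine ⟨(((-(form (der p x X) (der p x Y))) • form (dualVec 𝔭 a k (p x))).comp
      (Submodule.subtype _)).smulRight ⟨_, hmem⟩, fun v => ?_⟩
    rw [hNN v v.2]
    simp
  · intro K hK
    obtain ⟨B, hB0, hB1⟩ := exists_basis_pair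
      (linearIndependent_null_pair (h.form_eq x) (h.null x) h.ne_zero) (perp_perpBundle x).symm
    have h0 : K (B 0) = (0 : ℝ) • B 0 + (0 : ℝ) • B 1 := by
      apply Subtype.ext
      rw [hK, hNN _ (B 0).2, hB0, h.form_dualVec_const]
      simp
    have h1 : K (B 1) = (-(form (der p x X) (der p x Y)) * k⁻¹) • B 0 +
        (a / k ^ 2 * form (der p x X) (der p x Y)) • B 1 := by
      apply Subtype.ext
      rw [hK, hNN _ (B 1).2, hB1, h.form_dualVec_field]
      simp only [Submodule.coe_add, Submodule.coe_smul, hB0, hB1, dualVec]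
      module
    rw [trace_pair B h0 h1, zero_add]

/-- The situation common to both directions of the correspondence: `f` is a Legendre map
containing the null field `p`, `Λ = f ∩ ⟨𝔭⟩^⊥`, and the forms `χ` and `η` determine each other
by `η = (2 k / a) χ - k⁻¹ p ∧ dp`. -/
structure IsGuichardLift (𝔭 : R42) (p : M → R42) (a k : ℝ) (f Λ : M → Submodule ℝ R42)
    (χ η : OneForm M EndR42) : Prop where
  nullField : IsNullField 𝔭 p a k
  ne_zero : a ≠ 0
  legendre : IsLegendre f
  subbundle : IsSubbundle 1 Λ
  inter : ∀ x, Λ x = f x ⊓ vperp 𝔭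
  mem : ∀ x, p x ∈ f x
  mem_wedge : ∀ x X, χ x X ∈ wedgeSpan (Λ x) (derived Λ x)
  rel : ∀ x X, η x X = (2 * k / a) • χ x X - k⁻¹ • wedge (p x) (der p x X)

namespace IsGuichardLift

theorem le (h : IsGuichardLift 𝔭 p a k f Λ χ η) (x : M) : Λ x ≤ f x :=
  h.inter x ▸ inf_le_left

theorem field_section (h : IsGuichardLift 𝔭 p a k f Λ χ η) (x : M) : IsSectionNear f x p :=
  ⟨Set.univ, isOpen_univ, trivial, h.nullField.smooth, fun y _ => h.mem y⟩

theorem section_of_section (h : IsGuichardLift 𝔭 p a k f Λ χ η) {x : M} {σ : M → R42}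
    (hσ : IsSectionNear Λ x σ) : IsSectionNear f x σ := by
  obtain ⟨U, hU, hx, hs, hm⟩ := hσ
  exact ⟨U, hU, hx, hs, fun y hy => h.le y (hm y hy)⟩

theorem le_perpBundle (h : IsGuichardLift 𝔭 p a k f Λ χ η) (x : M) :
    Λ x ≤ perpBundle 𝔭 p x := by
  intro v hv
  have h1 := h.le x hv
  rw [h.inter x] at hv
  exact mem_perpBundle.mpr ⟨mem_vperp.mp hv.2, h.legendre.form_eq_zero (h.mem x) h1⟩

theorem der_mem_perpBundle (h : IsGuichardLift 𝔭 p a k f Λ χ η) {x : M} {σ : M → R42}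
    (hσ : IsSectionNear Λ x σ) (X : TangentSpace (𝓡 2) x) :
    der σ x X ∈ perpBundle 𝔭 p x := by
  refine mem_perpBundle.mpr ⟨?_, ?_⟩
  · obtain ⟨U, hU, hx, hs, hm⟩ := id hσ
    have h1 := der_form (σ := fun _ => 𝔭) ((smoothOn_const 𝔭 _).diffAt isOpen_univ trivial)
      hσ.diffAt X
    rw [der_eq_zero_of_eqOn hU hx (c := 0) fun y hy =>
      (mem_perpBundle.mp (h.le_perpBundle y (hm y hy))).1, der_const] at h1
    simpa using h1.symm
  · rw [form_comm]
    exact h.legendre.form_der (h.section_of_section hσ) X (h.mem x)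

theorem derived_le (h : IsGuichardLift 𝔭 p a k f Λ χ η) (x : M) :
    derived Λ x ≤ perpBundle 𝔭 p x := by
  refine Submodule.span_le.mpr ?_
  rintro v ⟨σ, hσ, rfl | ⟨X, rfl⟩⟩
  · exact h.le_perpBundle x hσ.mem
  · exact h.der_mem_perpBundle hσ X

theorem derived_le_perp (h : IsGuichardLift 𝔭 p a k f Λ χ η) (x : M) :
    derived Λ x ≤ perp (f x) := by
  refine Submodule.span_le.mpr ?_
  rintro v ⟨σ, hσ, rfl | ⟨X, rfl⟩⟩
  · exact h.legendre.mem_perp_of_mem (h.le x hσ.mem)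
  · exact h.legendre.der_mem_perp (h.section_of_section hσ) X

theorem isSkew (h : IsGuichardLift 𝔭 p a k f Λ χ η) (x : M) (X : TangentSpace (𝓡 2) x) :
    IsSkew (χ x X) := isSkew_of_mem (h.mem_wedge x X)

/-- Both Λ and Λ^{(1)} lie in V, so χ kills V^⊥. -/
theorem apply_eq_zero (h : IsGuichardLift 𝔭 p a k f Λ χ η) {x : M} (X : TangentSpace (𝓡 2) x)
    {v : R42} (hv : v ∈ Submodule.span ℝ {𝔭, p x}) : χ x X v = 0 := by
  have key : ∀ w ∈ perpBundle 𝔭 p x, form w v = 0 := fun w hw => by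
    rw [form_comm]
    exact hw v hv
  exact apply_eq_zero_of_perp (h.mem_wedge x X) (fun u hu => key u (h.le_perpBundle x hu))
    fun w hw => key w (h.derived_le x hw)

theorem apply_const (h : IsGuichardLift 𝔭 p a k f Λ χ η) (x : M) (X : TangentSpace (𝓡 2) x) :
    χ x X 𝔭 = 0 := h.apply_eq_zero X (Submodule.subset_span (by simp))

theorem apply_field (h : IsGuichardLift 𝔭 p a k f Λ χ η) (x : M) (X : TangentSpace (𝓡 2) x) :
    χ x X (p x) = 0 := h.apply_eq_zero X (Submodule.subset_span (by simp))

theorem apply_mem (h : IsGuichardLift 𝔭 p a k f Λ χ η) {x : M} (X : TangentSpace (𝓡 2) x)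
    {v : R42} (hv : v ∈ perp (f x)) : χ x X v ∈ Λ x :=
  apply_mem_of_perp_left (h.mem_wedge x X) (perp_anti (h.le x) hv)

theorem apply_of_mem (h : IsGuichardLift 𝔭 p a k f Λ χ η) {x : M} (X : TangentSpace (𝓡 2) x)
    {v : R42} (hv : v ∈ f x) : χ x X v = 0 :=
  apply_eq_zero_of_perp (h.mem_wedge x X) (fun _ hu => h.legendre.form_eq_zero (h.le x hu) hv)
    fun w hw => by rw [form_comm]; exact h.derived_le_perp x hw v hv

theorem mem_wedge_potential (h : IsGuichardLift 𝔭 p a k f Λ χ η) (x : M)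
    (X : TangentSpace (𝓡 2) x) : η x X ∈ wedgeSpan (f x) (perp (f x)) := by
  rw [h.rel]
  exact Submodule.sub_mem _ (Submodule.smul_mem _ _
    (wedgeSpan_mono (h.le x) (h.derived_le_perp x) (h.mem_wedge x X))) (Submodule.smul_mem _ _
    (wedge_mem_wedgeSpan (h.mem x) (h.legendre.der_mem_perp (h.field_section x) X)))

/-- Only p ∧ dp sees 𝔭. The coefficient k⁻¹ in `rel` is the one that makes 𝔭 + t p conserved. -/
theorem potential_const (h : IsGuichardLift 𝔭 p a k f Λ χ η) (x : M)
    (X : TangentSpace (𝓡 2) x) : η x X 𝔭 = - der p x X := by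
  have hd := (h.nullField.form_der x X).1
  rw [form_comm] at hd
  rw [h.rel, sub_apply, smul_apply, h.apply_const, smul_apply, wedge_apply, form_comm (p x),
    h.nullField.form_eq, hd, zero_smul, sub_zero, smul_smul, inv_mul_cancel₀ h.nullField.ne_zero]
  simp

theorem exists_frame (h : IsGuichardLift 𝔭 p a k f Λ χ η) (x : M) :
    ∃ U e, IsFrame₁ Λ U e ∧ IsFrame₂ f U e p ∧ x ∈ U := by
  obtain ⟨U, e, he, hx⟩ := h.subbundle.exists_frame₁ x
  have hind : ∀ y ∈ U, LinearIndependent ℝ ![e y, p y] := by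
    intro y hy
    refine linearIndependent_pair fun s t hst => ?_
    have h1 : form 𝔭 (s • e y + t • p y) = 0 := by rw [hst]; simp
    rw [map_add, map_smul, map_smul, (mem_perpBundle.mp (h.le_perpBundle y (he.mem hy))).1,
      h.nullField.form_eq] at h1
    have ht : t = 0 := by simpa [h.nullField.ne_zero] using h1
    subst ht
    exact ⟨by simpa [he.ne_zero y hy] using hst, rfl⟩
  refine ⟨U, e, he, ⟨he.isOpen, he.smooth, h.nullField.smooth.mono (Set.subset_univ _), hind,
    fun y hy => ?_⟩, hx⟩
  refine Submodule.eq_of_le_of_finrank_eq (Submodule.span_le.mpr ?_) ?_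
  · rintro v (rfl | rfl)
    · exact h.le y (he.mem hy)
    · exact h.mem y
  · rw [finrank_pair (hind y hy) rfl, h.legendre.finrank]

/-- The two quadratic differentials in terms of `χ` and `p`. -/
theorem differentials (h : IsGuichardLift 𝔭 p a k f Λ χ η) (x : M)
    (X Y : TangentSpace (𝓡 2) x) : ∃ c : ℝ,
      (∀ t, IsFibreTrace Λ x (fun σ => χ x X (inducedConn (perpBundle 𝔭 p) σ x Y)) t ↔ t = c) ∧
      (∀ t, IsFibreTrace f x (fun σ => η x X (der σ x Y)) t ↔
        t = 2 * k / a * c + k⁻¹ * form (der p x X) (der p x Y)) := by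
  obtain ⟨U, e, he, hf, hx⟩ := h.exists_frame x
  have hsec := he.isSectionNear hx
  obtain ⟨c, hc⟩ := he.exists_of_mem hx (h.apply_mem X
    (h.legendre.der_mem_perp (h.section_of_section hsec) Y))
  obtain ⟨g, hg⟩ := he.exists_of_mem hx (h.apply_mem X
    (h.legendre.der_mem_perp (h.field_section x) Y))
  refine ⟨c, fun t => he.isFibreTrace_iff hx fun σ hσ => ?_, fun t => ?_⟩
  · have hV : IsSectionNear (perpBundle 𝔭 p) x σ := by
      obtain ⟨U, hU, hx, hs, hm⟩ := hσ
      exact ⟨U, hU, hx, hs, fun y hy => h.le_perpBundle y (hm y hy)⟩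
    rw [h.nullField.inducedConn_eq hV, h.nullField.orthProj_of_mem (h.der_mem_perpBundle hσ Y)]
    obtain ⟨r, hr, hd⟩ := he.exists_der hx hσ
    obtain ⟨b, hb⟩ := hd Y
    rw [hb, map_add, map_smul, map_smul, hc, h.apply_of_mem X (h.le x (he.mem hx)), hr]
    module
  -- In the frame e, p of f, the form χ maps f^⊥ into ⟨e⟩ and p ∧ d_X p maps it into ⟨p⟩. So the
  -- first diagonal entry comes from χ alone and the second from p ∧ dp alone.
  · refine hf.isFibreTrace_iff hx (fun v hv => apply_eq_zero_of_mem (h.legendre.isotropic x)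
      (h.mem_wedge_potential x X) hv) (m₁₁ := 2 * k / a * c)
      (m₁₂ := k⁻¹ * form (der p x X) (der e x Y)) (m₂₁ := 2 * k / a * g)
      (m₂₂ := k⁻¹ * form (der p x X) (der p x Y)) ?_ ?_
    · rw [h.rel, sub_apply, smul_apply, hc, smul_apply, wedge_apply,
        (mem_perpBundle.mp (h.der_mem_perpBundle hsec Y)).2]
      module
    · rw [h.rel, sub_apply, smul_apply, hg, smul_apply, wedge_apply,
        (h.nullField.form_der x Y).2]
      module

/-- With c the trace of σ ↦ χ_X 𝒟_Y σ on Λ, one has q^Λ = 2c + (a/k²) (d_X p, d_Y p) and q = (2k/a)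
c + k⁻¹ (d_X p, d_Y p); their ratio is a/k. -/
theorem isGuichardDifferential (h : IsGuichardLift 𝔭 p a k f Λ χ η) {q : BiForm M}
    (hq : IsQuadraticDifferential f η q) :
    IsGuichardDifferential Λ (perpBundle 𝔭 p) χ fun x X Y => a / k * q x X Y := by
  intro x X Y
  obtain ⟨c, hc₁, hc₂⟩ := h.differentials x X Y
  obtain ⟨⟨K, hK⟩, hK'⟩ := h.nullField.exists_normal_trace x X Y
  refine ⟨c, K, (hc₁ c).mpr rfl, hK, ?_⟩
  dsimp only
  rw [hK' K hK, (hc₂ _).mp (hq x X Y)]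
  have := h.ne_zero
  have := h.nullField.ne_zero
  field_simp

theorem isQuadraticDifferential (h : IsGuichardLift 𝔭 p a k f Λ χ η) {q : BiForm M}
    (hq : IsGuichardDifferential Λ (perpBundle 𝔭 p) χ q) :
    IsQuadraticDifferential f η fun x X Y => k / a * q x X Y := by
  intro x X Y
  obtain ⟨c, hc₁, hc₂⟩ := h.differentials x X Y
  obtain ⟨-, hK'⟩ := h.nullField.exists_normal_trace x X Y
  obtain ⟨c', K, hc', hK, hq'⟩ := hq x X Y
  obtain rfl := (hc₁ c').mp hc'
  rw [hc₂]
  dsimp only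
  rw [hq', hK' K hK]
  have := h.ne_zero
  have := h.nullField.ne_zero
  field_simp

theorem potential_der (h : IsGuichardLift 𝔭 p a k f Λ χ η) (x : M)
    (X Y : TangentSpace (𝓡 2) x) : η x X (der p x Y) = (2 * k / a) • χ x X (der p x Y) +
      (k⁻¹ * form (der p x X) (der p x Y)) • p x := by
  rw [h.rel, sub_apply, smul_apply, smul_apply, wedge_apply, (h.nullField.form_der x Y).2]
  module

/-- The brackets of p ∧ dp with itself vanish since p is null and orthogonal to dp. The cross terms
are p ∧ χ_X d_Y p and p ∧ χ_Y d_X p, which cancel by `hs`. -/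
theorem bracket_eq (h : IsGuichardLift 𝔭 p a k f Λ χ η)
    (hs : ∀ x X Y, χ x X (der p x Y) = χ x Y (der p x X)) (x : M) (X Y : TangentSpace (𝓡 2) x) :
    η x X * η x Y - η x Y * η x X =
      (2 * k / a) ^ 2 • (χ x X * χ x Y - χ x Y * χ x X) := by
  have c1 : wedge (p x) (der p x X) * wedge (p x) (der p x Y) -
      wedge (p x) (der p x Y) * wedge (p x) (der p x X) = 0 := by
    rw [(isSkew_wedge _ _).commutator_wedge, wedge_apply, wedge_apply, h.nullField.null,
      (h.nullField.form_der x Y).2, form_comm (der p x X) (p x), (h.nullField.form_der x X).2]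
    simp [wedge_zero_left, wedge_neg_right, wedge_smul_right, wedge_self]
  have c2 : ∀ X Y, χ x X * wedge (p x) (der p x Y) - wedge (p x) (der p x Y) * χ x X =
      wedge (p x) (χ x X (der p x Y)) := by
    intro X Y
    rw [(h.isSkew x X).commutator_wedge, h.apply_field, wedge_zero_left, zero_add]
  have c3 : ∀ (r s : ℝ) (A B C D : EndR42), (r • A - s • C) * (r • B - s • D) -
      (r • B - s • D) * (r • A - s • C) = r ^ 2 • (A * B - B * A) -
      (r * s) • ((A * D - D * A) - (B * C - C * B)) + s ^ 2 • (C * D - D * C) := by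
    intro r s A B C D
    simp only [mul_sub, sub_mul, smul_mul_assoc, mul_smul_comm]
    module
  rw [h.rel, h.rel, c3, c1, c2, c2, hs x X Y]
  simp

variable [IsManifold (𝓡 2) ∞ M]

theorem extDer_eq (h : IsGuichardLift 𝔭 p a k f Λ χ η) (hχ : IsSmoothForm χ) (x₀ : M) {x : M}
    (hx : x ∈ (chartAt 𝔼 x₀).source) (u v : 𝔼) :
    extDer η x₀ (chartAt 𝔼 x₀ x) u v = (2 * k / a) • (extDer χ x₀ (chartAt 𝔼 x₀ x) u v -
      (a / k ^ 2) • wedge (der p x (coordField x₀ u x)) (der p x (coordField x₀ v x))) := by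
  have hη : η = fun x => (2 * k / a) • χ x + (-k⁻¹) • wedgeDer p p x := by
    funext x
    ext1 X
    rw [h.rel, add_apply, smul_apply, smul_apply, wedgeDer_apply]
    module
  rw [hη, extDer_lin hχ (isSmoothForm_wedgeDer h.nullField.smooth h.nullField.smooth) _ _
    ((chartAt 𝔼 x₀).map_source hx), extDer_wedgeDer h.nullField.smooth h.nullField.smooth x₀ hx,
    wedge_swap (der p x (coordField x₀ v x)) (der p x (coordField x₀ u x))]
  have h1 : 2 * k / a * (a / k ^ 2) = 2 * k⁻¹ := by
    have := h.ne_zero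
    have := h.nullField.ne_zero
    field_simp
  rw [smul_sub (2 * k / a), smul_smul, h1]
  module

theorem isGuichard (h : IsGuichardLift 𝔭 p a k f Λ χ η) (hχ : IsSmoothForm χ)
    (hcl : IsClosedForm η) (hb : BracketVanishes η) : IsGuichard 𝔭 Λ (perpBundle 𝔭 p) χ := by
  have ha := h.ne_zero
  have hk := h.nullField.ne_zero
  have hr : 2 * k / a ≠ 0 := by positivity
  -- Evaluating [η_X, η_Y] = 0 on 𝔭, where η𝔭 = -dp, makes η_X d_Y p symmetric; its component along
  -- p is symmetric in any case, so the χ-part is too.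
  have hs : ∀ x X Y, χ x X (der p x Y) = χ x Y (der p x X) := by
    intro x X Y
    have h1 := congrArg (fun T : EndR42 => T 𝔭) (hb x X Y)
    simp only [sub_apply, mul_apply_eq_comp, h.potential_const, map_neg, h.potential_der,
      form_comm (der p x Y) (der p x X), zero_apply] at h1
    have h2 : (2 * k / a) • (χ x X (der p x Y) - χ x Y (der p x X)) = 0 := by
      rw [← neg_eq_zero, ← h1]; module
    exact sub_eq_zero.mp ((smul_eq_zero.mp h2).resolve_left hr)
  exact
    { nonnull := h.nullField.form_const ▸ ha
      pointMap := ⟨h.subbundle, fun x => h.inter x ▸ inf_le_right, fun x v hv w hw =>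
        h.legendre.form_eq_zero (h.le x hw) (h.le x hv)⟩
      sphere := h.nullField.isSphereCongruence
      envelops := h.derived_le
      smooth := hχ
      mem := h.mem_wedge
      flat := (h.nullField.flat_iff hχ h.isSkew h.apply_const h.apply_field).mpr
        ⟨fun x₀ x hx u v => by
          have h1 := hcl x₀ _ ((chartAt 𝔼 x₀).map_source hx) u v
          rw [h.extDer_eq hχ x₀ hx, smul_eq_zero] at h1
          exact sub_eq_zero.mp (h1.resolve_left hr), hs, fun x X Y => by
          have h1 := hb x X Y
          rw [h.bracket_eq hs, smul_eq_zero] at h1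
          exact h1.resolve_left (pow_ne_zero 2 hr)⟩ }

theorem isPotential (h : IsGuichardLift 𝔭 p a k f Λ χ η) (hχ : IsSmoothForm χ)
    (hfl : ∀ t : ℝ, IsFlat fun x => (t - 1) • normalForm (perpBundle 𝔭 p) x + (t ^ 2 - 1) • χ x) :
    IsPotential f η := by
  obtain ⟨h1, hs, hb⟩ :=
    (h.nullField.flat_iff hχ h.isSkew h.apply_const h.apply_field).mp hfl
  refine ⟨?_, h.mem_wedge_potential, fun x₀ y hy u v => ?_, fun x X Y => ?_⟩
  · have hη : η = fun x => (2 * k / a) • χ x + (-k⁻¹) • wedgeDer p p x := by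
      funext x
      ext1 X
      rw [h.rel, add_apply, smul_apply, smul_apply, wedgeDer_apply]
      module
    rw [hη]
    exact hχ.lin (isSmoothForm_wedgeDer h.nullField.smooth h.nullField.smooth) _ _
  · have hx := (chartAt 𝔼 x₀).map_target hy
    have h2 := h.extDer_eq hχ x₀ hx u v
    rw [h1 x₀ _ hx, sub_self, smul_zero, (chartAt 𝔼 x₀).right_inv hy] at h2
    exact h2
  · rw [h.bracket_eq hs, hb x X Y, smul_zero]

end IsGuichardLift

end Correspondence

/-! ### Consequences of closedness and the shape of middle potentials -/

section Potentials

variable {M : Type*} [TopologicalSpace M] [ChartedSpace (EuclideanSpace ℝ (Fin 2)) M]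
  [IsManifold (𝓡 2) ∞ M]

local notation "𝔼" => EuclideanSpace ℝ (Fin 2)

/-- A function with vanishing derivative on a connected surface is constant. -/
theorem exists_eq_const_of_der_eq_zero [ConnectedSpace M] {F : Type*} [NormedAddCommGroup F]
    [NormedSpace ℝ F] {σ : M → F} (hσ : SmoothOn σ Set.univ) (h : ∀ x X, der σ x X = 0) :
    ∃ c, ∀ x, σ x = c := by
  have hloc : IsLocallyConstant σ := by
    rw [IsLocallyConstant.iff_eventually_eq]
    intro x
    set φ := chartAt 𝔼 x
    have hx := mem_chart_source 𝔼 x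
    obtain ⟨r, hr, hball⟩ := Metric.isOpen_iff.mp φ.open_target (φ x) (φ.map_source hx)
    have hd : ∀ y ∈ Metric.ball (φ x) r, fderiv ℝ (σ ∘ φ.symm) y = 0 := by
      intro y hy
      ext1 u
      have h1 := der_coordField x (φ.map_target (hball hy))
        (hσ.diffAt isOpen_univ (Set.mem_univ (φ.symm y))) u
      rw [h] at h1
      change 0 = fderiv ℝ (σ ∘ φ.symm) (φ (φ.symm y)) u at h1
      rw [φ.right_inv (hball hy)] at h1
      exact h1.symm
    have hdiff : DifferentiableOn ℝ (σ ∘ φ.symm) (Metric.ball (φ x) r) := by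
      have h1 := hσ.inChart x
      refine (h1.mono fun y hy => ⟨hball hy, trivial⟩).differentiableOn (by simp)
    have hnear : φ.source ∩ φ ⁻¹' Metric.ball (φ x) r ∈ nhds x :=
      (φ.isOpen_inter_preimage Metric.isOpen_ball).mem_nhds ⟨hx, Metric.mem_ball_self hr⟩
    filter_upwards [hnear] with y hy
    have h2 := Metric.isOpen_ball.is_const_of_fderiv_eq_zero
      (convex_ball (φ x) r).isPreconnected hdiff (fun z hz => hd z hz) hy.2
      (Metric.mem_ball_self hr)
    simpa [φ.left_inv hy.1, φ.left_inv hx] using h2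
  obtain ⟨x₀⟩ := (inferInstance : Nonempty M)
  exact ⟨σ x₀, fun x => hloc.apply_eq_of_isPreconnected isPreconnected_univ trivial trivial⟩

variable {f : M → Submodule ℝ R42} {η : OneForm M EndR42}

/-- Closedness of a potential makes `η_X d_Y σ` symmetric in `X` and `Y`. -/
theorem IsPotential.apply_der_comm (hη : IsPotential f η) (hf : IsLegendre f) {x : M}
    {σ : M → R42} (hσ : IsSectionNear f x σ) (X Y : TangentSpace (𝓡 2) x) :
    η x X (der σ x Y) = η x Y (der σ x X) := by
  obtain ⟨U, hU, hxU, hs, hm⟩ := id hσ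
  have hx₀ := mem_chart_source 𝔼 x
  obtain ⟨u, rfl⟩ := (coordField_bijective x hx₀).2 X
  obtain ⟨v, rfl⟩ := (coordField_bijective x hx₀).2 Y
  -- As η kills f, differentiating η_v σ = 0 along u trades η_v d_u σ for a derivative of η, which
  -- closedness makes symmetric.
  have key : ∀ u v : 𝔼, der (fun y => η y (coordField x v y)) x (coordField x u x) (σ x) +
      η x (coordField x v x) (der σ x (coordField x u x)) = 0 := by
    intro u v
    rw [← der_apply ((hη.smooth.smoothOn x v).diffAt (chartAt 𝔼 x).open_source hx₀) hσ.diffAt]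
    exact der_eq_zero_of_eqOn hU hxU (c := 0) (fun y hy => apply_eq_zero_of_mem
      (hf.isotropic y) (hη.mem y _) (hm y hy)) _
  have h1 := key u v
  have h2 := key v u
  have h3 := hη.closed x _ ((chartAt 𝔼 x).map_source hx₀) u v
  rw [extDer_eq hη.smooth x hx₀, sub_eq_zero] at h3
  rw [h3] at h1
  dsimp only
  exact add_left_cancel (h2.trans h1.symm)

/-- Elements of `∧² f`. -/
theorem exists_wedge_of_mem {F : Submodule ℝ R42} {a b : R42}
    (hs : Submodule.span ℝ {a, b} = F) {T : EndR42} (hT : T ∈ wedgeSpan F F) :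
    ∃ c : ℝ, T = c • wedge a b := by
  have := wedgeSpan_induction hT (Submodule.span ℝ {wedge a b}) fun v hv w hw => by
    rw [← hs] at hv hw
    obtain ⟨s, t, rfl⟩ := Submodule.mem_span_pair.mp hv
    obtain ⟨s', t', rfl⟩ := Submodule.mem_span_pair.mp hw
    refine Submodule.mem_span_singleton.mpr ⟨s * t' - t * s', ?_⟩
    simp only [wedge_add_left, wedge_add_right, wedge_smul_left, wedge_smul_right, wedge_self,
      wedge_swap b a]
    module
  obtain ⟨c, hc⟩ := Submodule.mem_span_singleton.mp this
  exact ⟨c, hc.symm⟩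

theorem exists_wedge_triple {a b c : R42} {T : EndR42}
    (hT : T ∈ wedgeSpan (Submodule.span ℝ {a, b, c}) (Submodule.span ℝ {a, b, c})) :
    ∃ A B C : ℝ, T = A • wedge a b + B • wedge a c + C • wedge b c := by
  have := wedgeSpan_induction hT (Submodule.span ℝ {wedge a b, wedge a c, wedge b c})
    fun v hv w hw => by
    obtain ⟨s, t, r, rfl⟩ := Submodule.mem_span_triple.mp hv
    obtain ⟨s', t', r', rfl⟩ := Submodule.mem_span_triple.mp hw
    refine Submodule.mem_span_triple.mpr
      ⟨s * t' - t * s', s * r' - r * s', t * r' - r * t', ?_⟩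
    simp only [wedge_add_left, wedge_add_right, wedge_smul_left, wedge_smul_right, wedge_self,
      wedge_swap b a, wedge_swap c a, wedge_swap c b]
    module
  obtain ⟨A, B, C, h⟩ := Submodule.mem_span_triple.mp this
  exact ⟨A, B, C, h.symm⟩

section CurvatureFrame

variable {U : Set M} {σ₁ σ₂ : M → R42} {X₁ X₂ : (x : M) → TangentSpace (𝓡 2) x}

theorem IsCurvatureFrame.symm (h : IsCurvatureFrame f U σ₁ σ₂ X₁ X₂) :
    IsCurvatureFrame f U σ₂ σ₁ X₂ X₁ where
  smooth₁ := h.smooth₂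
  smooth₂ := h.smooth₁
  smooth_field₁ := h.smooth_field₂
  smooth_field₂ := h.smooth_field₁
  indep y hy := LinearIndependent.pair_symm_iff.mp (h.indep y hy)
  span y hy := by rw [Set.pair_comm]; exact h.span y hy
  indep_field y hy := LinearIndependent.pair_symm_iff.mp (h.indep_field y hy)
  curv₁ := h.curv₂
  curv₂ := h.curv₁

theorem IsCurvatureFrame.smooth_der₁ (h : IsCurvatureFrame f U σ₁ σ₂ X₁ X₂) (hU : IsOpen U) :
    SmoothOn (fun y => der σ₁ y (X₂ y)) U :=
  SmoothOn.der_field h.smooth₁ hU h.smooth_field₂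

/-- The inner products of `σ₁, σ₂` with the second derivative of `σ₁`. -/
theorem IsCurvatureFrame.form_der_der (hf : IsLegendre f) (h : IsCurvatureFrame f U σ₁ σ₂ X₁ X₂)
    (hU : IsOpen U) {x : M} (hx : x ∈ U) (Z : TangentSpace (𝓡 2) x) :
    form (σ₁ x) (der (fun y => der σ₁ y (X₂ y)) x Z) = -form (der σ₁ x Z) (der σ₁ x (X₂ x)) ∧
    form (σ₂ x) (der (fun y => der σ₁ y (X₂ y)) x Z) =
      -form (der σ₂ x Z) (der σ₁ x (X₂ x)) := by
  have hd := (h.smooth_der₁ hU).diffAt hU hx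
  constructor
  · have h1 := der_form (SmoothOn.diffAt h.smooth₁ hU hx) hd Z
    rw [der_eq_zero_of_eqOn hU hx (c := 0) fun y hy => ?_] at h1
    · linarith
    · rw [form_comm]
      exact hf.form_der ((h.isPrincipalAt hU hy).frame.section₁ hy) _
        ((h.isPrincipalAt hU hy).frame.mem₁ hy)
  · have h1 := der_form (SmoothOn.diffAt h.smooth₂ hU hx) hd Z
    rw [der_eq_zero_of_eqOn hU hx (c := 0) fun y hy => ?_] at h1
    · linarith
    · rw [form_comm]
      exact hf.form_der ((h.isPrincipalAt hU hy).frame.section₁ hy) _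
        ((h.isPrincipalAt hU hy).frame.mem₂ hy)

/-- The components of `h` in `∧² S₁` for `h + m` in `f ∧ f^⊥`. -/
theorem IsCurvatureFrame.coeff_eq_zero (hf : IsLegendre f)
    (h : IsCurvatureFrame f U σ₁ σ₂ X₁ X₂) (hU : IsOpen U) {x : M} (hx : x ∈ U) {A B C : ℝ}
    (h0 : (A • wedge (σ₁ x) (der σ₁ x (X₂ x)) +
      B • wedge (σ₁ x) (der (fun y => der σ₁ y (X₂ y)) x (X₂ x)) +
      C • wedge (der σ₁ x (X₂ x)) (der (fun y => der σ₁ y (X₂ y)) x (X₂ x))) (σ₁ x) = 0) :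
    B = 0 ∧ C = 0 := by
  have hP := h.isPrincipalAt hU hx
  have hpos := hP.form_self_pos₁ hf
  have h1 := (h.form_der_der hf hU hx (X₂ x)).1
  have h2 : form (σ₁ x) (σ₁ x) = 0 := hf.form_eq_zero (hP.frame.mem₁ hx) (hP.frame.mem₁ hx)
  have h3 : form (der σ₁ x (X₂ x)) (σ₁ x) = 0 :=
    hf.form_der (hP.frame.section₁ hx) _ (hP.frame.mem₁ hx)
  rw [form_comm] at h1
  simp only [add_apply, smul_apply, wedge_apply, h1, h2, h3] at h0
  -- With n = d_{X₂} σ₁, the three terms take σ₁ to 0, B (n, n) σ₁ and C (n, n) n; pairing with n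
  -- isolates C.
  have h4 := congrArg (fun v => form (der σ₁ x (X₂ x)) v) h0
  simp [h3, hpos.ne'] at h4
  subst h4
  refine ⟨?_, rfl⟩
  have h5 := (hP.frame.indep x hx).ne_zero 0
  simpa [hpos.ne', show σ₁ x ≠ 0 from h5] using h0

/-- A middle potential in terms of a curvature frame. -/
theorem IsCurvatureFrame.exists_middle (hf : IsLegendre f)
    (h : IsCurvatureFrame f U σ₁ σ₂ X₁ X₂) (hU : IsOpen U) {x : M} (hx : x ∈ U) {T : EndR42}
    (hT : T ∈ wedgeSpan (f x) (perp (f x)))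
    (hm : ∃ h ∈ wedgeSpan (cyclideSpace σ₁ X₂ x) (cyclideSpace σ₁ X₂ x) ⊔
          wedgeSpan (cyclideSpace σ₂ X₁ x) (cyclideSpace σ₂ X₁ x),
      ∃ m ∈ wedgeSpan (cyclideSpace σ₁ X₂ x) (cyclideSpace σ₂ X₁ x),
        T = h + m ∧ m ∈ wedgeSpan (f x) (f x)) :
    ∃ α β γ : ℝ, T = α • wedge (σ₁ x) (der σ₁ x (X₂ x)) +
      β • wedge (σ₂ x) (der σ₂ x (X₁ x)) + γ • wedge (σ₁ x) (σ₂ x) := by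
  obtain ⟨w, hw, m, -, hTm, hmf⟩ := hm
  obtain ⟨w₁, hw₁, w₂, hw₂, rfl⟩ := Submodule.mem_sup.mp hw
  obtain ⟨γ, rfl⟩ := exists_wedge_of_mem (h.span x hx) hmf
  obtain ⟨A, B, C, rfl⟩ := exists_wedge_triple hw₁
  obtain ⟨A', B', C', rfl⟩ := exists_wedge_triple hw₂
  have hP := h.isPrincipalAt hU hx
  have m₁ := hP.frame.mem₁ hx
  have m₂ := hP.frame.mem₂ hx
  have f11 := hf.form_eq_zero m₁ m₁
  have f22 := hf.form_eq_zero m₂ m₂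
  have f12 := hf.form_eq_zero m₁ m₂
  have f21 := hf.form_eq_zero m₂ m₁
  have n12 := hf.form_der (hP.frame.section₁ hx) (X₂ x) m₂
  have n21 := hf.form_der (hP.frame.section₂ hx) (X₁ x) m₁
  have k12 := (h.form_der_der hf hU hx (X₂ x)).2
  rw [hf.form_eq_zero_of_mem_of_mem_perp (h.curv₂ x hx) (hP.der_mem_perp₁ hf _), neg_zero,
    form_comm] at k12
  have k21 := (h.symm.form_der_der hf hU hx (X₁ x)).2
  rw [hf.form_eq_zero_of_mem_of_mem_perp (h.curv₁ x hx) (hP.symm.der_mem_perp₁ hf _), neg_zero,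
    form_comm] at k21
  have z₁ : T (σ₁ x) = 0 := apply_eq_zero_of_mem (hf.isotropic x) hT m₁
  have z₂ : T (σ₂ x) = 0 := apply_eq_zero_of_mem (hf.isotropic x) hT m₂
  -- The endomorphism T kills σ₁, and so do the ∧² S₂-part and the ∧² f-part. Hence the ∧² S₁-part
  -- kills σ₁ on its own, which rules out second derivatives.
  have e₁ := h.coeff_eq_zero hf hU hx (A := A) (B := B) (C := C) (by
    rw [hTm] at z₁
    rw [← z₁]
    simp only [add_apply, smul_apply, wedge_apply, f11, f21, n21, k21]
    module)
  have e₂ := h.symm.coeff_eq_zero hf hU hx (A := A') (B := B') (C := C') (by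
    rw [hTm] at z₂
    rw [← z₂]
    simp only [add_apply, smul_apply, wedge_apply, f12, f22, n12, k12]
    module)
  obtain ⟨rfl, rfl⟩ := e₁
  obtain ⟨rfl, rfl⟩ := e₂
  exact ⟨A, A', γ, by rw [hTm]; module⟩

end CurvatureFrame

end Potentials

/-! ### From special Omega-surfaces to Guichard surfaces -/

section Projection

variable {M : Type*} [TopologicalSpace M] [ChartedSpace (EuclideanSpace ℝ (Fin 2)) M]

local notation "𝔼" => EuclideanSpace ℝ (Fin 2)

variable {f : M → Submodule ℝ R42} {η : OneForm M EndR42} {q : BiForm M}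

theorem isPrincipalAt_ne_zero {U : Set M} {e₁ e₂ : M → R42} {x : M}
    {X₁ X₂ : TangentSpace (𝓡 2) x} (h : IsPrincipalAt f U e₁ e₂ x X₁ X₂) :
    e₁ x ≠ 0 ∧ e₂ x ≠ 0 :=
  ⟨(h.frame.indep x h.mem).ne_zero 0, (h.frame.indep x h.mem).ne_zero 1⟩

/-- If `η_{X₁} = α e₁ ∧ n₁ + β e₂ ∧ n₂ + γ e₁ ∧ e₂` then `α = 0` by closedness and `β ≠ 0` by
non-degeneracy of the quadratic differential. -/
theorem IsPrincipalAt.coeff_of_potential [IsManifold (𝓡 2) ∞ M] (hf : IsLegendre f) (hη : IsPotential f η)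
    (hq : IsQuadraticDifferential f η q) (hn : IsNondegenerate q) {U : Set M} {e₁ e₂ : M → R42}
    {x : M} {X₁ X₂ : TangentSpace (𝓡 2) x} (h : IsPrincipalAt f U e₁ e₂ x X₁ X₂) {α β γ : ℝ}
    (hT : η x X₁ = α • wedge (e₁ x) (der e₁ x X₂) + β • wedge (e₂ x) (der e₂ x X₁) +
      γ • wedge (e₁ x) (e₂ x)) : α = 0 ∧ β ≠ 0 := by
  have m₁ := h.frame.mem₁ h.mem
  have m₂ := h.frame.mem₂ h.mem
  have s₁ := h.frame.section₁ h.mem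
  have s₂ := h.frame.section₂ h.mem
  have hz : ∀ Z, ∀ v ∈ f x, η x Z v = 0 := fun Z v hv =>
    apply_eq_zero_of_mem (hf.isotropic x) (hη.mem x Z) hv
  have n12 := h.form_eq_zero hf
  have n21 := n12
  rw [form_comm] at n21
  have a1 : form (e₁ x) (der e₁ x X₂) = 0 := by rw [form_comm]; exact hf.form_der s₁ _ m₁
  have a2 : form (e₂ x) (der e₁ x X₂) = 0 := by rw [form_comm]; exact hf.form_der s₁ _ m₂
  have b1 : form (e₁ x) (der e₂ x X₁) = 0 := by rw [form_comm]; exact hf.form_der s₂ _ m₁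
  have b2 : form (e₂ x) (der e₂ x X₁) = 0 := by rw [form_comm]; exact hf.form_der s₂ _ m₂
  -- By closedness η_{X₁} d_{X₂} e₁ = η_{X₂} d_{X₁} e₁, and the latter vanishes because d_{X₁} e₁
  -- lies in f.
  have hα : α = 0 := by
    have h1 := hη.apply_der_comm hf s₁ X₁ X₂
    rw [hz X₂ _ h.curv₁, hT] at h1
    simp only [add_apply, smul_apply, wedge_apply, a1, a2, n21] at h1
    simpa [(isPrincipalAt_ne_zero h).1, (h.form_self_pos₁ hf).ne'] using h1
  refine ⟨hα, ?_⟩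
  -- With α = β = 0 only γ e₁ ∧ e₂ remains, which kills f^⊥, so that q(X₁, ·) = 0.
  rintro rfl
  subst hα
  refine h.indep.ne_zero 0 (hn x X₁ fun Y => ?_)
  obtain ⟨a, b, rfl⟩ := exists_smul_add_smul h.indep Y
  obtain ⟨r₁, hr₁, hd₁⟩ := h.exists_der₁ a b
  obtain ⟨r₂, hr₂, hd₂⟩ := h.symm.exists_der₁ b a
  rw [add_comm] at hd₂
  have := (h.frame.isFibreTrace_iff h.mem (hz X₁) (m₁₁ := 0) (m₁₂ := 0) (m₂₁ := 0) (m₂₂ := 0)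
    (by
      rw [hd₁, map_add, hz X₁ r₁ hr₁, hT]
      simp only [add_apply, smul_apply, wedge_apply, map_smul, a1, a2]
      module)
    (by
      rw [hd₂, map_add, hz X₁ r₂ hr₂, hT]
      simp only [add_apply, smul_apply, wedge_apply, map_smul, b1, b2]
      module)).mp (hq x X₁ (a • X₁ + b • X₂))
  simpa using this

/-- The shape of a middle potential in a curvature frame. -/
theorem IsOmegaSurface.exists_principal [IsManifold (𝓡 2) ∞ M] (h : IsOmegaSurface f η q) (x : M) :
    ∃ (U : Set M) (e₁ e₂ : M → R42) (X₁ X₂ : TangentSpace (𝓡 2) x) (α β γ₁ γ₂ : ℝ),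
      IsPrincipalAt f U e₁ e₂ x X₁ X₂ ∧ α ≠ 0 ∧ β ≠ 0 ∧
      η x X₁ = β • wedge (e₂ x) (der e₂ x X₁) + γ₁ • wedge (e₂ x) (e₁ x) ∧
      η x X₂ = α • wedge (e₁ x) (der e₁ x X₂) + γ₂ • wedge (e₁ x) (e₂ x) := by
  obtain ⟨U, σ₁, σ₂, X₁, X₂, hU, hx, hfr, hm⟩ := h.middle.middle x
  have hf := h.legendre
  have hη := h.middle.toIsPotential
  have hP := hfr.isPrincipalAt hU hx
  obtain ⟨α₁, β₁, γ₁, h₁⟩ := hfr.exists_middle hf hU hx (hη.mem x (X₁ x)) (hm (X₁ x))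
  obtain ⟨α₂, β₂, γ₂, h₂⟩ := hfr.exists_middle hf hU hx (hη.mem x (X₂ x)) (hm (X₂ x))
  obtain ⟨rfl, hβ⟩ := hP.coeff_of_potential hf hη h.differential h.nondegenerate h₁
  obtain ⟨rfl, hα⟩ := hP.symm.coeff_of_potential hf hη h.differential h.nondegenerate
    (α := β₂) (β := α₂) (γ := -γ₂) (by
      rw [h₂, wedge_swap (σ₁ x) (σ₂ x)]; module)
  refine ⟨U, σ₁, σ₂, X₁ x, X₂ x, α₂, β₁, -γ₁, γ₂, hP, hα, hβ, ?_, ?_⟩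
  · rw [h₁, wedge_swap (σ₁ x) (σ₂ x)]; module
  · rw [h₂]; module

/-- Pairing with n₁ = d_{X₂} e₁, which is orthogonal to f, keeps only the term α (e₁, v) (n₁, n₁).
-/
theorem IsPrincipalAt.form_of_apply_eq_zero (hf : IsLegendre f) {U : Set M} {e₁ e₂ : M → R42}
    {x : M} {X₁ X₂ : TangentSpace (𝓡 2) x} (h : IsPrincipalAt f U e₁ e₂ x X₁ X₂) {α γ : ℝ}
    (hα : α ≠ 0) {v : R42}
    (hv : (α • wedge (e₁ x) (der e₁ x X₂) + γ • wedge (e₁ x) (e₂ x)) v = 0) :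
    form (e₁ x) v = 0 := by
  have s₁ := h.frame.section₁ h.mem
  have a1 : form (der e₁ x X₂) (e₁ x) = 0 := hf.form_der s₁ _ (h.frame.mem₁ h.mem)
  have a2 : form (der e₁ x X₂) (e₂ x) = 0 := hf.form_der s₁ _ (h.frame.mem₂ h.mem)
  have h1 := congrArg (fun w => form (der e₁ x X₂) w) hv
  simp only [add_apply, smul_apply, wedge_apply] at h1
  simpa [a1, a2, hα, (h.form_self_pos₁ hf).ne'] using h1

theorem IsPrincipalAt.form_der_of_apply_eq_zero {U : Set M} {e₁ e₂ : M → R42}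
    {x : M} {X₁ X₂ : TangentSpace (𝓡 2) x} (h : IsPrincipalAt f U e₁ e₂ x X₁ X₂) {α γ : ℝ}
    (hα : α ≠ 0) {v : R42} (h₁ : form (e₁ x) v = 0) (h₂ : form (e₂ x) v = 0)
    (hv : (α • wedge (e₁ x) (der e₁ x X₂) + γ • wedge (e₁ x) (e₂ x)) v = 0) :
    form (der e₁ x X₂) v = 0 := by
  simp only [add_apply, smul_apply, wedge_apply, h₁, h₂] at hv
  simpa [hα, (isPrincipalAt_ne_zero h).1] using hv

/-- Since α and β do not vanish, η v = 0 first forces v orthogonal to e₁, e₂ and then to d_{X₂} e₁,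
d_{X₁} e₂. So v lies in f^⊥ and is orthogonal to f^⊥ / f. Applied to the top coefficient of the
conserved quantity, this places it in f. -/
theorem IsOmegaSurface.mem_of_apply_eq_zero [IsManifold (𝓡 2) ∞ M]
    (h : IsOmegaSurface f η q) {x : M} {v : R42}
    (hv : ∀ X, η x X v = 0) : v ∈ f x := by
  obtain ⟨U, e₁, e₂, X₁, X₂, α, β, γ₁, γ₂, hP, hα, hβ, h₁, h₂⟩ := h.exists_principal x
  have hf := h.legendre
  have v₁ := hv X₁
  have v₂ := hv X₂
  rw [h₁] at v₁
  rw [h₂] at v₂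
  have f₁ := hP.form_of_apply_eq_zero hf hα v₂
  have f₂ := hP.symm.form_of_apply_eq_zero hf hβ v₁
  refine hP.mem_of_perp hf ?_ (hP.form_der_of_apply_eq_zero hα f₁ f₂ v₂)
    (hP.symm.form_der_of_apply_eq_zero hβ f₂ f₁ v₁)
  rw [← hP.frame.span x hP.mem, mem_perp_span_pair]
  exact ⟨f₁, f₂⟩

/-! The point map -/

variable {𝔭 : R42} {p : M → R42} {a k : ℝ}

/-- The combination spans the kernel of (𝔭, ·) on f as long as 𝔭 is not orthogonal to f. -/
theorem isFrame₁_inter {U : Set M} {e₁ e₂ : M → R42} (h : IsFrame₂ f U e₁ e₂)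
    (h𝔭 : ∀ y ∈ U, form 𝔭 (e₁ y) ≠ 0 ∨ form 𝔭 (e₂ y) ≠ 0) :
    IsFrame₁ (fun x => f x ⊓ vperp 𝔭) U
      (fun y => form 𝔭 (e₂ y) • e₁ y - form 𝔭 (e₁ y) • e₂ y) where
  isOpen := h.isOpen
  smooth := (((smoothOn_const 𝔭 U).form h.smooth₂).fsmul h.smooth₁).fsub
    (((smoothOn_const 𝔭 U).form h.smooth₁).fsmul h.smooth₂)
  ne_zero y hy h0 := by
    have h1 := LinearIndependent.pair_iff.mp (h.indep y hy) (form 𝔭 (e₂ y)) (-form 𝔭 (e₁ y))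
      (by rw [neg_smul, ← sub_eq_add_neg]; exact h0)
    rcases h𝔭 y hy with h2 | h2
    · exact h2 (neg_eq_zero.mp h1.2)
    · exact h2 h1.1
  span y hy := by
    apply le_antisymm
    · rw [Submodule.span_singleton_le_iff_mem]
      refine ⟨(f y).sub_mem ((f y).smul_mem _ (h.mem₁ hy)) ((f y).smul_mem _ (h.mem₂ hy)),
        mem_vperp.mpr ?_⟩
      simp; ring
    · rintro v ⟨hv, hv'⟩
      obtain ⟨s, t, rfl⟩ := h.exists_of_mem hy hv
      have h1 := mem_vperp.mp hv'
      simp only [map_add, map_smul, smul_eq_mul] at h1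
      rw [Submodule.mem_span_singleton]
      rcases h𝔭 y hy with h2 | h2
      · refine ⟨-t / form 𝔭 (e₁ y), ?_⟩
        rw [smul_sub, smul_smul, smul_smul]
        have e1 : -t / form 𝔭 (e₁ y) * form 𝔭 (e₂ y) = s := by
          field_simp; linarith
        have e2 : -t / form 𝔭 (e₁ y) * form 𝔭 (e₁ y) = -t := by field_simp
        rw [e1, e2]; module
      · refine ⟨s / form 𝔭 (e₂ y), ?_⟩
        rw [smul_sub, smul_smul, smul_smul]
        have e1 : s / form 𝔭 (e₂ y) * form 𝔭 (e₁ y) = -t := by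
          field_simp; linarith
        have e2 : s / form 𝔭 (e₂ y) * form 𝔭 (e₂ y) = s := by field_simp
        rw [e1, e2]; module

theorem form_ne_zero_or {U : Set M} {e₁ e₂ : M → R42} (h : IsFrame₂ f U e₁ e₂)
    (hp : IsNullField 𝔭 p a k) (hmem : ∀ x, p x ∈ f x) (y : M) (hy : y ∈ U) :
    form 𝔭 (e₁ y) ≠ 0 ∨ form 𝔭 (e₂ y) ≠ 0 := by
  by_contra hcon
  push Not at hcon
  obtain ⟨s, t, hst⟩ := h.exists_of_mem hy (hmem y)
  have h1 := hp.form_eq y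
  rw [hst] at h1
  simp [hcon.1, hcon.2] at h1
  exact hp.ne_zero h1.symm

/-- The projection of `p^⊥` along `p` to `⟨𝔭, p⟩^⊥`. -/
def shear (𝔭 p : R42) (k : ℝ) (v : R42) : R42 := v - (k⁻¹ * form 𝔭 v) • p

theorem shear_add (𝔭 p : R42) (k : ℝ) (v w : R42) :
    shear 𝔭 p k (v + w) = shear 𝔭 p k v + shear 𝔭 p k w := by
  simp only [shear, map_add]; module

theorem shear_smul (𝔭 p : R42) (k c : ℝ) (v : R42) :
    shear 𝔭 p k (c • v) = c • shear 𝔭 p k v := by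
  simp only [shear, map_smul, smul_eq_mul]; module

theorem shear_of_form_eq_zero {𝔭 p : R42} {k : ℝ} {v : R42} (h : form 𝔭 v = 0) :
    shear 𝔭 p k v = v := by simp [shear, h]

/-- The component in `∧² ⟨𝔭, p⟩^⊥` of a wedge product of vectors orthogonal to `p`. -/
theorem wedge_shear {𝔭 p : R42} {k : ℝ} (u v : R42) :
    wedge u v - k⁻¹ • wedge p (wedge u v 𝔭) = wedge (shear 𝔭 p k u) (shear 𝔭 p k v) := by
  rw [wedge_apply, form_comm u, form_comm v]
  simp only [shear, wedge_sub_left, wedge_sub_right, wedge_smul_left, wedge_smul_right, wedge_self,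
    wedge_swap p u, wedge_swap p v]
  module

theorem shear_mem {F : Submodule ℝ R42} {p v : R42} (hk : form 𝔭 p = k) (hk0 : k ≠ 0)
    (hp : p ∈ F) (hv : v ∈ F) : shear 𝔭 p k v ∈ F ⊓ vperp 𝔭 := by
  refine ⟨F.sub_mem hv (F.smul_mem _ hp), mem_vperp.mpr ?_⟩
  simp [shear, hk]; field_simp; ring

/-- The `∧² ⟨𝔭, p⟩^⊥`-part of `e₁ ∧ d_{X₂} e₁` takes values in `Λ ∧ Λ^{(1)}`. -/
theorem IsPrincipalAt.wedge_shear_mem (hf : IsLegendre f) (hp : IsNullField 𝔭 p a k)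
    (hmem : ∀ x, p x ∈ f x) {U : Set M} {e₁ e₂ : M → R42}
    {x : M} {X₁ X₂ : TangentSpace (𝓡 2) x} (h : IsPrincipalAt f U e₁ e₂ x X₁ X₂)
    {β γ : ℝ} (hd : der p x X₁ =
      -(β • wedge (e₂ x) (der e₂ x X₁) + γ • wedge (e₂ x) (e₁ x)) 𝔭) :
    wedge (shear 𝔭 (p x) k (e₁ x)) (shear 𝔭 (p x) k (der e₁ x X₂)) ∈
      wedgeSpan (f x ⊓ vperp 𝔭) (derived (fun x => f x ⊓ vperp 𝔭) x) := by
  have hx := h.mem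
  have hΛ := isFrame₁_inter h.frame (form_ne_zero_or h.frame hp hmem)
  have hle : f x ⊓ vperp 𝔭 ≤ derived (fun x => f x ⊓ vperp 𝔭) x := by
    intro v hv
    obtain ⟨c, rfl⟩ := hΛ.exists_of_mem hx hv
    exact Submodule.smul_mem _ c (hΛ.isSectionNear hx).mem_derived
  have hs : ∀ v ∈ f x, shear 𝔭 (p x) k v ∈ f x ⊓ vperp 𝔭 := fun v hv =>
    shear_mem (hp.form_eq x) hp.ne_zero (hmem x) hv
  -- If (𝔭, e₂) = 0 at x, then `hd` puts d_{X₁} p into f, so p is a multiple of e₁ at x and the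
  -- shear of e₁ vanishes. This is a case in which Λ fails to be immersed.
  by_cases h0 : form 𝔭 (e₂ x) = 0
  · have hz : shear 𝔭 (p x) k (e₁ x) = 0 := by
      obtain ⟨A, B, hAB, hder⟩ := h.frame.exists_der hx (σ := p)
        ⟨Set.univ, isOpen_univ, trivial, hp.smooth, fun y _ => hmem y⟩
      obtain ⟨r, hr, hdr⟩ := hder X₁
      have hB : B = 0 := by
        by_contra hB
        refine h.symm.der_notMem₁ hf ?_
        have h1 : der e₂ x X₁ = B⁻¹ • (der p x X₁ - A • der e₁ x X₁ - r) := by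
          rw [hdr, eq_inv_smul_iff₀ hB]; module
        rw [h1]
        refine (f x).smul_mem _ ((f x).sub_mem ((f x).sub_mem ?_ ((f x).smul_mem _ h.curv₁)) hr)
        rw [hd]
        simp only [add_apply, smul_apply, wedge_apply, form_comm (e₂ x) 𝔭, h0, zero_smul, zero_sub]
        refine (f x).neg_mem ((f x).add_mem ((f x).smul_mem _ ((f x).neg_mem
          ((f x).smul_mem _ (h.frame.mem₂ hx)))) ((f x).smul_mem _ ((f x).neg_mem
          ((f x).smul_mem _ (h.frame.mem₂ hx)))))
      rw [hB, zero_smul, add_zero] at hAB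
      have hk := hp.form_eq x
      have hk0 := hp.ne_zero
      rw [hAB, map_smul, smul_eq_mul] at hk
      have hA : A ≠ 0 := by rintro rfl; simp at hk; exact hk0 hk.symm
      have h1 : k⁻¹ * form 𝔭 (e₁ x) * A = 1 := by
        rw [mul_assoc, mul_comm (form 𝔭 (e₁ x)) A, hk, inv_mul_cancel₀ hk0]
      rw [shear, hAB, smul_smul, h1, one_smul, sub_self]
    rw [hz, wedge_zero_left]
    exact Submodule.zero_mem _
  -- Otherwise the section (𝔭, e₂) e₁ - (𝔭, e₁) e₂ of Λ has X₂-derivative (𝔭, e₂) d_{X₂} e₁ modulo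
  -- f. This derivative is orthogonal to 𝔭, hence fixed by the shear, and the shear maps the
  -- remainder into Λ.
  · refine wedge_mem_wedgeSpan (hs _ (h.frame.mem₁ hx)) ?_
    have hsec := hΛ.isSectionNear hx
    have hdl : ∃ r ∈ f x, der (fun y => form 𝔭 (e₂ y) • e₁ y - form 𝔭 (e₁ y) • e₂ y) x X₂ =
        form 𝔭 (e₂ x) • der e₁ x X₂ + r := by
      have d1 := h.frame.smooth₁.diffAt h.frame.isOpen hx
      have d2 := h.frame.smooth₂.diffAt h.frame.isOpen hx
      have c1 := ((smoothOn_const 𝔭 U).form h.frame.smooth₁)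
      have c2 := ((smoothOn_const 𝔭 U).form h.frame.smooth₂)
      refine ⟨(der (fun y => form 𝔭 (e₂ y)) x X₂ : ℝ) • e₁ x -
        ((der (fun y => form 𝔭 (e₁ y)) x X₂ : ℝ) • e₂ x + form 𝔭 (e₁ x) • der e₂ x X₂),
        (f x).sub_mem ((f x).smul_mem _ (h.frame.mem₁ hx)) ((f x).add_mem
          ((f x).smul_mem _ (h.frame.mem₂ hx)) ((f x).smul_mem _ h.curv₂)), ?_⟩
      rw [der_sub ((c2.fsmul h.frame.smooth₁).diffAt h.frame.isOpen hx)
        ((c1.fsmul h.frame.smooth₂).diffAt h.frame.isOpen hx),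
        der_smul (c2.diffAt h.frame.isOpen hx) d1, der_smul (c1.diffAt h.frame.isOpen hx) d2]
      module
    obtain ⟨r, hr, hdr⟩ := hdl
    have hd0 : form 𝔭 (der (fun y => form 𝔭 (e₂ y) • e₁ y - form 𝔭 (e₁ y) • e₂ y) x X₂) = 0 := by
      have h1 := der_form (σ := fun _ => 𝔭) ((smoothOn_const 𝔭 _).diffAt isOpen_univ trivial)
        hsec.diffAt X₂
      rw [der_eq_zero_of_eqOn hΛ.isOpen hx (c := 0) fun y hy => mem_vperp.mp (hΛ.mem hy).2,
        der_const] at h1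
      simpa using h1.symm
    have h1 : der e₁ x X₂ = (form 𝔭 (e₂ x))⁻¹ •
        (der (fun y => form 𝔭 (e₂ y) • e₁ y - form 𝔭 (e₁ y) • e₂ y) x X₂ + (-1 : ℝ) • r) := by
      rw [hdr, eq_inv_smul_iff₀ h0]; module
    rw [h1, shear_smul, shear_add, shear_smul, shear_of_form_eq_zero hd0]
    exact Submodule.smul_mem _ _ (Submodule.add_mem _ (hsec.der_mem_derived X₂)
      (Submodule.smul_mem _ _ (hle (hs r hr))))

end Projection

/-! ### Linear conserved quantities and the projection of special Ω-surfaces -/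

section LinearConserved

variable {M : Type*} [TopologicalSpace M] [ChartedSpace (EuclideanSpace ℝ (Fin 2)) M]

local notation "𝔼" => EuclideanSpace ℝ (Fin 2)

variable {f : M → Submodule ℝ R42} {η : OneForm M EndR42} {q : BiForm M}
  {𝔭 : R42} {p : M → R42} {a k : ℝ}

theorem evalPoly_one {M : Type*} (p : Fin (1 + 1) → M → R42) (t : ℝ) (x : M) :
    evalPoly p t x = p 0 x + t • p 1 x := by
  simp [evalPoly, Fin.sum_univ_succ]

theorem form_evalPoly_one {M : Type*} (p : Fin (1 + 1) → M → R42) (t : ℝ) (x : M) :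
    form (evalPoly p t x) (evalPoly p t x) =
      form (p 0 x) (p 0 x) + 2 * form (p 0 x) (p 1 x) * t + form (p 1 x) (p 1 x) * t ^ 2 := by
  rw [evalPoly_one]
  simp only [map_add, map_smul, LinearMap.add_apply, LinearMap.smul_apply, smul_eq_mul,
    form_comm (p 1 x) (p 0 x)]
  ring

theorem der_evalPoly_one {p : Fin (1 + 1) → M → R42} {x : M} (h : ∀ k, DiffAt (p k) x) (t : ℝ)
    (X : TangentSpace (𝓡 2) x) :
    der (evalPoly p t) x X = der (p 0) x X + t • der (p 1) x X := by
  have : evalPoly p t = fun y => p 0 y + t • p 1 y := funext fun y => evalPoly_one p t y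
  rw [this, der_add (τ := fun y => t • p 1 y) (h 0) ((h 1).const_smul t), der_const_smul t (h 1)]

/-- A linear polynomial with constant coefficient `𝔭` is conserved if and only if
`d p₁ = -η 𝔭` and `η p₁ = 0`. -/
theorem IsConservedQuantity.parallel_iff {p : Fin (1 + 1) → M → R42}
    (h : ∀ k, ContMDiff (𝓡 2) 𝓘(ℝ, R42) ∞ (p k)) :
    (∀ t x X, der (evalPoly p t) x X + t • η x X (evalPoly p t x) = 0) ↔
      ∀ x X, der (p 0) x X = 0 ∧ der (p 1) x X = - η x X (p 0 x) ∧ η x X (p 1 x) = 0 := by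
  have hd : ∀ x k, DiffAt (p k) x := fun x k => (h k x).mdifferentiableAt (by simp)
  have key : ∀ (t : ℝ) x X, der (evalPoly p t) x X + t • η x X (evalPoly p t x) =
      der (p 0) x X + t • (der (p 1) x X + η x X (p 0 x)) + t ^ 2 • η x X (p 1 x) := by
    intro t x X
    rw [der_evalPoly_one (hd x), evalPoly_one, map_add, map_smul]
    module
  simp only [key]
  constructor
  · intro H x X
    have h0 := H 0 x X
    have h1 := H 1 x X
    have h2 := H (-1) x X
    have e0 : der (p 0) x X = 0 := by simpa using h0
    rw [e0] at h1 h2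
    have e1 : η x X (p 1 x) = 0 := by
      have h3 := congrArg₂ (· + ·) h1 h2
      have h4 : (2 : ℝ) • η x X (p 1 x) = 0 := by
        rw [add_zero] at h3
        rw [← h3]
        module
      simpa using h4
    rw [e1] at h1
    refine ⟨e0, ?_, e1⟩
    rw [eq_neg_iff_add_eq_zero]
    simpa using h1
  · intro H t x X
    obtain ⟨e0, e1, e2⟩ := H x X
    rw [e0, e1, e2]
    module

theorem IsNullField.isSubbundle_inter (hp : IsNullField 𝔭 p a k) (hf : IsSubbundle 2 f)
    (hmem : ∀ x, p x ∈ f x) : IsSubbundle 1 fun x => f x ⊓ vperp 𝔭 := by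
  refine isSubbundle_of_frame₁ fun x => ?_
  obtain ⟨U, e₁, e₂, he, hx⟩ := hf.exists_frame₂ x
  exact ⟨U, _, isFrame₁_inter he (form_ne_zero_or he hp hmem), hx⟩

theorem IsNullField.inter_sup (hp : IsNullField 𝔭 p a k) (hmem : ∀ x, p x ∈ f x) (x : M) :
    f x = (f x ⊓ vperp 𝔭) ⊔ Submodule.span ℝ {p x} := by
  refine le_antisymm (fun v hv => ?_)
    (sup_le inf_le_left ((Submodule.span_singleton_le_iff_mem _ _).mpr (hmem x)))
  have h := shear_mem (hp.form_eq x) hp.ne_zero (hmem x) hv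
  have hv' : v = shear 𝔭 (p x) k v + (k⁻¹ * form 𝔭 v) • p x := by rw [shear]; module
  rw [hv']
  exact Submodule.add_mem_sup h (Submodule.smul_mem _ _ (Submodule.mem_span_singleton_self _))

theorem IsNullField.isNullNormal (hp : IsNullField 𝔭 p a k) :
    IsNullNormal (perpBundle 𝔭 p) fun x => Submodule.span ℝ {p x} where
  smooth := isSubbundle_of_frame₁ fun x => ⟨Set.univ, p, ⟨isOpen_univ, hp.smooth,
    fun y _ h0 => hp.ne_zero (by rw [← hp.form_eq y, h0, map_zero]), fun _ _ => rfl⟩, trivial⟩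
  le x := by
    rw [perp_perpBundle]
    exact Submodule.span_mono (by simp)
  isotropic x := by
    refine (Submodule.span_singleton_le_iff_mem _ _).mpr (mem_vperp.mpr (hp.null x))

theorem IsNondegenerate.const_mul {q : BiForm M} (hq : IsNondegenerate q) {c : ℝ} (hc : c ≠ 0) :
    IsNondegenerate (fun x X Y => c * q x X Y : BiForm M) := fun x X h =>
  hq x X fun Y => (mul_eq_zero.mp (h Y)).resolve_left hc

variable [IsManifold (𝓡 2) ∞ M]

/-- The Guichard form attached to a middle potential and its linear conserved quantity. -/
theorem IsOmegaSurface.isGuichardLift (h : IsOmegaSurface f η q) (hp : IsNullField 𝔭 p a k)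
    (ha : a ≠ 0) (hd : ∀ x X, der p x X = - η x X 𝔭) (h0 : ∀ x X, η x X (p x) = 0) :
    IsGuichardLift 𝔭 p a k f (fun x => f x ⊓ vperp 𝔭)
      (fun x => (a / (2 * k)) • η x + (a / (2 * k) * k⁻¹) • wedgeDer p p x) η := by
  have hk := hp.ne_zero
  have hmem : ∀ x, p x ∈ f x := fun x => h.mem_of_apply_eq_zero (h0 x)
  have hf := h.legendre
  refine ⟨hp, ha, hf, hp.isSubbundle_inter hf.smooth hmem, fun _ => rfl, hmem, ?_, ?_⟩
  · intro x Z
    obtain ⟨U, e₁, e₂, X₁, X₂, α, β, γ₁, γ₂, hP, -, -, h₁, h₂⟩ := h.exists_principal x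
    have m₁ := hP.wedge_shear_mem hf hp hmem (β := β) (γ := γ₁)
      (by rw [hd, h₁])
    have m₂ := hP.symm.wedge_shear_mem hf hp hmem (β := α) (γ := γ₂)
      (by rw [hd, h₂])
    have hΛ := isFrame₁_inter hP.frame (form_ne_zero_or hP.frame hp hmem)
    have hle : f x ⊓ vperp 𝔭 ≤ derived (fun x => f x ⊓ vperp 𝔭) x := by
      intro v hv
      obtain ⟨c, rfl⟩ := hΛ.exists_of_mem hP.mem hv
      exact Submodule.smul_mem _ c (hΛ.isSectionNear hP.mem).mem_derived
    have hs : ∀ v ∈ f x, shear 𝔭 (p x) k v ∈ f x ⊓ vperp 𝔭 := fun v hv =>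
      shear_mem (hp.form_eq x) hk (hmem x) hv
    have m₃ := wedge_mem_wedgeSpan (hs _ (hP.frame.mem₁ hP.mem))
      (hle (hs _ (hP.frame.mem₂ hP.mem)))
    obtain ⟨s, t, rfl⟩ := exists_smul_add_smul hP.indep Z
    -- Since dp = -η𝔭, `wedge_shear` identifies this form with a/(2k) times the ∧² V-component of η.
    have key : ((a / (2 * k)) • η x + (a / (2 * k) * k⁻¹) • wedgeDer p p x) (s • X₁ + t • X₂) =
        (a / (2 * k)) • (
          (s * β) • wedge (shear 𝔭 (p x) k (e₂ x)) (shear 𝔭 (p x) k (der e₂ x X₁)) +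
          (t * α) • wedge (shear 𝔭 (p x) k (e₁ x)) (shear 𝔭 (p x) k (der e₁ x X₂)) +
          (t * γ₂ - s * γ₁) • wedge (shear 𝔭 (p x) k (e₁ x)) (shear 𝔭 (p x) k (e₂ x))) := by
      have hw : ∀ X, wedgeDer p p x X = - wedge (p x) (η x X 𝔭) := by
        intro X
        rw [wedgeDer_apply, hd, wedge_neg_right]
      rw [add_apply, smul_apply, smul_apply, hw]
      simp only [map_add, map_smul, h₁, h₂, add_apply, smul_apply, wedge_add_right,
        wedge_smul_right, ← wedge_shear]
      rw [wedge_swap (e₂ x) (e₁ x)]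
      simp only [neg_apply, wedge_neg_right]
      module
    change ((a / (2 * k)) • η x + (a / (2 * k) * k⁻¹) • wedgeDer p p x) (s • X₁ + t • X₂) ∈ _
    rw [key]
    exact Submodule.smul_mem _ _ (Submodule.add_mem _ (Submodule.add_mem _
      (Submodule.smul_mem _ _ m₂) (Submodule.smul_mem _ _ m₁)) (Submodule.smul_mem _ _ m₃))
  · intro x X
    change _ = (2 * k / a) • ((a / (2 * k)) • η x X + (a / (2 * k) * k⁻¹) • wedgeDer p p x X) - _
    rw [smul_add, smul_smul, smul_smul, wedgeDer_apply]
    have e1 : 2 * k / a * (a / (2 * k)) = 1 := by field_simp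
    rw [← mul_assoc, e1, one_mul, one_smul, add_sub_cancel_right]

/-- Special Omega-surfaces of type 1 project to non-channel Guichard surfaces. -/
theorem IsOmegaSurface.exists_isGuichard [ConnectedSpace M] {p : Fin (1 + 1) → M → R42}
    (h : IsOmegaSurface f η q) (hp : IsConservedQuantity η 1 p)
    (hab : ∀ x, ∃ a b : ℝ, a ≠ 0 ∧ b ≠ 0 ∧
        ∀ t : ℝ, form (evalPoly p t x) (evalPoly p t x) = a + b * t) :
    ∃ (𝔭 : R42) (a b : ℝ), (∀ x, p 0 x = 𝔭) ∧ a ≠ 0 ∧ b ≠ 0 ∧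
        (∀ (x : M) (t : ℝ), form (evalPoly p t x) (evalPoly p t x) = a + b * t) ∧
        ∃ (V s : M → Submodule ℝ R42) (χ : OneForm M EndR42),
          IsGuichard 𝔭 (fun x => f x ⊓ vperp 𝔭) V χ ∧
          IsNullNormal V s ∧ (∀ x, f x = (f x ⊓ vperp 𝔭) ⊔ s x) ∧
          IsGuichardDifferential (fun x => f x ⊓ vperp 𝔭) V χ
            (fun x X Y => 2 * a / b * q x X Y) ∧
          IsNondegenerate (fun x X Y => 2 * a / b * q x X Y : BiForm M) := by
  have hpar := (IsConservedQuantity.parallel_iff hp.smooth).mp hp.parallel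
  obtain ⟨𝔭, h𝔭⟩ := exists_eq_const_of_der_eq_zero (hp.smooth 0).contMDiffOn
    fun x X => (hpar x X).1
  have hd : ∀ x X, der (p 1) x X = - η x X 𝔭 := fun x X => by rw [(hpar x X).2.1, h𝔭]
  have h0 : ∀ x X, η x X (p 1 x) = 0 := fun x X => (hpar x X).2.2
  have hη := h.middle.toIsPotential
  have hs1 : SmoothOn (p 1) Set.univ := (hp.smooth 1).contMDiffOn
  -- The derivative of (𝔭, p₁) is -(𝔭, η𝔭), zero because η is skew.
  obtain ⟨k, hk⟩ := exists_eq_const_of_der_eq_zero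
    ((smoothOn_const 𝔭 Set.univ).form hs1) fun x X => by
      rw [der_form (mdifferentiableAt_const) (hs1.diffAt isOpen_univ trivial), der_const, hd]
      have := (isSkew_of_mem (hη.mem x X)).form_self 𝔭
      rw [form_comm] at this
      simp [this]
  have hcoef : ∀ x, form 𝔭 𝔭 ≠ 0 ∧ k ≠ 0 ∧ form (p 1 x) (p 1 x) = 0 := by
    intro x
    obtain ⟨a, b, ha, hb, hab⟩ := hab x
    simp only [form_evalPoly_one, h𝔭, hk] at hab
    have h0 := hab 0
    have h1 := hab 1
    have h2 := hab (-1)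
    norm_num at h0 h1 h2
    refine ⟨h0 ▸ ha, ?_, by linarith⟩
    rintro rfl
    exact hb (by linarith)
  obtain ⟨x₀⟩ := (inferInstance : Nonempty M)
  obtain ⟨ha, hk0, -⟩ := hcoef x₀
  have hnf : IsNullField 𝔭 (p 1) (form 𝔭 𝔭) k := ⟨hs1, rfl, hk, fun x => (hcoef x).2.2, hk0⟩
  have hG := h.isGuichardLift hnf ha hd h0
  have hsm : IsSmoothForm (fun x => (form 𝔭 𝔭 / (2 * k)) • η x +
      (form 𝔭 𝔭 / (2 * k) * k⁻¹) • wedgeDer (p 1) (p 1) x) :=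
    hη.smooth.lin (isSmoothForm_wedgeDer hs1 hs1) _ _
  -- The coefficient of t in (p(t), p(t)) is b = 2k, so the factor 2a/b equals a/k.
  have hc : 2 * form 𝔭 𝔭 / (2 * k) = form 𝔭 𝔭 / k := mul_div_mul_left _ _ two_ne_zero
  refine ⟨𝔭, form 𝔭 𝔭, 2 * k, h𝔭, ha, mul_ne_zero two_ne_zero hk0, fun x t => ?_,
    perpBundle 𝔭 (p 1), fun x => Submodule.span ℝ {p 1 x}, _,
    hG.isGuichard hsm hη.closed hη.bracket, hnf.isNullNormal, hnf.inter_sup hG.mem, ?_, ?_⟩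
  · rw [form_evalPoly_one, h𝔭, hk, (hcoef x).2.2, zero_mul, add_zero]
  · rw [hc]
    exact hG.isGuichardDifferential h.differential
  · rw [hc]
    exact h.nondegenerate.const_mul (div_ne_zero ha hk0)

end LinearConserved

/-! ### From Guichard surfaces to Legendre maps -/

theorem HasSignature31.eq_zero {W : Submodule ℝ R42} (h : HasSignature31 W) {v : R42}
    (hv : v ∈ W) (hv' : v ∈ perp W) : v = 0 := by
  obtain ⟨e, hs, he⟩ := h
  rw [← hs, Submodule.mem_span_range_iff_exists_fun] at hv
  obtain ⟨c, rfl⟩ := hv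
  have hc : ∀ j, c j = 0 := by
    intro j
    have h1 := mem_perp.mp hv' (e j) (hs ▸ Submodule.subset_span ⟨j, rfl⟩)
    simp only [map_sum, map_smul, he, Matrix.diagonal_apply, smul_eq_mul, mul_ite, mul_zero,
      Finset.sum_ite_eq, Finset.mem_univ, if_true] at h1
    fin_cases j <;> simpa using h1
  simp [hc]

theorem HasSignature31.finrank {W : Submodule ℝ R42} (h : HasSignature31 W) :
    Module.finrank ℝ W = 4 := by
  obtain ⟨e, hs, he⟩ := h
  have hi : LinearIndependent ℝ e := by
    rw [Fintype.linearIndependent_iff]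
    intro c hc j
    have h1 := congrArg (form (e j)) hc
    simp only [map_sum, map_smul, he, Matrix.diagonal_apply, smul_eq_mul, mul_ite, mul_zero,
      Finset.sum_ite_eq, Finset.mem_univ, if_true, map_zero] at h1
    fin_cases j <;> simpa using h1
  rw [← hs, finrank_span_eq_card hi, Fintype.card_fin]

section Lift

variable {M : Type*} [TopologicalSpace M] [ChartedSpace (EuclideanSpace ℝ (Fin 2)) M]

variable {𝔭 : R42} {Λ V s : M → Submodule ℝ R42} {χ : OneForm M EndR42} {p : M → R42} {a k : ℝ}

/-- Otherwise 𝔭 and v would span the plane V^⊥ and v would be orthogonal to all of it, although V^⊥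
is non-degenerate. -/
theorem IsSphereCongruence.form_ne_zero (hV : IsSphereCongruence 𝔭 V) (h𝔭 : form 𝔭 𝔭 ≠ 0)
    {x : M} {v : R42} (hv : v ∈ perp (V x)) (hn : form v v = 0) (h0 : v ≠ 0) : form 𝔭 v ≠ 0 := by
  intro hpv
  have hi : LinearIndependent ℝ ![𝔭, v] := by
    refine linearIndependent_pair fun c d h => ?_
    have h1 := congrArg (form 𝔭) h
    simp only [map_add, map_smul, smul_eq_mul, hpv, mul_zero, add_zero, map_zero] at h1
    have hc := (mul_eq_zero.mp h1).resolve_right h𝔭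
    rw [hc, zero_smul, zero_add] at h
    exact ⟨hc, (smul_eq_zero.mp h).resolve_right h0⟩
  have h𝔭V : 𝔭 ∈ perp (V x) := mem_perp.mpr fun w hw => by
    rw [form_comm]; exact mem_vperp.mp (hV.le x hw)
  have hsp : Submodule.span ℝ {𝔭, v} = perp (V x) := by
    refine Submodule.eq_of_le_of_finrank_eq ?_ ?_
    · rw [Submodule.span_le]
      rintro w (rfl | rfl)
      · exact h𝔭V
      · exact hv
    · rw [finrank_pair hi rfl, finrank_perp, (hV.signature x).finrank]
  refine h0 ((hV.signature x).eq_zero ?_ hv)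
  rw [← perp_perp (V x), ← hsp, mem_perp_span_pair]
  exact ⟨hpv, hn⟩

/-- The null normal bundle has a unique section `p` with `(𝔭, p) = (𝔭, 𝔭)`. -/
theorem IsSphereCongruence.exists_nullField (hV : IsSphereCongruence 𝔭 V) (h𝔭 : form 𝔭 𝔭 ≠ 0)
    (hs : IsNullNormal V s) : ∃ p : M → R42, IsNullField 𝔭 p (form 𝔭 𝔭) (form 𝔭 𝔭) ∧
      V = perpBundle 𝔭 p ∧ s = fun x => Submodule.span ℝ {p x} := by
  have hnull : ∀ x, ∀ v ∈ s x, form v v = 0 := fun x v hv => mem_perp.mp (hs.isotropic x hv) v hv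
  have hne : ∀ {U e}, IsFrame₁ s U e → ∀ y ∈ U, form 𝔭 (e y) ≠ 0 := fun he y hy =>
    hV.form_ne_zero h𝔭 (hs.le y (he.mem hy)) (hnull y _ (he.mem hy)) (he.ne_zero y hy)
  -- The scaling k = a makes the ratio a/k of the two quadratic differentials equal to 1.
  have hex : ∀ x, ∃ v ∈ s x, form 𝔭 v = form 𝔭 𝔭 := by
    intro x
    obtain ⟨U, e, he, hx⟩ := hs.smooth.exists_frame₁ x
    refine ⟨(form 𝔭 𝔭 / form 𝔭 (e x)) • e x, (s x).smul_mem _ (he.mem hx), ?_⟩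
    have := hne he x hx
    simp only [map_smul, smul_eq_mul]
    field_simp
  choose p hps hp using hex
  have hloc : ∀ {U e}, IsFrame₁ s U e → ∀ y ∈ U,
      p y = (form 𝔭 𝔭 * (form 𝔭 (e y))⁻¹) • e y := by
    intro U e he y hy
    obtain ⟨c, hc⟩ := he.exists_of_mem hy (hps y)
    have h1 := hp y
    rw [hc, map_smul, smul_eq_mul] at h1
    rw [hc, ← h1, mul_inv_cancel_right₀ (hne he y hy)]
  have hsm : SmoothOn p Set.univ := by
    intro x _
    obtain ⟨U, e, he, hx⟩ := hs.smooth.exists_frame₁ x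
    have h1 : SmoothOn p U := SmoothOn.congr_on (((smoothOn_const (form 𝔭 𝔭) U).fmul
      (((smoothOn_const 𝔭 U).form he.smooth).inv (hne he))).fsmul he.smooth) (hloc he)
    exact (h1.contMDiffAt (he.isOpen.mem_nhds hx)).contMDiffWithinAt
  have hnf : IsNullField 𝔭 p (form 𝔭 𝔭) (form 𝔭 𝔭) :=
    ⟨hsm, rfl, hp, fun x => hnull x _ (hps x), h𝔭⟩
  refine ⟨p, hnf, funext fun x => ?_, funext fun x => ?_⟩
  · refine Submodule.eq_of_le_of_finrank_eq (fun w hw => mem_perpBundle.mpr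
      ⟨mem_vperp.mp (hV.le x hw), ?_⟩) ?_
    · rw [form_comm]; exact mem_perp.mp (hs.le x (hps x)) w hw
    · rw [(hV.signature x).finrank]
      exact (finrank_perp_null_pair (hp x) (hnull x _ (hps x)) h𝔭).symm
  · obtain ⟨U, e, he, hx⟩ := hs.smooth.exists_frame₁ x
    rw [hloc he x hx, Submodule.span_singleton_smul_eq
      (mul_ne_zero h𝔭 (inv_ne_zero (hne he x hx))).isUnit, he.span x hx]

/-- By the modular law, since (𝔭, p) ≠ 0 leaves only zero in ⟨p⟩ ∩ ⟨𝔭⟩^⊥. -/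
theorem IsNullField.sup_inter (hp : IsNullField 𝔭 p a k) (hΛ : IsPointMap 𝔭 Λ) (x : M) :
    (Λ x ⊔ Submodule.span ℝ {p x}) ⊓ vperp 𝔭 = Λ x := by
  rw [sup_inf_assoc_of_le _ (hΛ.le x), sup_eq_left.mpr]
  rintro v ⟨hv, hv'⟩
  obtain ⟨c, rfl⟩ := Submodule.mem_span_singleton.mp hv
  have h1 := mem_vperp.mp hv'
  rw [map_smul, hp.form_eq, smul_eq_mul] at h1
  rw [(mul_eq_zero.mp h1).resolve_right hp.ne_zero, zero_smul]
  exact Submodule.zero_mem _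

theorem IsNullField.isFrame₂_sup (hp : IsNullField 𝔭 p a k) (hΛ : IsPointMap 𝔭 Λ) {U : Set M}
    {e : M → R42} (he : IsFrame₁ Λ U e) :
    IsFrame₂ (fun x => Λ x ⊔ Submodule.span ℝ {p x}) U e p where
  isOpen := he.isOpen
  smooth₁ := he.smooth
  smooth₂ := hp.smooth.mono (Set.subset_univ _)
  indep y hy := by
    refine linearIndependent_pair fun c d h => ?_
    have h1 := congrArg (form 𝔭) h
    simp only [map_add, map_smul, smul_eq_mul, mem_vperp.mp (hΛ.le y (he.mem hy)), hp.form_eq,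
      mul_zero, zero_add, map_zero] at h1
    have hd := (mul_eq_zero.mp h1).resolve_right hp.ne_zero
    rw [hd, zero_smul, add_zero] at h
    exact ⟨(smul_eq_zero.mp h).resolve_right (he.ne_zero y hy), hd⟩
  span y hy := by rw [Submodule.span_insert, he.span y hy]

/-- The contact lift of an immersed surface enveloping a sphere congruence. -/
theorem IsNullField.isLegendre_sup (hp : IsNullField 𝔭 p a k) (hΛ : IsPointMap 𝔭 Λ)
    (henv : ∀ x, derived Λ x ≤ perpBundle 𝔭 p x) (hI : Immerses Λ) :
    IsLegendre fun x => Λ x ⊔ Submodule.span ℝ {p x} := by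
  have hiso : ∀ {U e}, IsFrame₁ Λ U e → ∀ y ∈ U, form (e y) (e y) = 0 ∧ form (p y) (e y) = 0 :=
    fun he y hy => ⟨mem_perp.mp (hΛ.isotropic y (he.mem hy)) _ (he.mem hy),
      (mem_perpBundle.mp (henv y (he.isSectionNear hy).mem_derived)).2⟩
  have hI2 : ∀ x, IsIsotropic (Λ x ⊔ Submodule.span ℝ {p x}) := by
    intro x
    obtain ⟨U, e, he, hx⟩ := hΛ.smooth.exists_frame₁ x
    obtain ⟨h1, h2⟩ := hiso he x hx
    intro v hv
    obtain ⟨c, d, rfl⟩ := (hp.isFrame₂_sup hΛ he).exists_of_mem hx hv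
    rw [← (hp.isFrame₂_sup hΛ he).span x hx, mem_perp_span_pair]
    simp [h1, h2, form_comm (e x) (p x), hp.null]
  refine ⟨isSubbundle_of_frame₂ fun x => ?_, hI2, fun x => ?_, fun x X hX => ?_⟩
  · obtain ⟨U, e, he, hx⟩ := hΛ.smooth.exists_frame₁ x
    exact ⟨U, e, p, hp.isFrame₂_sup hΛ he, hx⟩
  · obtain ⟨U, e, he, hx⟩ := hΛ.smooth.exists_frame₁ x
    have hf := hp.isFrame₂_sup hΛ he
    refine Submodule.span_le.mpr ?_
    rintro v ⟨σ, hσ, rfl | ⟨X, rfl⟩⟩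
    · exact hI2 x hσ.mem
    · obtain ⟨c, d, -, hd⟩ := hf.exists_der hx hσ
      obtain ⟨r, hr, hd⟩ := hd X
      have hde := he.smooth.diffAt he.isOpen hx
      have e1 : form (e x) (der e x X) = 0 := by
        have h1 := der_form hde hde X
        rw [der_eq_zero_of_eqOn he.isOpen hx (c := 0) fun y hy => (hiso he y hy).1,
          form_comm (der e x X)] at h1
        linarith
      have e2 : form (p x) (der e x X) = 0 :=
        (mem_perpBundle.mp (henv x ((he.isSectionNear hx).der_mem_derived X))).2
      -- Differentiate (p, e) = 0 and use (p, de) = 0, which holds because Λ envelops V.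
      have e3 : form (e x) (der p x X) = 0 := by
        have h1 := der_form (hp.diffAt x) hde X
        rw [der_eq_zero_of_eqOn he.isOpen hx (c := 0) fun y hy => (hiso he y hy).2, e2,
          form_comm (der p x X)] at h1
        linarith
      have e4 := (hp.form_der x X).2
      have hr' := hI2 x hr
      change der σ x X ∈ perp _
      rw [← hf.span x hx, mem_perp_span_pair] at hr' ⊢
      rw [hd]
      simp [e1, e2, e3, e4, hr'.1, hr'.2]
  -- For a section σ of Λ the derivative d_X σ lies in V, so if it lies in f it lies in f ∩ ⟨𝔭⟩^⊥ =
  -- Λ.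
  · refine hI x X fun σ hσ => ?_
    rw [← hp.sup_inter hΛ x]
    refine ⟨hX σ ?_, mem_vperp.mpr (mem_perpBundle.mp (henv x (hσ.der_mem_derived X))).1⟩
    obtain ⟨U, hU, hx, h1, h2⟩ := hσ
    exact ⟨U, hU, hx, h1, fun y hy => Submodule.mem_sup_left (h2 y hy)⟩

/-- The lift of a Guichard surface carries a potential. -/
theorem IsGuichard.isGuichardLift (h : IsGuichard 𝔭 Λ (perpBundle 𝔭 p) χ)
    (hp : IsNullField 𝔭 p (form 𝔭 𝔭) (form 𝔭 𝔭))
    (hf : IsLegendre fun x => Λ x ⊔ Submodule.span ℝ {p x}) :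
    IsGuichardLift 𝔭 p (form 𝔭 𝔭) (form 𝔭 𝔭) (fun x => Λ x ⊔ Submodule.span ℝ {p x}) Λ χ
      (fun x => (2 : ℝ) • χ x + (-(form 𝔭 𝔭)⁻¹) • wedgeDer p p x) where
  nullField := hp
  ne_zero := h.nonnull
  legendre := hf
  subbundle := h.pointMap.smooth
  inter x := (hp.sup_inter h.pointMap x).symm
  mem x := Submodule.mem_sup_right (Submodule.mem_span_singleton_self _)
  mem_wedge := h.mem
  rel x X := by
    rw [mul_div_cancel_right₀ _ h.nonnull, add_apply, smul_apply, smul_apply, wedgeDer_apply,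
      neg_smul, sub_eq_add_neg]

end Lift

/-! ### Smooth curvature frames -/

section ExistsFrame

variable {M : Type*} [TopologicalSpace M] [ChartedSpace (EuclideanSpace ℝ (Fin 2)) M]

local notation "𝔼" => EuclideanSpace ℝ (Fin 2)

variable {f : M → Submodule ℝ R42}

/-- The small root of a quadratic equation depends smoothly on its coefficients. -/
theorem exists_smooth_root {A B C : M → ℝ} {U : Set M} (hU : IsOpen U) (hA : SmoothOn A U)
    (hB : SmoothOn B U) (hC : SmoothOn C U) {x : M} (hx : x ∈ U) (hAx : A x = 0)
    (hBx : 0 < B x) :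
    ∃ W ⊆ U, IsOpen W ∧ x ∈ W ∧ ∃ u : M → ℝ, SmoothOn u W ∧ u x = 0 ∧
      ∀ y ∈ W, A y + B y * u y + C y * u y ^ 2 = 0 := by
  obtain ⟨W₁, hW₁U, hW₁, hxW₁, hpos⟩ := hB.exists_open_pos hU hx hBx
  have hA₁ : SmoothOn A W₁ := hA.mono hW₁U
  have hB₁ : SmoothOn B W₁ := hB.mono hW₁U
  have hC₁ : SmoothOn C W₁ := hC.mono hW₁U
  have hD : SmoothOn (fun y => B y * B y - 4 * (A y * C y)) W₁ :=
    (hB₁.fmul hB₁).fsub ((smoothOn_const 4 W₁).fmul (hA₁.fmul hC₁))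
  obtain ⟨W, hWW₁, hW, hxW, hposD⟩ := hD.exists_open_pos hW₁ hxW₁ (by
    rw [hAx]; simp only [zero_mul, mul_zero, sub_zero]; exact mul_pos hBx hBx)
  have hsum : ∀ y ∈ W, B y + √(B y * B y - 4 * (A y * C y)) ≠ 0 := fun y hy =>
    (add_pos_of_pos_of_nonneg (hpos y (hWW₁ hy)) (Real.sqrt_nonneg _)).ne'
  have hA₂ : SmoothOn A W := hA₁.mono hWW₁
  have hB₂ : SmoothOn B W := hB₁.mono hWW₁
  have hD₂ : SmoothOn (fun y => B y * B y - 4 * (A y * C y)) W := hD.mono hWW₁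
  -- The rationalised root -2A / (B + √(B² - 4AC)) avoids dividing by C, which may vanish.
  refine ⟨W, hWW₁.trans hW₁U, hW, hxW,
    fun y => (-2 * A y) * (B y + √(B y * B y - 4 * (A y * C y)))⁻¹,
    ((smoothOn_const (-2) W).fmul hA₂).fmul
      ((hB₂.fadd (hD₂.sqrt fun y hy => (hposD y hy).ne')).inv hsum), by simp [hAx], ?_⟩
  intro y hy
  have h1 := hsum y hy
  have h2 := Real.sq_sqrt (hposD y hy).le
  beta_reduce
  generalize √(B y * B y - 4 * (A y * C y)) = r at h1 h2 ⊢
  field_simp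
  linear_combination A y * h2

/-- A local frame is changed by constant coefficients so that it spans the two curvature spheres at
the single point x; nothing is claimed at nearby points. -/
theorem exists_isPrincipalAt (hf : IsLegendre f) (hu : IsUmbilicFree f) (x : M) :
    ∃ U e₁ e₂ X₁ X₂, IsPrincipalAt f U e₁ e₂ x X₁ X₂ := by
  obtain ⟨s₁, s₂, ⟨h₁, hs₁, X₁, hX₁, hc₁⟩, ⟨h₂, hs₂, X₂, hX₂, hc₂⟩, hne⟩ := hu x
  obtain ⟨U, a, b, hab, hx⟩ := hf.smooth.exists_frame₂ x
  obtain ⟨v₁, hv₁, hsp₁⟩ := finrank_eq_one_iff'.mp h₁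
  obtain ⟨v₂, hv₂, hsp₂⟩ := finrank_eq_one_iff'.mp h₂
  have hn₁ : (v₁ : R42) ≠ 0 := fun h => hv₁ (Subtype.ext h)
  have hn₂ : (v₂ : R42) ≠ 0 := fun h => hv₂ (Subtype.ext h)
  have e₁ : Submodule.span ℝ {(v₁ : R42)} = s₁ := le_antisymm
    ((Submodule.span_singleton_le_iff_mem _ _).mpr v₁.2) fun w hw => by
      obtain ⟨c, hc⟩ := hsp₁ ⟨w, hw⟩
      exact Submodule.mem_span_singleton.mpr ⟨c, congrArg Subtype.val hc⟩
  have e₂ : Submodule.span ℝ {(v₂ : R42)} = s₂ := le_antisymm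
    ((Submodule.span_singleton_le_iff_mem _ _).mpr v₂.2) fun w hw => by
      obtain ⟨c, hc⟩ := hsp₂ ⟨w, hw⟩
      exact Submodule.mem_span_singleton.mpr ⟨c, congrArg Subtype.val hc⟩
  have hi : LinearIndependent ℝ ![(v₁ : R42), v₂] := by
    rw [LinearIndependent.pair_iff' hn₁]
    intro c hc
    have hc0 : c ≠ 0 := by rintro rfl; exact hn₂ (by rw [← hc, zero_smul])
    exact hne (by rw [← e₁, ← e₂, ← hc, Submodule.span_singleton_smul_eq hc0.isUnit])
  obtain ⟨a₁, b₁, hv₁'⟩ := hab.exists_of_mem hx (hs₁ v₁.2)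
  obtain ⟨a₂, b₂, hv₂'⟩ := hab.exists_of_mem hx (hs₂ v₂.2)
  have hdet : a₁ * b₂ - a₂ * b₁ ≠ 0 := by
    intro h0
    have hlin : ∀ c d : ℝ, c * a₁ + d * a₂ = 0 → c * b₁ + d * b₂ = 0 → c = 0 ∧ d = 0 :=
      fun c d h1 h2 => LinearIndependent.pair_iff.mp hi c d (by
        rw [hv₁', hv₂']
        have : c • (a₁ • a x + b₁ • b x) + d • (a₂ • a x + b₂ • b x) =
          (c * a₁ + d * a₂) • a x + (c * b₁ + d * b₂) • b x := by module
        rw [this, h1, h2, zero_smul, zero_smul, add_zero])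
    have t1 := hlin a₂ (-a₁) (by ring) (by linarith)
    have t2 := hlin b₂ (-b₁) (by linarith) (by ring)
    refine hn₁ (by rw [hv₁', neg_eq_zero.mp t1.2, neg_eq_zero.mp t2.2]; simp)
  set τ₁ : M → R42 := fun y => a₁ • a y + b₁ • b y with hτ₁
  set τ₂ : M → R42 := fun y => a₂ • a y + b₂ • b y with hτ₂
  have hfr : IsFrame₂ f U τ₁ τ₂ := by
    have hcomb : ∀ y, ∀ c d : ℝ, c • a y + d • b y =
        ((c * b₂ - d * a₂) / (a₁ * b₂ - a₂ * b₁)) • τ₁ y +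
        ((d * a₁ - c * b₁) / (a₁ * b₂ - a₂ * b₁)) • τ₂ y := by
      intro y c d
      simp only [hτ₁, hτ₂]
      generalize hD : a₁ * b₂ - a₂ * b₁ = D at hdet ⊢
      match_scalars
      · field_simp
        rw [← hD]; ring
      · field_simp
        rw [← hD]; ring
    refine ⟨hab.isOpen, ((smoothOn_const a₁ U).fsmul hab.smooth₁).fadd
      ((smoothOn_const b₁ U).fsmul hab.smooth₂), ((smoothOn_const a₂ U).fsmul hab.smooth₁).fadd
      ((smoothOn_const b₂ U).fsmul hab.smooth₂), fun y hy => ?_, fun y hy => ?_⟩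
    · refine linearIndependent_pair fun c d h => ?_
      have h1 := LinearIndependent.pair_iff.mp (hab.indep y hy) (c * a₁ + d * a₂)
        (c * b₁ + d * b₂) (by rw [← h]; simp only [hτ₁, hτ₂]; module)
      have hc : c * (a₁ * b₂ - a₂ * b₁) = 0 := by
        linear_combination b₂ * h1.1 - a₂ * h1.2
      have hd : d * (a₁ * b₂ - a₂ * b₁) = 0 := by
        linear_combination a₁ * h1.2 - b₁ * h1.1
      exact ⟨(mul_eq_zero.mp hc).resolve_right hdet, (mul_eq_zero.mp hd).resolve_right hdet⟩
    · apply le_antisymm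
      · rw [Submodule.span_le]
        rintro w (rfl | rfl)
        · exact (f y).add_mem ((f y).smul_mem _ (hab.mem₁ hy)) ((f y).smul_mem _ (hab.mem₂ hy))
        · exact (f y).add_mem ((f y).smul_mem _ (hab.mem₁ hy)) ((f y).smul_mem _ (hab.mem₂ hy))
      · intro w hw
        obtain ⟨c, d, rfl⟩ := hab.exists_of_mem hy hw
        rw [hcomb y c d, Submodule.mem_span_pair]
        exact ⟨_, _, rfl⟩
  have k₁ : der τ₁ x X₁ ∈ f x := hc₁ τ₁ (hfr.section₁ hx) (by simpa only [hτ₁, ← hv₁'] using v₁.2)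
  have k₂ : der τ₂ x X₂ ∈ f x := hc₂ τ₂ (hfr.section₂ hx) (by simpa only [hτ₂, ← hv₂'] using v₂.2)
  refine ⟨U, τ₁, τ₂, X₁, X₂, hfr, hx, ?_, k₁, k₂⟩
  -- If X₂ were a multiple of X₁, then d_{X₁} would map every section into f.
  rw [LinearIndependent.pair_iff' hX₁]
  intro c hc
  have hc0 : c ≠ 0 := by rintro rfl; exact hX₂ (by rw [← hc, zero_smul])
  refine hX₁ (hf.immersion x X₁ fun σ hσ => ?_)
  obtain ⟨r, t, -, hd⟩ := hfr.exists_der hx hσ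
  obtain ⟨w, hw, hd⟩ := hd X₁
  rw [← hc, map_smul] at k₂
  rw [hd]
  exact (f x).add_mem ((f x).add_mem ((f x).smul_mem _ k₁)
    ((f x).smul_mem _ (((f x).smul_mem_iff hc0).mp k₂))) hw

theorem coordField_smul (x₀ : M) (t : ℝ) (u : 𝔼) (y : M) :
    coordField x₀ (t • u) y = t • coordField x₀ u y := map_smul _ _ _

variable [IsManifold (𝓡 2) ∞ M]

theorem coordField_linearIndependent (x : M) {u v : 𝔼} {y : M}
    (hy : y ∈ (chartAt 𝔼 x).source)
    (h : LinearIndependent ℝ ![coordField x u x, coordField x v x]) :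
    LinearIndependent ℝ ![coordField x u y, coordField x v y] := by
  have hlin : ∀ z (s t : ℝ), coordField x (s • u + t • v) z =
      s • coordField x u z + t • coordField x v z := fun z s t => by
    rw [coordField_add, coordField_smul, coordField_smul]
  have h0 : ∀ z, coordField x 0 z = 0 := fun z => map_zero (mfderiv 𝓘(ℝ, 𝔼) (𝓡 2) (chartAt 𝔼 x).symm (chartAt 𝔼 x z))
  rw [LinearIndependent.pair_iff] at h ⊢
  intro s t hst
  refine h s t ?_
  rw [← hlin] at hst ⊢
  have : s • u + t • v = 0 := (coordField_bijective x hy).1 (hst.trans (h0 y).symm)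
  rw [this, h0]

/-- A principal frame at a point extends to a smooth curvature sphere congruence. -/
theorem IsPrincipalAt.exists_curvature_sphere (hf : IsLegendre f) {U : Set M} {e₁ e₂ : M → R42}
    {x : M} {u₁ u₂ : 𝔼}
    (h : IsPrincipalAt f U e₁ e₂ x (coordField x u₁ x) (coordField x u₂ x)) :
    ∃ W ⊆ (chartAt 𝔼 x).source ∩ U, IsOpen W ∧ x ∈ W ∧ ∃ c κ : M → ℝ, SmoothOn c W ∧
      SmoothOn κ W ∧ c x = 0 ∧ κ x = 0 ∧ ∀ y ∈ W,
        der (fun z => e₁ z + c z • e₂ z) y (coordField x u₁ y + κ y • coordField x u₂ y) ∈ f y := by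
  have hxs : x ∈ (chartAt 𝔼 x).source := mem_chart_source 𝔼 x
  set O := (chartAt 𝔼 x).source ∩ U with hOdef
  have hO : IsOpen O := (chartAt 𝔼 x).open_source.inter h.frame.isOpen
  have hxO : x ∈ O := ⟨hxs, h.mem⟩
  have hOU : O ⊆ U := Set.inter_subset_right
  set a : M → R42 := fun y => der e₁ y (coordField x u₁ y) with ha
  set n₁ : M → R42 := fun y => der e₁ y (coordField x u₂ y) with hn₁
  set n₂ : M → R42 := fun y => der e₂ y (coordField x u₁ y) with hn₂
  set b : M → R42 := fun y => der e₂ y (coordField x u₂ y) with hb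
  have sa : SmoothOn a O := h.frame.smooth₁.der_coordField h.frame.isOpen x u₁
  have sn₁ : SmoothOn n₁ O := h.frame.smooth₁.der_coordField h.frame.isOpen x u₂
  have sn₂ : SmoothOn n₂ O := h.frame.smooth₂.der_coordField h.frame.isOpen x u₁
  have sb : SmoothOn b O := h.frame.smooth₂.der_coordField h.frame.isOpen x u₂
  have p₁ : 0 < form (n₁ x) (n₁ x) := h.form_self_pos₁ hf
  have p₂ : 0 < form (n₂ x) (n₂ x) := h.symm.form_self_pos₁ hf
  have n12 : form (n₁ x) (n₂ x) = 0 := h.form_eq_zero hf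
  have m₁ : ∀ y ∈ O, n₁ y ∈ perp (f y) := fun y hy =>
    hf.der_mem_perp (h.frame.section₁ (hOU hy)) _
  have m₂ : ∀ y ∈ O, n₂ y ∈ perp (f y) := fun y hy =>
    hf.der_mem_perp (h.frame.section₂ (hOU hy)) _
  have ma : ∀ y ∈ O, a y ∈ perp (f y) := fun y hy =>
    hf.der_mem_perp (h.frame.section₁ (hOU hy)) _
  have mb : ∀ y ∈ O, b y ∈ perp (f y) := fun y hy =>
    hf.der_mem_perp (h.frame.section₂ (hOU hy)) _
  have z₁a : form (n₁ x) (a x) = 0 := hf.form_der (h.frame.section₁ h.mem) _ h.curv₁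
  have z₂a : form (n₂ x) (a x) = 0 := hf.form_der (h.frame.section₂ h.mem) _ h.curv₁
  have z₁b : form (n₁ x) (b x) = 0 := hf.form_der (h.frame.section₁ h.mem) _ h.curv₂
  have z₂b : form (n₂ x) (b x) = 0 := hf.form_der (h.frame.section₂ h.mem) _ h.curv₂
  -- The derivative of e₁ + c e₂ along u₁ + κ u₂ is a + c n₂ + κ (n₁ + c b) modulo f, and lies in f
  -- when it is orthogonal to n₁ and n₂. Eliminating κ leaves the quadratic A + B c + C c² = 0, with
  -- A = 0 and B = (n₁, n₁) (n₂, n₂) > 0 at x.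
  obtain ⟨W₁, hW₁O, hW₁, hxW₁, c, sc, hcx, hroot⟩ := exists_smooth_root hO
    (A := fun y => form (n₂ y) (a y) * form (n₁ y) (n₁ y) -
      form (n₁ y) (a y) * form (n₁ y) (n₂ y))
    (B := fun y => form (n₂ y) (n₂ y) * form (n₁ y) (n₁ y) + form (n₂ y) (a y) * form (n₁ y) (b y) -
      form (n₁ y) (n₂ y) * form (n₁ y) (n₂ y) - form (n₁ y) (a y) * form (n₂ y) (b y))
    (C := fun y => form (n₂ y) (n₂ y) * form (n₁ y) (b y) - form (n₁ y) (n₂ y) * form (n₂ y) (b y))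
    (((sn₂.form sa).fmul (sn₁.form sn₁)).fsub ((sn₁.form sa).fmul (sn₁.form sn₂)))
    (((((sn₂.form sn₂).fmul (sn₁.form sn₁)).fadd ((sn₂.form sa).fmul (sn₁.form sb))).fsub
      ((sn₁.form sn₂).fmul (sn₁.form sn₂))).fsub ((sn₁.form sa).fmul (sn₂.form sb)))
    (((sn₂.form sn₂).fmul (sn₁.form sb)).fsub ((sn₁.form sn₂).fmul (sn₂.form sb)))
    hxO (by simp [z₁a, z₂a]) (by simp only [z₁a, z₂a, n12]; nlinarith [mul_pos p₁ p₂])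
  have mono : ∀ {F : Type} [NormedAddCommGroup F] [NormedSpace ℝ F] {σ : M → F}, SmoothOn σ O →
      SmoothOn σ W₁ := fun hσ => ContMDiffOn.mono hσ hW₁O
  have sden : SmoothOn (fun y => form (n₁ y) (n₁ y) + c y * form (n₁ y) (b y)) W₁ :=
    (mono (sn₁.form sn₁)).fadd (sc.fmul (mono (sn₁.form sb)))
  obtain ⟨W₂, hW₂W₁, hW₂, hxW₂, hden⟩ := sden.exists_open_ne_zero hW₁ hxW₁
    (by simp [hcx, p₁.ne'])
  have sG : SmoothOn (fun y => form (n₁ y) (n₁ y) * form (n₂ y) (n₂ y) -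
      form (n₁ y) (n₂ y) * form (n₁ y) (n₂ y)) W₂ :=
    ContMDiffOn.mono (((sn₁.form sn₁).fmul (sn₂.form sn₂)).fsub
      ((sn₁.form sn₂).fmul (sn₁.form sn₂))) (hW₂W₁.trans hW₁O)
  obtain ⟨W, hWW₂, hW, hxW, hG⟩ := sG.exists_open_ne_zero hW₂ hxW₂ (by
    simp [n12, p₁.ne', p₂.ne'])
  have hWW₁ : W ⊆ W₁ := hWW₂.trans hW₂W₁
  have hWO : W ⊆ O := hWW₁.trans hW₁O
  have scW : SmoothOn c W := ContMDiffOn.mono sc hWW₁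
  refine ⟨W, hWO, hW, hxW, c, fun y => -(form (n₁ y) (a y) + c y * form (n₁ y) (n₂ y)) *
    (form (n₁ y) (n₁ y) + c y * form (n₁ y) (b y))⁻¹, scW, ?_, hcx, ?_, ?_⟩
  · exact ((SmoothOn.fadd (ContMDiffOn.mono (sn₁.form sa) hWO) (scW.fmul
      (ContMDiffOn.mono (sn₁.form sn₂) hWO))).fneg).fmul
      (SmoothOn.inv (ContMDiffOn.mono sden hWW₁) fun y hy => hden y (hWW₂ hy))
  · simp [hcx, z₁a]
  · intro y hy
    have hyO := hWO hy
    have hyU := hOU hyO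
    have hd := hden y (hWW₂ hy)
    set κ := -(form (n₁ y) (a y) + c y * form (n₁ y) (n₂ y)) *
      (form (n₁ y) (n₁ y) + c y * form (n₁ y) (b y))⁻¹ with hκ
    have hκ' : κ * (form (n₁ y) (n₁ y) + c y * form (n₁ y) (b y)) =
        -(form (n₁ y) (a y) + c y * form (n₁ y) (n₂ y)) := by
      rw [hκ, inv_mul_cancel_right₀ hd]
    have d₁ := h.frame.smooth₁.diffAt h.frame.isOpen hyU
    have d₂ := h.frame.smooth₂.diffAt h.frame.isOpen hyU
    have dc := scW.diffAt hW hy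
    have dce : DiffAt (fun z => c z • e₂ z) y :=
      (scW.fsmul (ContMDiffOn.mono h.frame.smooth₂ (hWO.trans hOU))).diffAt hW hy
    rw [der_add d₁ dce, der_smul dc d₂]
    have hsplit : ∀ r : ℝ, der e₁ y (coordField x u₁ y + κ • coordField x u₂ y) +
        (r • e₂ y + c y • der e₂ y (coordField x u₁ y + κ • coordField x u₂ y)) =
        r • e₂ y + (a y + c y • n₂ y + κ • (n₁ y + c y • b y)) := by
      intro r
      simp only [map_add, map_smul, ha, hb, hn₁, hn₂]
      module
    rw [hsplit]
    refine (f y).add_mem ((f y).smul_mem _ (h.frame.mem₂ hyU)) ?_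
    refine mem_of_perp_pair (hf.finrank y) (hf.isotropic y) (m₁ y hyO) (m₂ y hyO)
      (by rw [sq]; exact hG y hy) ?_ ?_ ?_
    · exact Submodule.add_mem _ (Submodule.add_mem _ (ma y hyO) (Submodule.smul_mem _ _ (m₂ y hyO)))
        (Submodule.smul_mem _ _ (Submodule.add_mem _ (m₁ y hyO)
          (Submodule.smul_mem _ _ (mb y hyO))))
    · simp only [map_add, map_smul, smul_eq_mul]
      linear_combination hκ'
    · simp only [map_add, map_smul, smul_eq_mul, form_comm (n₂ y) (n₁ y)]
      have h1 := hroot y (hWW₁ hy)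
      refine (mul_eq_zero.mp (?_ : (form (n₁ y) (n₁ y) + c y * form (n₁ y) (b y)) * _ = 0)).resolve_left
        hd
      linear_combination h1 + (form (n₁ y) (n₂ y) + c y * form (n₂ y) (b y)) * hκ'

/-- Near each point of an umbilic-free Legendre map there are smooth lifts of the curvature
spheres and smooth fields of curvature directions. -/
theorem exists_isCurvatureFrame (hf : IsLegendre f) (hu : IsUmbilicFree f) (x : M) :
    ∃ (U : Set M) (σ₁ σ₂ : M → R42) (X₁ X₂ : (x : M) → TangentSpace (𝓡 2) x),
      IsOpen U ∧ x ∈ U ∧ IsCurvatureFrame f U σ₁ σ₂ X₁ X₂ := by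
  obtain ⟨U, e₁, e₂, Y₁, Y₂, h⟩ := exists_isPrincipalAt hf hu x
  have hxs : x ∈ (chartAt 𝔼 x).source := mem_chart_source 𝔼 x
  obtain ⟨u₁, rfl⟩ := (coordField_bijective x hxs).2 Y₁
  obtain ⟨u₂, rfl⟩ := (coordField_bijective x hxs).2 Y₂
  obtain ⟨W₁, hW₁O, hW₁, hxW₁, c₁, κ₁, sc₁, sκ₁, hc₁, hκ₁, hcurv₁⟩ := h.exists_curvature_sphere hf
  obtain ⟨W₂, hW₂O, hW₂, hxW₂, c₂, κ₂, sc₂, sκ₂, hc₂, hκ₂, hcurv₂⟩ :=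
    h.symm.exists_curvature_sphere hf
  have hW : IsOpen (W₁ ∩ W₂) := hW₁.inter hW₂
  have sc : SmoothOn (fun y => 1 - c₁ y * c₂ y) (W₁ ∩ W₂) := (smoothOn_const 1 _).fsub
    (SmoothOn.fmul (sc₁.mono Set.inter_subset_left) (sc₂.mono Set.inter_subset_right))
  have sκ : SmoothOn (fun y => 1 - κ₁ y * κ₂ y) (W₁ ∩ W₂) := (smoothOn_const 1 _).fsub
    (SmoothOn.fmul (sκ₁.mono Set.inter_subset_left) (sκ₂.mono Set.inter_subset_right))
  obtain ⟨W₃, hW₃, hW₃o, hxW₃, hne₃⟩ := sc.exists_open_ne_zero hW ⟨hxW₁, hxW₂⟩ (by simp [hc₁])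
  obtain ⟨W₄, hW₄, hW₄o, hxW₄, hne₄⟩ := sκ.exists_open_ne_zero hW ⟨hxW₁, hxW₂⟩ (by simp [hκ₁])
  have hi : W₃ ∩ W₄ ⊆ W₁ ∩ W₂ := Set.inter_subset_left.trans hW₃
  have hi₁ : W₃ ∩ W₄ ⊆ W₁ := hi.trans Set.inter_subset_left
  have hi₂ : W₃ ∩ W₄ ⊆ W₂ := hi.trans Set.inter_subset_right
  have hiS : W₃ ∩ W₄ ⊆ (chartAt 𝔼 x).source := (hi₁.trans hW₁O).trans Set.inter_subset_left
  have hiU : W₃ ∩ W₄ ⊆ U := (hi₁.trans hW₁O).trans Set.inter_subset_right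
  have se₁ : SmoothOn e₁ (W₃ ∩ W₄) := h.frame.smooth₁.mono hiU
  have se₂ : SmoothOn e₂ (W₃ ∩ W₄) := h.frame.smooth₂.mono hiU
  -- This change of basis has determinant 1 - r t; in both uses r and t vanish at x.
  have hpair : ∀ {E : Type} [AddCommGroup E] [Module ℝ E] {v w : E} {r t : ℝ},
      LinearIndependent ℝ ![v, w] → 1 - r * t ≠ 0 →
      LinearIndependent ℝ ![v + r • w, w + t • v] := by
    intro E _ _ v w r t hvw hrt
    rw [LinearIndependent.pair_iff] at hvw ⊢
    intro a b hab
    obtain ⟨h1, h2⟩ := hvw (a + b * t) (a * r + b) (by rw [← hab]; module)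
    have hb : b * (1 - r * t) = 0 := by linear_combination h2 - r * h1
    have hb := (mul_eq_zero.mp hb).resolve_right hrt
    rw [hb] at h1
    exact ⟨by linarith, hb⟩
  refine ⟨W₃ ∩ W₄, fun y => e₁ y + c₁ y • e₂ y, fun y => e₂ y + c₂ y • e₁ y,
    fun y => coordField x u₁ y + κ₁ y • coordField x u₂ y,
    fun y => coordField x u₂ y + κ₂ y • coordField x u₁ y, hW₃o.inter hW₄o, ⟨hxW₃, hxW₄⟩,
    se₁.fadd (SmoothOn.fsmul (sc₁.mono hi₁) se₂), se₂.fadd (SmoothOn.fsmul (sc₂.mono hi₂) se₁),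
    ?_, ?_, ?_, ?_, ?_, fun y hy => hcurv₁ y (hi₁ hy), fun y hy => hcurv₂ y (hi₂ hy)⟩
  · exact ContMDiffOn.add_section ((contMDiffOn_coordField x u₁).mono hiS)
      (ContMDiffOn.smul_section (sκ₁.mono hi₁) ((contMDiffOn_coordField x u₂).mono hiS))
  · exact ContMDiffOn.add_section ((contMDiffOn_coordField x u₂).mono hiS)
      (ContMDiffOn.smul_section (sκ₂.mono hi₂) ((contMDiffOn_coordField x u₁).mono hiS))
  · exact fun y hy => hpair (h.frame.indep y (hiU hy)) (hne₃ y hy.1)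
  · intro y hy
    have h1 := hpair (h.frame.indep y (hiU hy)) (hne₃ y hy.1)
    refine Submodule.eq_of_le_of_finrank_eq ?_ ?_
    · rw [Submodule.span_le]
      rintro w (rfl | rfl)
      · exact (f y).add_mem (h.frame.mem₁ (hiU hy)) ((f y).smul_mem _ (h.frame.mem₂ (hiU hy)))
      · exact (f y).add_mem (h.frame.mem₂ (hiU hy)) ((f y).smul_mem _ (h.frame.mem₁ (hiU hy)))
    · rw [finrank_pair h1 rfl, hf.finrank]
  · exact fun y hy => hpair (E := 𝔼) (coordField_linearIndependent x (hiS hy) h.indep)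
      (hne₄ y hy.2)

end ExistsFrame

/-! ### The gauge transformation to the middle potential -/

section Gauge

variable {M : Type*} [TopologicalSpace M] [ChartedSpace (EuclideanSpace ℝ (Fin 2)) M]

local notation "𝔼" => EuclideanSpace ℝ (Fin 2)

variable {f : M → Submodule ℝ R42} {η : OneForm M EndR42}

/-- The correction term in `∧² f` determined by a curvature sphere lift and the other curvature
direction. -/
def gaugeAt (η : OneForm M EndR42) (e : M → R42) (x : M) (X : TangentSpace (𝓡 2) x) : EndR42 :=
  -(form (der e x X) (der e x X))⁻¹ • wedge (η x X (der e x X)) (e x)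

/-- The wedge and the inner product in `gaugeAt` both scale by c² t², and neither sees elements of f
added to the derivative. -/
theorem gaugeAt_congr (hf : IsLegendre f) {x : M} (hη : ∀ X, ∀ v ∈ f x, η x X v = 0)
    {e d : M → R42} (he : IsSectionNear f x e) {X Y : TangentSpace (𝓡 2) x} {c t : ℝ}
    (hc : c ≠ 0) (ht : t ≠ 0) (hd : d x = c • e x) (hY : Y = t • X) {r : R42} (hr : r ∈ f x)
    (hdd : der d x X = c • der e x X + r) : gaugeAt η d x Y = gaugeAt η e x X := by
  have h1 : form (der e x X) r = 0 := hf.form_der he X hr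
  have h2 : form r r = 0 := hf.form_eq_zero hr hr
  have h3 : form (der d x Y) (der d x Y) = (c * t) ^ 2 * form (der e x X) (der e x X) := by
    rw [hY, map_smul, hdd]
    simp only [map_add, map_smul, LinearMap.add_apply, LinearMap.smul_apply, smul_eq_mul, h1, h2,
      form_comm r]
    ring
  have h4 : η x Y (der d x Y) = (c * t ^ 2) • η x X (der e x X) := by
    rw [hY, map_smul, map_smul, hdd, smul_apply, map_smul, map_add, map_smul, hη X r hr]
    module
  rw [gaugeAt, gaugeAt, h3, h4, hd, wedge_smul_left, wedge_smul_right, smul_smul, smul_smul,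
    mul_inv]
  congr 1
  field_simp

theorem IsPrincipalAt.form_der_ne_zero (hf : IsLegendre f) {U : Set M} {e₁ e₂ : M → R42} {x : M}
    {X₁ X₂ : TangentSpace (𝓡 2) x} (h : IsPrincipalAt f U e₁ e₂ x X₁ X₂) :
    form (der e₁ x X₂) (der e₁ x X₂) ≠ 0 := (h.form_self_pos₁ hf).ne'

variable [IsManifold (𝓡 2) ∞ M]

/-- The components of X, obtained by differentiating the chart along X, are smooth; α(X) is then
expanded over two coordinate fields. -/
theorem IsSmoothForm.smoothOn_field {F : Type*} [NormedAddCommGroup F] [NormedSpace ℝ F]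
    {α : OneForm M F} (hα : IsSmoothForm α) {U : Set M} (hU : IsOpen U)
    {X : (x : M) → TangentSpace (𝓡 2) x}
    (hX : ContMDiffOn (𝓡 2) (𝓡 2).tangent ∞ (fun x => (⟨x, X x⟩ : TangentBundle (𝓡 2) M)) U) :
    SmoothOn (fun y => α y (X y)) U := by
  intro x hx
  set O := (chartAt 𝔼 x).source ∩ U
  have hO : IsOpen O := (chartAt 𝔼 x).open_source.inter hU
  have hxO : x ∈ O := ⟨mem_chart_source 𝔼 x, hx⟩
  have hch : SmoothOn (fun y => id (chartAt 𝔼 x y)) O :=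
    smoothOn_comp_chart x (U := U) contDiff_id.contDiffOn
  have hw : SmoothOn (fun y => der (fun z => id (chartAt 𝔼 x z)) y (X y)) O :=
    hch.der_field hO (hX.mono Set.inter_subset_right)
  set w : M → 𝔼 := fun y => der (fun z => id (chartAt 𝔼 x z)) y (X y) with hwdef
  have hXw : ∀ y ∈ O, X y = coordField x (w y) y := by
    intro y hy
    obtain ⟨u, hu⟩ := (coordField_bijective x hy.1).2 (X y)
    have h1 := der_comp_chart (g := id) x hy.1 differentiableAt_id u
    rw [fderiv_id] at h1
    have h2 : w y = u := by
      rw [hwdef]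
      beta_reduce
      rw [← hu]
      exact h1
    rw [h2]
    exact hu.symm
  have hcoord : ∀ i, SmoothOn (fun y => w y i) O := fun i =>
    hw.comp_contDiffAt (g := fun v : 𝔼 => v i) fun y _ =>
      (EuclideanSpace.proj (𝕜 := ℝ) i).contDiff.contDiffAt
  have hα' : ∀ u, SmoothOn (fun y => α y (coordField x u y)) O := fun u =>
    (hα.smoothOn x u).mono Set.inter_subset_left
  have hmain : SmoothOn (fun y => α y (X y)) O := by
    refine SmoothOn.congr_on (((hcoord 0).fsmul (hα' (EuclideanSpace.single 0 1))).fadd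
      ((hcoord 1).fsmul (hα' (EuclideanSpace.single 1 1)))) fun y hy => ?_
    have h3 : w y = w y 0 • EuclideanSpace.single (0 : Fin 2) (1 : ℝ) +
        w y 1 • EuclideanSpace.single (1 : Fin 2) (1 : ℝ) := by
      ext i; fin_cases i <;> simp
    rw [hXw y hy]
    nth_rewrite 1 [h3]
    rw [coordField_add, coordField_smul, coordField_smul, map_add, map_smul, map_smul]
  exact (hmain.contMDiffAt (hO.mem_nhds hxO)).contMDiffWithinAt

/-- The compatibility, by closedness, of the off-diagonal parts of a potential along the two
curvature directions. -/
theorem IsPrincipalAt.coeff_add_eq_zero (hf : IsLegendre f) (hη : IsPotential f η) {U : Set M}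
    {e₁ e₂ : M → R42} {x : M} {X₁ X₂ : TangentSpace (𝓡 2) x}
    (h : IsPrincipalAt f U e₁ e₂ x X₁ X₂) {P Q R S : ℝ}
    (h₂ : η x X₂ (der e₁ x X₂) = P • e₁ x + Q • e₂ x)
    (h₁ : η x X₁ (der e₂ x X₁) = R • e₁ x + S • e₂ x) :
    Q * form (der e₂ x X₁) (der e₂ x X₁) + R * form (der e₁ x X₂) (der e₁ x X₂) = 0 := by
  have hxs : x ∈ (chartAt 𝔼 x).source := mem_chart_source 𝔼 x
  obtain ⟨u₁, rfl⟩ := (coordField_bijective x hxs).2 X₁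
  obtain ⟨u₂, rfl⟩ := (coordField_bijective x hxs).2 X₂
  set O := (chartAt 𝔼 x).source ∩ U
  have hO : IsOpen O := (chartAt 𝔼 x).open_source.inter h.frame.isOpen
  have hxO : x ∈ O := ⟨hxs, h.mem⟩
  have hOU : O ⊆ U := Set.inter_subset_right
  set n₁ : M → R42 := fun y => der e₁ y (coordField x u₂ y) with hn₁
  set n₂ : M → R42 := fun y => der e₂ y (coordField x u₁ y) with hn₂
  have sn₁ : SmoothOn n₁ O := h.frame.smooth₁.der_coordField h.frame.isOpen x u₂
  have sn₂ : SmoothOn n₂ O := h.frame.smooth₂.der_coordField h.frame.isOpen x u₁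
  have m₁ : ∀ y ∈ O, n₁ y ∈ perp (f y) := fun y hy =>
    hf.der_mem_perp (h.frame.section₁ (hOU hy)) _
  have m₂ : ∀ y ∈ O, n₂ y ∈ perp (f y) := fun y hy =>
    hf.der_mem_perp (h.frame.section₂ (hOU hy)) _
  have dn₁ := sn₁.diffAt hO hxO
  have dn₂ := sn₂.diffAt hO hxO
  have d₁ := h.frame.smooth₁.diffAt h.frame.isOpen h.mem
  have d₂ := h.frame.smooth₂.diffAt h.frame.isOpen h.mem
  have hz : ∀ Z, ∀ v ∈ f x, η x Z v = 0 := fun Z v hv =>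
    apply_eq_zero_of_mem (hf.isotropic x) (hη.mem x Z) hv
  have hskew : ∀ Z, IsSkew (η x Z) := fun Z => isSkew_of_mem (hη.mem x Z)
  -- The vector η_u n₁ lies in f and n₂ in f^⊥, so (η_u n₁, n₂) = 0 near x. Differentiating along v
  -- expresses a derivative of η through those of n₁ and n₂, and closedness equates the expressions
  -- for (u₁, u₂) and (u₂, u₁).
  have key : ∀ u v, form (der (fun y => η y (coordField x u y)) x (coordField x v x) (n₁ x))
      (n₂ x) = -form (η x (coordField x u x) (der n₁ x (coordField x v x))) (n₂ x) -
        form (η x (coordField x u x) (n₁ x)) (der n₂ x (coordField x v x)) := by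
    intro u v
    have sη : SmoothOn (fun y => η y (coordField x u y)) O :=
      (hη.smooth.smoothOn x u).mono Set.inter_subset_left
    have h0 : ∀ y ∈ O, form (η y (coordField x u y) (n₁ y)) (n₂ y) = 0 := fun y hy =>
      hf.form_eq_zero_of_mem_of_mem_perp (apply_mem_of_mem_perp (hη.mem y _) (m₁ y hy)) (m₂ y hy)
    have h1 := der_form ((sη.clm_app sn₁).diffAt hO hxO) dn₂ (coordField x v x)
    rw [der_eq_zero_of_eqOn hO hxO h0, der_apply (sη.diffAt hO hxO) dn₁] at h1
    simp only [map_add, LinearMap.add_apply] at h1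
    linarith
  have hcl := hη.closed x _ ((chartAt 𝔼 x).map_source hxs) u₁ u₂
  rw [extDer_eq hη.smooth x hxs, sub_eq_zero] at hcl
  have e := key u₂ u₁
  rw [hcl, key u₁ u₂] at e
  have c₁ : η x (coordField x u₁ x) (n₁ x) = 0 := by
    rw [hn₁, hη.apply_der_comm hf (h.frame.section₁ h.mem), hz _ _ h.curv₁]
  have c₂ : η x (coordField x u₂ x) (n₂ x) = 0 := by
    rw [hn₂, hη.apply_der_comm hf (h.frame.section₂ h.mem), hz _ _ h.curv₂]
  rw [hskew _ _ (n₂ x), hskew _ (der n₁ x _) (n₂ x), c₁, c₂] at e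
  have q₁ : ∀ v, form (e₁ x) (der n₂ x v) = -form (der e₁ x v) (n₂ x) := by
    intro v
    have h1 := der_form d₁ dn₂ v
    rw [der_eq_zero_of_eqOn hO hxO (c := 0) fun y hy => hf.form_eq_zero_of_mem_of_mem_perp
      (h.frame.mem₁ (hOU hy)) (m₂ y hy)] at h1
    linarith
  have q₂ : ∀ v, form (e₂ x) (der n₂ x v) = -form (der e₂ x v) (n₂ x) := by
    intro v
    have h1 := der_form d₂ dn₂ v
    rw [der_eq_zero_of_eqOn hO hxO (c := 0) fun y hy => hf.form_eq_zero_of_mem_of_mem_perp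
      (h.frame.mem₂ (hOU hy)) (m₂ y hy)] at h1
    linarith
  have q₃ : ∀ v, form (e₁ x) (der n₁ x v) = -form (der e₁ x v) (n₁ x) := by
    intro v
    have h1 := der_form d₁ dn₁ v
    rw [der_eq_zero_of_eqOn hO hxO (c := 0) fun y hy => hf.form_eq_zero_of_mem_of_mem_perp
      (h.frame.mem₁ (hOU hy)) (m₁ y hy)] at h1
    linarith
  have q₄ : ∀ v, form (e₂ x) (der n₁ x v) = -form (der e₂ x v) (n₁ x) := by
    intro v
    have h1 := der_form d₂ dn₁ v
    rw [der_eq_zero_of_eqOn hO hxO (c := 0) fun y hy => hf.form_eq_zero_of_mem_of_mem_perp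
      (h.frame.mem₂ (hOU hy)) (m₁ y hy)] at h1
    linarith
  have z₁ : form (der e₁ x (coordField x u₁ x)) (n₂ x) = 0 :=
    hf.form_eq_zero_of_mem_of_mem_perp h.curv₁ (m₂ x hxO)
  have z₂ : form (der e₂ x (coordField x u₂ x)) (n₁ x) = 0 :=
    hf.form_eq_zero_of_mem_of_mem_perp h.curv₂ (m₁ x hxO)
  have h₁' : η x (coordField x u₁ x) (n₂ x) = R • e₁ x + S • e₂ x := h₁
  have h₂' : η x (coordField x u₂ x) (n₁ x) = P • e₁ x + Q • e₂ x := h₂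
  rw [h₁', h₂', form_comm (der n₁ x _)] at e
  simp only [map_add, map_smul, map_zero, LinearMap.add_apply, LinearMap.smul_apply,
    LinearMap.zero_apply, smul_eq_mul, q₁, q₂, q₃, q₄, z₁, z₂] at e
  change Q * form (n₂ x) (n₂ x) + R * form (n₁ x) (n₁ x) = 0
  change - -(R * -form (n₁ x) (n₁ x) + S * -0) - 0 =
    - -0 - (P * -0 + Q * -form (n₂ x) (n₂ x)) at e
  linarith

/-- With n₁ = d_{X₂} e₁ and n₂ = d_{X₁} e₂, the two sides are Q / (n₁, n₁) and -R / (n₂, n₂) times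
e₁ ∧ e₂; `coeff_add_eq_zero` says that these coefficients agree. One correction thus serves both
curvature directions. -/
theorem IsPrincipalAt.gaugeAt_symm (hf : IsLegendre f) (hη : IsPotential f η) {U : Set M}
    {e₁ e₂ : M → R42} {x : M} {X₁ X₂ : TangentSpace (𝓡 2) x}
    (h : IsPrincipalAt f U e₁ e₂ x X₁ X₂) : gaugeAt η e₁ x X₂ = gaugeAt η e₂ x X₁ := by
  obtain ⟨P, Q, h₂⟩ := h.frame.exists_of_mem h.mem
    (apply_mem_of_mem_perp (hη.mem x X₂) (h.der_mem_perp₁ hf X₂))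
  obtain ⟨R, S, h₁⟩ := h.frame.exists_of_mem h.mem
    (apply_mem_of_mem_perp (hη.mem x X₁) (h.symm.der_mem_perp₁ hf X₁))
  have h0 := h.coeff_add_eq_zero hf hη h₂ h₁
  have p₁ := h.form_der_ne_zero hf
  have p₂ := h.symm.form_der_ne_zero hf
  rw [gaugeAt, gaugeAt, h₁, h₂]
  simp only [wedge_add_left, wedge_smul_left, wedge_self, wedge_swap (e₂ x) (e₁ x), smul_zero,
    zero_add, add_zero, smul_neg, smul_smul]
  match_scalars
  field_simp
  linear_combination h0

/-- The gauge term does not depend on the principal frame: any two principal frames at a point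
agree up to scale and order. -/
theorem IsPrincipalAt.gaugeAt_eq (hf : IsLegendre f) (hη : IsPotential f η) {U U' : Set M}
    {e₁ e₂ d₁ d₂ : M → R42} {x : M} {X₁ X₂ Y₁ Y₂ : TangentSpace (𝓡 2) x}
    (h : IsPrincipalAt f U e₁ e₂ x X₁ X₂) (h' : IsPrincipalAt f U' d₁ d₂ x Y₁ Y₂) :
    gaugeAt η d₂ x Y₁ = gaugeAt η e₂ x X₁ := by
  have hz : ∀ Z, ∀ v ∈ f x, η x Z v = 0 := fun Z v hv =>
    apply_eq_zero_of_mem (hf.isotropic x) (hη.mem x Z) hv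
  have p₁ := h.form_der_ne_zero hf
  have p₂ := h.symm.form_der_ne_zero hf
  have n12 := h.form_eq_zero hf
  -- Modulo f the derivative of a e₁ + b e₂ along s X₁ + t X₂ is a t d_{X₂} e₁ + b s d_{X₁} e₂, a
  -- combination of two independent vectors.
  have main : ∀ {d : M → R42} {a b : ℝ} {s t : ℝ}, IsSectionNear f x d →
      (∀ X, ∃ r ∈ f x, der d x X = a • der e₁ x X + b • der e₂ x X + r) →
      der d x (s • X₁ + t • X₂) ∈ f x → a * t = 0 ∧ b * s = 0 := by
    intro d a b s t hd hder hmem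
    obtain ⟨r, hr, hder⟩ := hder (s • X₁ + t • X₂)
    obtain ⟨r₁, hr₁, hd₁⟩ := h.exists_der₁ s t
    obtain ⟨r₂, hr₂, hd₂⟩ := h.symm.exists_der₁ t s
    rw [add_comm] at hd₂
    rw [hder, hd₁, hd₂] at hmem
    have k₁ := hf.form_der (h.frame.section₁ h.mem) X₂ hmem
    have k₂ := hf.form_der (h.frame.section₂ h.mem) X₁ hmem
    have z₁ : ∀ v ∈ f x, form (der e₁ x X₂) v = 0 := fun v hv =>
      hf.form_der (h.frame.section₁ h.mem) X₂ hv
    have z₂ : ∀ v ∈ f x, form (der e₂ x X₁) v = 0 := fun v hv =>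
      hf.form_der (h.frame.section₂ h.mem) X₁ hv
    simp only [map_add, map_smul, smul_eq_mul, n12, form_comm (der e₂ x X₁) (der e₁ x X₂),
      z₁ _ hr, z₁ _ hr₁, z₁ _ hr₂, z₂ _ hr, z₂ _ hr₁, z₂ _ hr₂] at k₁ k₂
    constructor
    · exact (mul_eq_zero.mp (by linarith : a * t * form (der e₁ x X₂) (der e₁ x X₂) = 0)).resolve_right p₁
    · exact (mul_eq_zero.mp (by linarith : b * s * form (der e₂ x X₁) (der e₂ x X₁) = 0)).resolve_right p₂
  obtain ⟨a₁, b₁, hd₁, hder₁⟩ := h.frame.exists_der h.mem (h'.frame.section₁ h'.mem)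
  obtain ⟨a₂, b₂, hd₂, hder₂⟩ := h.frame.exists_der h.mem (h'.frame.section₂ h'.mem)
  obtain ⟨s₁, t₁, hY₁⟩ := exists_smul_add_smul h.indep Y₁
  obtain ⟨s₂, t₂, hY₂⟩ := exists_smul_add_smul h.indep Y₂
  obtain ⟨i₁, j₁⟩ := main (h'.frame.section₁ h'.mem) hder₁ (hY₁ ▸ h'.curv₁)
  obtain ⟨i₂, j₂⟩ := main (h'.frame.section₂ h'.mem) hder₂ (hY₂ ▸ h'.curv₂)
  have hY₁0 : Y₁ ≠ 0 := h'.indep.ne_zero 0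
  have hY₂0 : Y₂ ≠ 0 := h'.indep.ne_zero 1
  have hd₁0 : d₁ x ≠ 0 := (isPrincipalAt_ne_zero h').1
  have hind := LinearIndependent.pair_iff.mp (h'.frame.indep x h'.mem)
  -- For a₁ = 0 the second frame lists the curvature spheres in the opposite order and
  -- `gaugeAt_symm` is needed; otherwise the frames differ by scaling at x.
  by_cases ha : a₁ = 0
  · have hb : b₁ ≠ 0 := by
      rintro rfl
      exact hd₁0 (by rw [hd₁, ha]; simp)
    have hs₁ : s₁ = 0 := (mul_eq_zero.mp j₁).resolve_left hb
    have ht₁ : t₁ ≠ 0 := by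
      rintro rfl
      exact hY₁0 (by rw [hY₁, hs₁]; simp)
    have ha₂ : a₂ ≠ 0 := by
      rintro rfl
      exact hb (neg_eq_zero.mp (hind b₂ (-b₁) (by rw [hd₁, hd₂, ha]; module)).2)
    have ht₂ : t₂ = 0 := (mul_eq_zero.mp i₂).resolve_left ha₂
    have hs₂ : s₂ ≠ 0 := by
      rintro rfl
      exact hY₂0 (by rw [hY₂, ht₂]; simp)
    have hb₂ : b₂ = 0 := (mul_eq_zero.mp j₂).resolve_right hs₂
    obtain ⟨r, hr, hder⟩ := hder₂ X₂
    rw [hb₂, zero_smul, add_zero] at hd₂ hder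
    rw [gaugeAt_congr hf hz (h.frame.section₁ h.mem) ha₂ ht₁ hd₂ (by rw [hY₁, hs₁]; simp) hr hder,
      h.gaugeAt_symm hf hη]
  · have ht₁ : t₁ = 0 := (mul_eq_zero.mp i₁).resolve_left ha
    have hs₁ : s₁ ≠ 0 := by
      rintro rfl
      exact hY₁0 (by rw [hY₁, ht₁]; simp)
    have hb₁ : b₁ = 0 := (mul_eq_zero.mp j₁).resolve_right hs₁
    have hb₂ : b₂ ≠ 0 := by
      rintro rfl
      exact ha (neg_eq_zero.mp (hind a₂ (-a₁) (by rw [hd₁, hd₂, hb₁]; module)).2)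
    have hs₂ : s₂ = 0 := (mul_eq_zero.mp j₂).resolve_left hb₂
    have ht₂ : t₂ ≠ 0 := by
      rintro rfl
      exact hY₂0 (by rw [hY₂, hs₂]; simp)
    have ha₂ : a₂ = 0 := (mul_eq_zero.mp i₂).resolve_right ht₂
    obtain ⟨r, hr, hder⟩ := hder₂ X₁
    rw [ha₂, zero_smul, zero_add] at hd₂ hder
    exact gaugeAt_congr hf hz (h.frame.section₂ h.mem) hb₂ hs₁ hd₂ (by rw [hY₁, ht₁]; simp) hr hder

/-- `τ` is a smooth section of `∧² f`. -/
def IsBivectorField (f : M → Submodule ℝ R42) (τ : M → EndR42) : Prop :=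
  ∀ x, ∃ (U : Set M) (ρ σ : M → R42), IsOpen U ∧ x ∈ U ∧ SmoothOn ρ U ∧ SmoothOn σ U ∧
    ∀ y ∈ U, ρ y ∈ f y ∧ σ y ∈ f y ∧ τ y = wedge (ρ y) (σ y)

/-- The gauge transformation is given globally by a section of `∧² f`. -/
theorem exists_gauge (hf : IsLegendre f) (hu : IsUmbilicFree f) (hη : IsPotential f η) :
    ∃ τ : M → EndR42, IsBivectorField f τ ∧ ∀ {x : M} {U : Set M} {e₁ e₂ : M → R42}
      {X₁ X₂ : TangentSpace (𝓡 2) x}, IsPrincipalAt f U e₁ e₂ x X₁ X₂ →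
        τ x = gaugeAt η e₂ x X₁ := by
  choose U e₁ e₂ X₁ X₂ h using exists_isPrincipalAt hf hu
  refine ⟨fun x => gaugeAt η (e₂ x) x (X₁ x), fun x => ?_, fun h' => h'.gaugeAt_eq hf hη (h _)⟩
  -- The pointwise chosen frames need not vary smoothly. Independence of the frame allows τ to be
  -- computed in a smooth curvature frame.
  obtain ⟨W, σ₁, σ₂, Y₁, Y₂, hW, hx, hfr⟩ := exists_isCurvatureFrame hf hu x
  have hn : SmoothOn (fun y => der σ₂ y (Y₁ y)) W := hfr.symm.smooth_der₁ hW
  refine ⟨W, fun y => -(form (der σ₂ y (Y₁ y)) (der σ₂ y (Y₁ y)))⁻¹ •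
    η y (Y₁ y) (der σ₂ y (Y₁ y)), σ₂, hW, hx, ?_, hfr.smooth₂, fun y hy => ?_⟩
  · exact (SmoothOn.inv (hn.form hn)
      fun y hy => (hfr.isPrincipalAt hW hy).symm.form_der_ne_zero hf).fneg.fsmul
      ((hη.smooth.smoothOn_field hW hfr.smooth_field₁).clm_app hn)
  · have hP := hfr.isPrincipalAt hW hy
    refine ⟨(f y).smul_mem _ (apply_mem_of_mem_perp (hη.mem y _) (hP.symm.der_mem_perp₁ hf _)),
      hP.frame.mem₂ hy, ?_⟩
    rw [wedge_smul_left]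
    exact hP.gaugeAt_eq hf hη (h y)

end Gauge

theorem wedge_ne_zero {a b : R42} (h : LinearIndependent ℝ ![a, b]) : wedge a b ≠ 0 := by
  intro h0
  refine h.ne_zero 0 (form_eq_zero_of_forall fun v => ?_)
  have h1 := congrArg (fun T : EndR42 => T v) h0
  simp only [wedge_apply, zero_apply] at h1
  exact (LinearIndependent.pair_iff.mp h (-form b v) (form a v) (by rw [← h1]; module)).2

theorem apply_mem_of_mem_wedge_self {F : Submodule ℝ R42} {T : EndR42} (hT : T ∈ wedgeSpan F F)
    (v : R42) : T v ∈ F := by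
  refine wedgeSpan_induction hT (mapsSubmodule ⊤ F) (fun a ha b hb u _ => ?_) v trivial
  rw [wedge_apply]
  exact F.sub_mem (F.smul_mem _ hb) (F.smul_mem _ ha)

/-! ### Gauging to the middle potential and lifting Guichard surfaces -/

section MiddlePotential

variable {M : Type*} [TopologicalSpace M] [ChartedSpace (EuclideanSpace ℝ (Fin 2)) M]

local notation "𝔼" => EuclideanSpace ℝ (Fin 2)

variable {f : M → Submodule ℝ R42} {η : OneForm M EndR42} {τ : M → EndR42}

namespace IsBivectorField

theorem smooth (hτ : IsBivectorField f τ) : SmoothOn τ Set.univ := by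
  intro x _
  obtain ⟨U, ρ, σ, hU, hx, hρ, hσ, h⟩ := hτ x
  have h1 : SmoothOn τ U := SmoothOn.congr_on (hρ.wedge hσ) fun y hy => (h y hy).2.2
  exact (h1.contMDiffAt (hU.mem_nhds hx)).contMDiffWithinAt

theorem mem (hτ : IsBivectorField f τ) (x : M) : τ x ∈ wedgeSpan (f x) (f x) := by
  obtain ⟨U, ρ, σ, hU, hx, hρ, hσ, h⟩ := hτ x
  obtain ⟨h1, h2, h3⟩ := h x hx
  exact h3 ▸ wedge_mem_wedgeSpan h1 h2

theorem diffAt (hτ : IsBivectorField f τ) (x : M) : DiffAt τ x :=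
  hτ.smooth.diffAt isOpen_univ trivial

/-- For τ = g e₁ ∧ e₂ the derivative of g only contributes a multiple of e₁ ∧ e₂, which kills f^⊥.
There dτ acts as g (de₁ ∧ e₂ + e₁ ∧ de₂). -/
theorem exists_der (hτ : IsBivectorField f τ) (hf : IsLegendre f) {U : Set M} {e₁ e₂ : M → R42}
    (he : IsFrame₂ f U e₁ e₂) {x : M} (hx : x ∈ U) :
    ∃ g : ℝ, τ x = g • wedge (e₁ x) (e₂ x) ∧ ∀ X, der τ x X ∈ wedgeSpan (f x) (perp (f x)) ∧
      ∀ v ∈ perp (f x), der τ x X v =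
        g • (form (der e₁ x X) v • e₂ x - form (der e₂ x X) v • e₁ x) := by
  obtain ⟨W, ρ, σ, hW, hxW, sρ, sσ, h⟩ := hτ x
  have hρ : IsSectionNear f x ρ := ⟨W, hW, hxW, sρ, fun y hy => (h y hy).1⟩
  have hσ : IsSectionNear f x σ := ⟨W, hW, hxW, sσ, fun y hy => (h y hy).2.1⟩
  obtain ⟨a₁, b₁, hρx, hdρ⟩ := he.exists_der hx hρ
  obtain ⟨a₂, b₂, hσx, hdσ⟩ := he.exists_der hx hσ
  have hder : ∀ X, der τ x X = wedge (der ρ x X) (σ x) + wedge (ρ x) (der σ x X) := fun X => by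
    rw [der_congr hW hxW (fun y hy => (h y hy).2.2), der_wedge hρ.diffAt hσ.diffAt]
  refine ⟨a₁ * b₂ - a₂ * b₁, ?_, fun X => ⟨?_, fun v hv => ?_⟩⟩
  · rw [(h x hxW).2.2, hρx, hσx]
    simp only [wedge_add_left, wedge_add_right, wedge_smul_left, wedge_smul_right, wedge_self,
      wedge_swap (e₂ x) (e₁ x)]
    module
  · rw [hder, wedge_swap (der ρ x X)]
    exact Submodule.add_mem _ (Submodule.neg_mem _ (wedge_mem_wedgeSpan hσ.mem
      (hf.der_mem_perp hρ X))) (wedge_mem_wedgeSpan hρ.mem (hf.der_mem_perp hσ X))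
  · obtain ⟨r₁, hr₁, hd₁⟩ := hdρ X
    obtain ⟨r₂, hr₂, hd₂⟩ := hdσ X
    have hz : ∀ w ∈ f x, form w v = 0 := fun w hw => hf.form_eq_zero_of_mem_of_mem_perp hw hv
    rw [hder, add_apply, wedge_apply, wedge_apply, hz _ hσ.mem, hz _ hρ.mem, hd₁, hd₂, hρx, hσx]
    simp only [map_add, map_smul, LinearMap.add_apply, LinearMap.smul_apply, smul_eq_mul,
      hz _ hr₁, hz _ hr₂]
    module

end IsBivectorField

/-- The potential obtained from `η` by the gauge transformation `exp τ`. -/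
def gaugedForm (η : OneForm M EndR42) (τ : M → EndR42) : OneForm M EndR42 :=
  fun x => (1 : ℝ) • η x + (-1 : ℝ) • der τ x

theorem gaugedForm_apply (η : OneForm M EndR42) (τ : M → EndR42) (x : M)
    (X : TangentSpace (𝓡 2) x) : gaugedForm η τ x X = η x X - der τ x X := by
  change (1 : ℝ) • η x X + (-1 : ℝ) • der τ x X = _
  module

theorem gaugedForm_mem (hf : IsLegendre f) (hη : IsPotential f η) (hτ : IsBivectorField f τ)
    (x : M) (X : TangentSpace (𝓡 2) x) :
    gaugedForm η τ x X ∈ wedgeSpan (f x) (perp (f x)) := by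
  obtain ⟨U, e₁, e₂, he, hx⟩ := hf.smooth.exists_frame₂ x
  obtain ⟨g, -, hd⟩ := hτ.exists_der hf he hx
  rw [gaugedForm_apply]
  exact Submodule.sub_mem _ (hη.mem x X) (hd X).1

variable [IsManifold (𝓡 2) ∞ M]

theorem isSmoothForm_gaugedForm (hη : IsPotential f η) (hτ : IsBivectorField f τ) :
    IsSmoothForm (gaugedForm η τ) := hη.smooth.lin (isSmoothForm_der hτ.smooth) 1 (-1)

theorem isClosedForm_gaugedForm (hη : IsPotential f η) (hτ : IsBivectorField f τ) :
    IsClosedForm (gaugedForm η τ) := by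
  intro x₀ y hy u v
  have h1 := extDer_lin hη.smooth (isSmoothForm_der hτ.smooth) 1 (-1) hy u v
  have h2 := extDer_der hτ.smooth x₀ ((chartAt 𝔼 x₀).map_target hy) u v
  rw [(chartAt 𝔼 x₀).right_inv hy] at h2
  rw [hη.closed x₀ y hy, h2, smul_zero, smul_zero, add_zero] at h1
  exact h1

/-- The quadratic differential is invariant under gauge transformations. -/
theorem IsQuadraticDifferential.gaugedForm {q : BiForm M} (hf : IsLegendre f)
    (hη : IsPotential f η) (hτ : IsBivectorField f τ) (hq : IsQuadraticDifferential f η q) :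
    IsQuadraticDifferential f (gaugedForm η τ) q := by
  intro x X Y
  obtain ⟨U, e₁, e₂, he, hx⟩ := hf.smooth.exists_frame₂ x
  obtain ⟨g, -, hd⟩ := hτ.exists_der hf he hx
  have s₁ := he.section₁ hx
  have s₂ := he.section₂ hx
  obtain ⟨m₁₁, m₁₂, h₁⟩ := he.exists_of_mem hx
    (apply_mem_of_mem_perp (hη.mem x X) (hf.der_mem_perp s₁ Y))
  obtain ⟨m₂₁, m₂₂, h₂⟩ := he.exists_of_mem hx
    (apply_mem_of_mem_perp (hη.mem x X) (hf.der_mem_perp s₂ Y))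
  have hq' := (he.isFibreTrace_iff hx (fun v hv => apply_eq_zero_of_mem (hf.isotropic x)
    (hη.mem x X) hv) h₁ h₂).mp (hq x X Y)
  refine (he.isFibreTrace_iff hx (fun v hv => apply_eq_zero_of_mem (hf.isotropic x)
    (gaugedForm_mem hf hη hτ x X) hv)
    (m₁₁ := m₁₁ + g * form (der e₂ x X) (der e₁ x Y))
    (m₁₂ := m₁₂ - g * form (der e₁ x X) (der e₁ x Y))
    (m₂₁ := m₂₁ + g * form (der e₂ x X) (der e₂ x Y))
    (m₂₂ := m₂₂ - g * form (der e₁ x X) (der e₂ x Y)) ?_ ?_).mpr ?_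
  · rw [gaugedForm_apply, sub_apply, h₁, (hd X).2 _ (hf.der_mem_perp s₁ Y)]
    module
  · rw [gaugedForm_apply, sub_apply, h₂, (hd X).2 _ (hf.der_mem_perp s₂ Y)]
    module
  -- The trace changes by g ((d_X e₂, d_Y e₁) - (d_X e₁, d_Y e₂)), zero by symmetry of the second
  -- fundamental form.
  · rw [hq', hf.form_der_der_comm s₁ s₂ X Y, form_comm (der e₁ x Y)]
    ring

/-- In a principal frame, the gauged potential has no mixed component. -/
theorem IsPrincipalAt.exists_gaugedForm (hf : IsLegendre f) (hη : IsPotential f η)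
    (hτ : IsBivectorField f τ) {U : Set M} {e₁ e₂ : M → R42} {x : M}
    {X₁ X₂ : TangentSpace (𝓡 2) x} (h : IsPrincipalAt f U e₁ e₂ x X₁ X₂)
    (hg : τ x = gaugeAt η e₂ x X₁) :
    gaugedForm η τ x X₁ (der e₁ x X₂) = 0 ∧
    ∃ β γ : ℝ, gaugedForm η τ x X₁ =
      β • wedge (e₂ x) (der e₂ x X₁) + γ • wedge (e₁ x) (e₂ x) := by
  have s₁ := h.frame.section₁ h.mem
  have s₂ := h.frame.section₂ h.mem
  have p₁ := h.form_der_ne_zero hf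
  have p₂ := h.symm.form_der_ne_zero hf
  have n12 := h.form_eq_zero hf
  have n21 := n12
  rw [form_comm] at n21
  have m₁ := hf.der_mem_perp s₁ X₂
  have m₂ := hf.der_mem_perp s₂ X₁
  have hi := h.frame.indep x h.mem
  obtain ⟨g, hτx, hd⟩ := hτ.exists_der hf h.frame h.mem
  obtain ⟨R, S, h₁⟩ := h.frame.exists_of_mem h.mem (apply_mem_of_mem_perp (hη.mem x X₁) m₂)
  -- This value of g is what defines `gaugeAt`: subtracting dτ adds g (n₂, n₂) e₁ to η_{X₁} n₂ with
  -- n₂ = d_{X₁} e₂, cancelling its e₁-component R e₁.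
  have hgR : g * form (der e₂ x X₁) (der e₂ x X₁) = -R := by
    rw [hτx, gaugeAt, h₁, wedge_add_left, wedge_smul_left, wedge_smul_left, wedge_self, smul_zero,
      add_zero, smul_smul] at hg
    have := smul_left_injective ℝ (wedge_ne_zero hi) hg
    rw [this]
    field_simp
  have v₁ : gaugedForm η τ x X₁ (der e₁ x X₂) = 0 := by
    rw [gaugedForm_apply, sub_apply, (hd X₁).2 _ m₁, hη.apply_der_comm hf s₁,
      apply_eq_zero_of_mem (hf.isotropic x) (hη.mem x X₂) h.curv₁, n21,
      hf.form_eq_zero_of_mem_of_mem_perp h.curv₁ m₁]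
    simp
  have v₂ : gaugedForm η τ x X₁ (der e₂ x X₁) = S • e₂ x := by
    rw [gaugedForm_apply, sub_apply, (hd X₁).2 _ m₂, h₁,
      hf.form_eq_zero_of_mem_of_mem_perp h.curv₁ m₂, zero_smul, zero_sub, smul_neg, smul_smul, hgR]
    module
  refine ⟨v₁, ?_⟩
  -- Vanishing at d_{X₂} e₁ removes α and ε; the absence of an e₁-component at d_{X₁} e₂ removes δ.
  obtain ⟨α, β, γ, δ, ε, hT⟩ := h.exists_wedge hf (gaugedForm_mem hf hη hτ x X₁)
  have z : ∀ v ∈ perp (f x), form (e₁ x) v = 0 ∧ form (e₂ x) v = 0 := fun v hv =>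
    ⟨hf.form_eq_zero_of_mem_of_mem_perp (h.frame.mem₁ h.mem) hv,
      hf.form_eq_zero_of_mem_of_mem_perp (h.frame.mem₂ h.mem) hv⟩
  rw [hT] at v₁ v₂
  simp only [add_apply, smul_apply, wedge_apply, (z _ m₁).1, (z _ m₁).2, n21] at v₁
  simp only [add_apply, smul_apply, wedge_apply, (z _ m₂).1, (z _ m₂).2, n12] at v₂
  have w₁ := LinearIndependent.pair_iff.mp hi
    (α * form (der e₁ x X₂) (der e₁ x X₂)) (ε * form (der e₁ x X₂) (der e₁ x X₂))
    (by rw [← neg_eq_zero, ← v₁]; module)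
  have w₂ := LinearIndependent.pair_iff.mp hi
    (δ * form (der e₂ x X₁) (der e₂ x X₁)) (S + β * form (der e₂ x X₁) (der e₂ x X₁))
    (by rw [add_smul, ← v₂]; module)
  have hα := (mul_eq_zero.mp w₁.1).resolve_right p₁
  have hε := (mul_eq_zero.mp w₁.2).resolve_right p₁
  have hδ := (mul_eq_zero.mp w₂.1).resolve_right p₂
  refine ⟨β, γ, ?_⟩
  rw [hT, hα, hε, hδ]
  module

/-- The gauged potential is a middle potential. -/
theorem isMiddlePotential_gaugedForm (hf : IsLegendre f) (hu : IsUmbilicFree f)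
    (hη : IsPotential f η) (hτ : IsBivectorField f τ)
    (hg : ∀ {x : M} {U : Set M} {e₁ e₂ : M → R42} {X₁ X₂ : TangentSpace (𝓡 2) x},
      IsPrincipalAt f U e₁ e₂ x X₁ X₂ → τ x = gaugeAt η e₂ x X₁) :
    IsMiddlePotential f (gaugedForm η τ) where
  smooth := isSmoothForm_gaugedForm hη hτ
  mem := gaugedForm_mem hf hη hτ
  closed := isClosedForm_gaugedForm hη hτ
  bracket x X Y := by
    obtain ⟨U, e₁, e₂, X₁, X₂, h⟩ := exists_isPrincipalAt hf hu x
    obtain ⟨v₁, -⟩ := h.exists_gaugedForm hf hη hτ (hg h)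
    obtain ⟨-, α, γ, h₂⟩ := h.symm.exists_gaugedForm hf hη hτ (hg h.symm)
    have hz : ∀ v ∈ f x, gaugedForm η τ x X₁ v = 0 := fun v hv =>
      apply_eq_zero_of_mem (hf.isotropic x) (gaugedForm_mem hf hη hτ x X₁) hv
    have hsk := isSkew_of_mem (gaugedForm_mem hf hη hτ x X₁)
    -- The gauged form along X₁ kills e₁, e₂ and d_{X₂} e₁, from which its value along X₂ is built,
    -- so the two endomorphisms commute.
    have key : gaugedForm η τ x X₁ * gaugedForm η τ x X₂ -
        gaugedForm η τ x X₂ * gaugedForm η τ x X₁ = 0 := by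
      have k₁ := hsk.commutator_wedge (e₁ x) (der e₁ x X₂)
      have k₂ := hsk.commutator_wedge (e₂ x) (e₁ x)
      rw [hz _ (h.frame.mem₁ h.mem), v₁, wedge_zero_left, wedge_zero_right, add_zero] at k₁
      rw [hz _ (h.frame.mem₁ h.mem), hz _ (h.frame.mem₂ h.mem), wedge_zero_left,
        wedge_zero_right, add_zero] at k₂
      have e : gaugedForm η τ x X₁ * gaugedForm η τ x X₂ -
          gaugedForm η τ x X₂ * gaugedForm η τ x X₁ =
          α • (gaugedForm η τ x X₁ * wedge (e₁ x) (der e₁ x X₂) -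
            wedge (e₁ x) (der e₁ x X₂) * gaugedForm η τ x X₁) +
          γ • (gaugedForm η τ x X₁ * wedge (e₂ x) (e₁ x) -
            wedge (e₂ x) (e₁ x) * gaugedForm η τ x X₁) := by
        rw [h₂, mul_add, add_mul, mul_smul_comm, mul_smul_comm, smul_mul_assoc, smul_mul_assoc]
        module
      rw [e, k₁, k₂, smul_zero, smul_zero, add_zero]
    obtain ⟨a, b, rfl⟩ := exists_smul_add_smul h.indep X
    obtain ⟨c, d, rfl⟩ := exists_smul_add_smul h.indep Y
    rw [map_add, map_add, map_smul, map_smul, map_smul, map_smul]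
    have e : ∀ S T : EndR42, (a • S + b • T) * (c • S + d • T) - (c • S + d • T) * (a • S + b • T) =
        (a * d - b * c) • (S * T - T * S) := by
      intro S T
      simp only [mul_add, add_mul, mul_smul_comm, smul_mul_assoc]
      module
    rw [e, key, smul_zero]
  middle x := by
    obtain ⟨U, σ₁, σ₂, X₁, X₂, hU, hx, hfr⟩ := exists_isCurvatureFrame hf hu x
    refine ⟨U, σ₁, σ₂, X₁, X₂, hU, hx, hfr, fun Z => ?_⟩
    have h := hfr.isPrincipalAt hU hx
    obtain ⟨-, β, γ₁, h₁⟩ := h.exists_gaugedForm hf hη hτ (hg h)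
    obtain ⟨-, α, γ₂, h₂⟩ := h.symm.exists_gaugedForm hf hη hτ (hg h.symm)
    obtain ⟨a, b, rfl⟩ := exists_smul_add_smul h.indep Z
    have c₁ : σ₁ x ∈ cyclideSpace σ₁ X₂ x := Submodule.subset_span (by simp)
    have c₁' : der σ₁ x (X₂ x) ∈ cyclideSpace σ₁ X₂ x := Submodule.subset_span (by simp)
    have c₂ : σ₂ x ∈ cyclideSpace σ₂ X₁ x := Submodule.subset_span (by simp)
    have c₂' : der σ₂ x (X₁ x) ∈ cyclideSpace σ₂ X₁ x := Submodule.subset_span (by simp)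
    refine ⟨(b * α) • wedge (σ₁ x) (der σ₁ x (X₂ x)) + (a * β) • wedge (σ₂ x) (der σ₂ x (X₁ x)),
      Submodule.add_mem_sup (Submodule.smul_mem _ _ (wedge_mem_wedgeSpan c₁ c₁'))
        (Submodule.smul_mem _ _ (wedge_mem_wedgeSpan c₂ c₂')),
      (a * γ₁ - b * γ₂) • wedge (σ₁ x) (σ₂ x), Submodule.smul_mem _ _ (wedge_mem_wedgeSpan c₁ c₂),
      ?_, Submodule.smul_mem _ _ (wedge_mem_wedgeSpan (h.frame.mem₁ hx) (h.frame.mem₂ hx))⟩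
    rw [map_add, map_smul, map_smul, h₁, h₂, wedge_swap (σ₂ x) (σ₁ x)]
    module

/-- Non-channel Guichard surfaces lift to special Omega-surfaces of type 1. -/
theorem IsGuichard.exists_isOmegaSurface [Nonempty M] {𝔭 : R42} {Λ : M → Submodule ℝ R42}
    {p : M → R42} {χ : OneForm M EndR42} {q : BiForm M}
    (h : IsGuichard 𝔭 Λ (perpBundle 𝔭 p) χ)
    (hp : IsNullField 𝔭 p (form 𝔭 𝔭) (form 𝔭 𝔭))
    (hq : IsGuichardDifferential Λ (perpBundle 𝔭 p) χ q) (hn : IsNondegenerate q)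
    (hf : IsLegendre fun x => Λ x ⊔ Submodule.span ℝ {p x})
    (hu : IsUmbilicFree fun x => Λ x ⊔ Submodule.span ℝ {p x}) :
    ∃ (η : OneForm M EndR42) (p' : Fin (1 + 1) → M → R42),
      IsOmegaSurface (fun x => Λ x ⊔ Submodule.span ℝ {p x}) η q ∧ IsConservedQuantity η 1 p' ∧
      (∀ x, p' 0 x = 𝔭) ∧ ∀ (x : M) (t : ℝ),
        form (evalPoly p' t x) (evalPoly p' t x) = form 𝔭 𝔭 * (1 + 2 * t) := by
  have hL := h.isGuichardLift hp hf
  have hη := hL.isPotential h.smooth h.flat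
  have hqd := hL.isQuadraticDifferential hq
  simp only [div_self h.nonnull, one_mul] at hqd
  obtain ⟨τ, hτ, hg⟩ := exists_gauge hf hu hη
  set η : OneForm M EndR42 := fun x => (2 : ℝ) • χ x + (-(form 𝔭 𝔭)⁻¹) • wedgeDer p p x
  -- The new top coefficient is p + τ𝔭: its derivative is -η𝔭 + (dτ)𝔭 = -(η - dτ)𝔭, it lies in f,
  -- where the gauged form vanishes, and (𝔭, τ𝔭) = 0 by skewness.
  have hmem : ∀ x, p x + τ x 𝔭 ∈ Λ x ⊔ Submodule.span ℝ {p x} := fun x =>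
    Submodule.add_mem _ (hL.mem x) (apply_mem_of_mem_wedge_self (hτ.mem x) 𝔭)
  have hform : ∀ x, form 𝔭 (p x + τ x 𝔭) = form 𝔭 𝔭 := fun x => by
    rw [map_add, hp.form_eq, form_comm 𝔭 (τ x 𝔭), (isSkew_of_mem (hτ.mem x)).form_self, add_zero]
  have hsm : SmoothOn (fun x => p x + τ x 𝔭) Set.univ :=
    hp.smooth.fadd (hτ.smooth.clm_app (smoothOn_const 𝔭 _))
  have hsm' : ∀ k, ContMDiff (𝓡 2) 𝓘(ℝ, R42) ∞
      ((![fun _ => 𝔭, fun x => p x + τ x 𝔭] : Fin (1 + 1) → M → R42) k) := by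
    intro k
    fin_cases k
    · exact contMDiff_const
    · exact contMDiffOn_univ.mp hsm
  refine ⟨gaugedForm η τ, ![fun _ => 𝔭, fun x => p x + τ x 𝔭],
    ⟨hf, hu, isMiddlePotential_gaugedForm hf hu hη hτ hg, hqd.gaugedForm hf hη hτ, hn⟩,
    ⟨hsm', fun h0 => ?_, (IsConservedQuantity.parallel_iff hsm').mpr fun x X => ⟨?_, ?_, ?_⟩⟩,
    fun _ => rfl, fun x t => ?_⟩
  · obtain ⟨x⟩ := (inferInstance : Nonempty M)
    have h1 : p x + τ x 𝔭 = 0 := congrFun h0 x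
    exact h.nonnull (by rw [← hform x, h1, map_zero])
  · exact der_const 𝔭 x X
  · change der (fun x => p x + τ x 𝔭) x X = - gaugedForm η τ x X 𝔭
    have hd : DiffAt (fun y => τ y 𝔭) x :=
      (hτ.smooth.clm_app (smoothOn_const 𝔭 _)).diffAt isOpen_univ trivial
    rw [der_add (hp.diffAt x) hd, der_apply (hτ.diffAt x) mdifferentiableAt_const, der_const,
      map_zero, add_zero, gaugedForm_apply, sub_apply, hL.potential_const]
    module
  · exact apply_eq_zero_of_mem (hf.isotropic x) (gaugedForm_mem hf hη hτ x X) (hmem x)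
  · rw [form_evalPoly_one]
    change form 𝔭 𝔭 + 2 * form 𝔭 (p x + τ x 𝔭) * t +
      form (p x + τ x 𝔭) (p x + τ x 𝔭) * t ^ 2 = _
    rw [hform, hf.form_eq_zero (hmem x) (hmem x)]
    ring

end MiddlePotential

end LieSphere

end

theorem mainTheorem2 (M : Type*) [TopologicalSpace M] [ConnectedSpace M]
    [ChartedSpace (EuclideanSpace ℝ (Fin 2)) M] [IsManifold (𝓡 2) ∞ M] :
    -- special Omega-surfaces of type 1 project to non-channel Guichard surfaces
    (∀ (f : M → Submodule ℝ R42) (η : OneForm M EndR42) (q : BiForm M)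
        (p : Fin (1 + 1) → M → R42),
      IsOmegaSurface f η q → IsConservedQuantity η 1 p →
      (∀ x, ∃ a b : ℝ, a ≠ 0 ∧ b ≠ 0 ∧
        ∀ t : ℝ, form (evalPoly p t x) (evalPoly p t x) = a + b * t) →
      ∃ (𝔭 : R42) (a b : ℝ), (∀ x, p 0 x = 𝔭) ∧ a ≠ 0 ∧ b ≠ 0 ∧
        (∀ (x : M) (t : ℝ), form (evalPoly p t x) (evalPoly p t x) = a + b * t) ∧
        ∃ (V s : M → Submodule ℝ R42) (χ : OneForm M EndR42),
          IsGuichard 𝔭 (fun x => f x ⊓ vperp 𝔭) V χ ∧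
          IsNullNormal V s ∧ (∀ x, f x = (f x ⊓ vperp 𝔭) ⊔ s x) ∧
          IsGuichardDifferential (fun x => f x ⊓ vperp 𝔭) V χ
            (fun x X Y => 2 * a / b * q x X Y) ∧
          IsNondegenerate (fun x X Y => 2 * a / b * q x X Y : BiForm M)) ∧
    -- and conversely
    (∀ (𝔭 : R42) (Λ V s : M → Submodule ℝ R42) (χ : OneForm M EndR42) (q : BiForm M),
      IsGuichard 𝔭 Λ V χ → IsGuichardDifferential Λ V χ q → IsNondegenerate q →
      IsNullNormal V s →
      (Immerses Λ → IsLegendre (fun x => Λ x ⊔ s x)) ∧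
      (IsLegendre (fun x => Λ x ⊔ s x) → IsUmbilicFree (fun x => Λ x ⊔ s x) →
        (∀ x, (Λ x ⊔ s x) ⊓ vperp 𝔭 = Λ x) ∧
        ∃ (η : OneForm M EndR42) (p : Fin (1 + 1) → M → R42),
          IsOmegaSurface (fun x => Λ x ⊔ s x) η q ∧ IsConservedQuantity η 1 p ∧
          (∀ x, p 0 x = 𝔭) ∧
          ∀ (x : M) (t : ℝ),
            form (evalPoly p t x) (evalPoly p t x) = form 𝔭 𝔭 * (1 + 2 * t))) := by
  refine ⟨fun f η q p h hp hab => h.exists_isGuichard hp hab, fun 𝔭 Λ V s χ q h hq hn hs => ?_⟩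
  -- The normalised null field p determines both V and s, which are eliminated in its favour.
  obtain ⟨p, hp, rfl, rfl⟩ := h.sphere.exists_nullField h.nonnull hs
  exact ⟨hp.isLegendre_sup h.pointMap h.envelops, fun hf hu =>
    ⟨hp.sup_inter h.pointMap, h.exists_isOmegaSurface hp hq hn hf hu⟩⟩
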